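/- **Setting.** Let $N\ge 2$, and write $B_s(x)$ for the open ball of $\mathbb{R}^N$, $\pi=\{y\in\mathbb{R}^N: y_N=0\}$ and $\pi^+=\{y\in\mathbb{R}^N: y_N=0,\ y_{N-1}\ge 0\}$. Let $r,L>0$. *Lipschitz hypersurfaces.* A compact set $S\subset\mathbb{R}^N$ is a Lipschitz hypersurface with constants $r$ and $L$ if for every $x\in S$ there is a map $\Phi_x:B_r(x)\to\mathbb{R}^N$ such that a) $L^{-1}\|z_1-z_2\|\le\|\Phi_x(z_1)-\Phi_x(z_2)\|\le L\|z_1-z_2\|$ for all $z_1,z_2\in B_r(x)$; b) $\Phi_x(x)=0$ and $\Phi_x(S\cap B_r(x))\subset\pi$; c) $\Phi_x(S\cap B_r(x))=\Phi_x(B_r(x))\cap\pi^+$ whenever $x$ belongs to the boundary of $S$. Here $x\in S$ belongs to the interior of $S$ if $B_\delta(0)\cap\pi\subset\Phi_x(S\cap B_r(x))$ for some $0<\delta\le r$, and it belongs to the boundary of $S$ otherwise. For a bounded open set $\Omega$, $\mathcal{B}(r,L)$ is the class of all such $S$ with $S\subset\overline\Omega$. *The class $\tilde{\mathcal{B}}(r,L,\omega)$.*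 Let $\Omega\subset\mathbb{R}^N$ be a bounded open set whose boundary is the union of finitely many elements of $\mathcal{B}(r,L)$ with empty boundary, and let $\omega:(0,+\infty)\to(0,+\infty)$ be nondecreasing and left-continuous. A compact set $K\subset\overline\Omega$ belongs to $\tilde{\mathcal{B}}=\tilde{\mathcal{B}}(r,L,\omega)$ if there are finitely many $K^1,\dots,K^M\in\mathcal{B}(r,L)$ such that 1) $K\cup\partial\Omega=\bigcup_{i=1}^M K^i$; 2) for every $i$ and every $x\in K^i$, if the distance $\delta$ of $x$ from the boundary of $K^i$ is positive, then the distance of $x$ from $\bigcup_{j\ne i}K^j$ is at least $\omega(\delta)$ (if the boundary of $K^i$ is empty, this is required with $\delta=\operatorname{diam}\Omega$). *Sobolev spaces and Mosco convergence.* For $K\subset\overline\Omega$ compact, $H^1(\Omega\setminus K)$ is regarded as a subspace of $L^2(\Omega,\mathbb{R}^{N+1})$ by identifying $u$ with $(u,\nabla u)$, where $u$ and its weak gradient are extended by $0$ to $K$. Subspaces $A_n$ of a normed space $X$ converge to a subspace $A$ in the sense of Mosco if $A=A'=A''$, where $A'$ is the set of all weak limits of sequences $x_k\in A_{n_k}$,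 with $(A_{n_k})_k$ any subsequence of $(A_n)_n$, and $A''$ is the set of all strong limits of sequences $x_n\in A_n$. **Theorem.** Let $(K_n)_{n\in\mathbb{N}}$ be a sequence in $\tilde{\mathcal{B}}$ that converges, as $n\to\infty$, to $K\in\tilde{\mathcal{B}}$ in the Hausdorff distance. Then $H^1(\Omega\setminus K_n)$ converges, as $n\to\infty$, to $H^1(\Omega\setminus K)$ in the sense of Mosco, as subspaces of $L^2(\Omega,\mathbb{R}^{N+1})$. -/

import Mathlib

open MeasureTheory Filter Topology

/-- The Euclidean space `ℝ^N`. -/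
abbrev Rn (N : ℕ) : Type := EuclideanSpace ℝ (Fin N)

/-! ### Mosco convergence of a sequence of subspaces of a normed space -/

section Mosco

variable {X : Type*} [NormedAddCommGroup X] [NormedSpace ℝ X]

/-- `u k` converges weakly to `x`. -/
def WeaklyConverges (u : ℕ → X) (x : X) : Prop :=
  ∀ f : X →L[ℝ] ℝ, Tendsto (fun k => f (u k)) atTop (𝓝 (f x))

/-- `A'`: the weak limits of sequences `u k ∈ A (n k)` along subsequences `A (n k)`. -/
def weakUpperLimit (A : ℕ → Submodule ℝ X) : Set X :=
  {x | ∃ n : ℕ → ℕ, StrictMono n ∧ ∃ u : ℕ → X, (∀ k, u k ∈ A (n k)) ∧ WeaklyConverges u x}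

/-- `A''`: the strong limits of sequences `u n ∈ A n`. -/
def strongLowerLimit (A : ℕ → Submodule ℝ X) : Set X :=
  {x | ∃ u : ℕ → X, (∀ n, u n ∈ A n) ∧ Tendsto u atTop (𝓝 x)}

/-- `A n` converges to `B` in the sense of Mosco: `B = A' = A''`. -/
def MoscoConverges (A : ℕ → Submodule ℝ X) (B : Submodule ℝ X) : Prop :=
  weakUpperLimit A = (B : Set X) ∧ strongLowerLimit A = (B : Set X)

end Mosco

/-! ### The space `H¹(Ω ∖ K)` inside `L²(Ω, ℝ^{N+1})` -/

/-- `L²(Ω, ℝ^{N+1})`. -/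
abbrev L2Vec {N : ℕ} (Ω : Set (Rn N)) : Type :=
  Lp (EuclideanSpace ℝ (Fin (N + 1))) 2 (volume.restrict Ω)

/-- The coordinates of an `L²` field are integrable against continuous, compactly supported
functions. -/
theorem L2Vec.integrable_coord_mul {N : ℕ} {Ω : Set (Rn N)} (F : L2Vec Ω) (K : Set (Rn N))
    (i : Fin (N + 1)) {ψ : Rn N → ℝ} (hψ : Continuous ψ) (hc : HasCompactSupport ψ) :
    Integrable (fun x => F x i * ψ x) (volume.restrict (Ω \ K)) := by
  have h1 : MemLp (fun x => F x i) 2 (volume.restrict (Ω \ K)) :=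
    ((EuclideanSpace.proj i : EuclideanSpace ℝ (Fin (N + 1)) →L[ℝ] ℝ).comp_memLp' (Lp.memLp F)
      ).mono_measure (Measure.restrict_mono Set.sdiff_subset le_rfl)
  have h2 : MemLp ψ 2 (volume.restrict (Ω \ K)) :=
    (hψ.memLp_of_hasCompactSupport hc).mono_measure Measure.restrict_le_self
  exact h1.integrable_mul h2

/-- The `i`-th partial derivative of `φ`. -/
noncomputable def partialDeriv {N : ℕ} (i : Fin N) (φ : Rn N → ℝ) (x : Rn N) : ℝ :=
  fderiv ℝ φ x (EuclideanSpace.single i 1)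

theorem partialDeriv_continuous {N : ℕ} (i : Fin N) {φ : Rn N → ℝ} (hφ : ContDiff ℝ (⊤ : ℕ∞) φ) :
    Continuous (partialDeriv i φ) :=
  (hφ.continuous_fderiv (by simp)).clm_apply continuous_const

theorem partialDeriv_hasCompactSupport {N : ℕ} (i : Fin N) {φ : Rn N → ℝ}
    (hφ : HasCompactSupport φ) : HasCompactSupport (partialDeriv i φ) :=
  (hφ.fderiv (𝕜 := ℝ)).comp_left
    (g := fun T : Rn N →L[ℝ] ℝ => T (EuclideanSpace.single i 1)) rfl

/-- `H¹(Ω ∖ K)` as a subspace of `L²(Ω, ℝ^{N+1})`: the fields `(u, ∇u)`, where `u` and its weak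
gradient on the open set `Ω ∖ K` are square integrable and are extended by zero to `K`.
The coordinate `0` is `u`, the coordinate `i + 1` is the weak derivative `∂_i u`. -/
noncomputable def H1 {N : ℕ} (Ω K : Set (Rn N)) : Submodule ℝ (L2Vec Ω) where
  carrier := {F | (∀ᵐ x ∂(volume.restrict Ω), x ∈ K → F x = 0) ∧
    ∀ φ : Rn N → ℝ, ContDiff ℝ (⊤ : ℕ∞) φ → HasCompactSupport φ → tsupport φ ⊆ Ω \ K → ∀ i : Fin N,
      ∫ x in Ω \ K, F x 0 * partialDeriv i φ x = -∫ x in Ω \ K, F x i.succ * φ x}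
  zero_mem' := by
    have h0 := Lp.coeFn_zero (EuclideanSpace ℝ (Fin (N + 1))) 2 (volume.restrict Ω)
    have h0' := ae_restrict_of_ae_restrict_of_subset (Set.sdiff_subset (t := K)) h0
    refine ⟨h0.mono fun x hx _ => by simpa using hx, fun φ _ _ _ i => ?_⟩
    rw [integral_eq_zero_of_ae, integral_eq_zero_of_ae, neg_zero]
    · filter_upwards [h0'] with x hx
      rw [hx]; simp
    · filter_upwards [h0'] with x hx
      rw [hx]; simp
  add_mem' := by
    rintro F G ⟨hF0, hF⟩ ⟨hG0, hG⟩
    have ha := Lp.coeFn_add F G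
    have ha' := ae_restrict_of_ae_restrict_of_subset (Set.sdiff_subset (t := K)) ha
    refine ⟨?_, fun φ h1 h2 h3 i => ?_⟩
    · filter_upwards [ha, hF0, hG0] with x hx h h' hK
      rw [hx, Pi.add_apply, h hK, h' hK, add_zero]
    · have e1 : ∫ x in Ω \ K, (F + G) x 0 * partialDeriv i φ x
          = ∫ x in Ω \ K, (F x 0 * partialDeriv i φ x + G x 0 * partialDeriv i φ x) := by
        refine integral_congr_ae ?_
        filter_upwards [ha'] with x hx
        rw [hx, Pi.add_apply, PiLp.add_apply, add_mul]
      have e2 : ∫ x in Ω \ K, (F + G) x i.succ * φ x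
          = ∫ x in Ω \ K, (F x i.succ * φ x + G x i.succ * φ x) := by
        refine integral_congr_ae ?_
        filter_upwards [ha'] with x hx
        rw [hx, Pi.add_apply, PiLp.add_apply, add_mul]
      have c := partialDeriv_continuous i h1
      have s := partialDeriv_hasCompactSupport i h2
      rw [e1, e2, integral_add (F.integrable_coord_mul K 0 c s) (G.integrable_coord_mul K 0 c s),
        integral_add (F.integrable_coord_mul K _ h1.continuous h2)
          (G.integrable_coord_mul K _ h1.continuous h2), hF φ h1 h2 h3 i, hG φ h1 h2 h3 i]
      ring
  smul_mem' := by
    rintro c F ⟨hF0, hF⟩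
    have ha := Lp.coeFn_smul c F
    have ha' := ae_restrict_of_ae_restrict_of_subset (Set.sdiff_subset (t := K)) ha
    refine ⟨?_, fun φ h1 h2 h3 i => ?_⟩
    · filter_upwards [ha, hF0] with x hx h hK
      rw [hx, Pi.smul_apply, h hK, smul_zero]
    · have e1 : ∫ x in Ω \ K, (c • F) x 0 * partialDeriv i φ x
          = ∫ x in Ω \ K, c * (F x 0 * partialDeriv i φ x) := by
        refine integral_congr_ae ?_
        filter_upwards [ha'] with x hx
        rw [hx, Pi.smul_apply, PiLp.smul_apply, smul_eq_mul, mul_assoc]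
      have e2 : ∫ x in Ω \ K, (c • F) x i.succ * φ x
          = ∫ x in Ω \ K, c * (F x i.succ * φ x) := by
        refine integral_congr_ae ?_
        filter_upwards [ha'] with x hx
        rw [hx, Pi.smul_apply, PiLp.smul_apply, smul_eq_mul, mul_assoc]
      rw [e1, e2, integral_const_mul, integral_const_mul, hF φ h1 h2 h3 i]
      ring

/-! ### Lipschitz hypersurfaces -/

/-- The hyperplane `π = {y : y_N = 0}`, the last coordinate having index `N - 1` in `Fin N`. -/
def flatHyperplane (N : ℕ) : Set (Rn N) :=
  {y | ∀ i : Fin N, (i : ℕ) + 1 = N → y i = 0}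

/-- The half-hyperplane `π⁺ = {y : y_N = 0, y_{N-1} ≥ 0}`. -/
def flatHalfHyperplane (N : ℕ) : Set (Rn N) :=
  {y | y ∈ flatHyperplane N ∧ ∀ i : Fin N, (i : ℕ) + 2 = N → 0 ≤ y i}

/-- In the chart `Φ`, centred at `x`, the set `K ∩ B_r(x)` covers a small disc of the hyperplane
`π`: the point `x` of `K` belongs to the interior of the hypersurface `K`. -/
def CoversFlatDisc {N : ℕ} (r : ℝ) (K : Set (Rn N)) (x : Rn N) (Φ : Rn N → Rn N) : Prop :=
  ∃ δ : ℝ, 0 < δ ∧ δ ≤ r ∧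
    Metric.ball 0 δ ∩ flatHyperplane N ⊆ Φ '' (K ∩ Metric.ball x r)

/-- A (compact) Lipschitz hypersurface of `ℝ^N`, with or without boundary, with constants `r` and
`L`: a compact set `carrier` and, for every `x` in it, a bi-Lipschitz chart `chart x` of the open
ball `B_r(x)` (only the values of `chart x` on this ball matter). -/
structure LipschitzHypersurface (N : ℕ) (r L : ℝ) where
  carrier : Set (Rn N)
  isCompact : IsCompact carrier
  chart : Rn N → Rn N → Rn N
  biLipschitz : ∀ x ∈ carrier, ∀ z₁ ∈ Metric.ball x r, ∀ z₂ ∈ Metric.ball x r,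
    L⁻¹ * ‖z₁ - z₂‖ ≤ ‖chart x z₁ - chart x z₂‖ ∧ ‖chart x z₁ - chart x z₂‖ ≤ L * ‖z₁ - z₂‖
  chart_self : ∀ x ∈ carrier, chart x x = 0
  image_flat : ∀ x ∈ carrier, chart x '' (carrier ∩ Metric.ball x r) ⊆ flatHyperplane N
  image_of_boundary : ∀ x ∈ carrier, ¬ CoversFlatDisc r carrier x (chart x) →
    chart x '' (carrier ∩ Metric.ball x r) =
      chart x '' Metric.ball x r ∩ flatHalfHyperplane N

/-- The boundary of a Lipschitz hypersurface: its points that are not interior. -/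
def LipschitzHypersurface.boundary {N : ℕ} {r L : ℝ} (S : LipschitzHypersurface N r L) :
    Set (Rn N) :=
  {x | x ∈ S.carrier ∧ ¬ CoversFlatDisc r S.carrier x (S.chart x)}

/-- `∂Ω` consists of finitely many Lipschitz hypersurfaces without boundary, with constants
`r` and `L`. -/
def HasLipschitzHypersurfaceBoundary {N : ℕ} (r L : ℝ) (Ω : Set (Rn N)) : Prop :=
  ∃ (m : ℕ) (S : Fin m → LipschitzHypersurface N r L),
    (∀ i, (S i).boundary = ∅) ∧ frontier Ω = ⋃ i, (S i).carrier

open Classical in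
/-- The distance of `x` from the boundary of a hypersurface contained in the closure of `Ω`;
for a hypersurface without boundary it is understood to be the diameter of `Ω`. -/
noncomputable def LipschitzHypersurface.distBoundary {N : ℕ} {r L : ℝ}
    (S : LipschitzHypersurface N r L) (Ω : Set (Rn N)) (x : Rn N) : ℝ :=
  if S.boundary.Nonempty then Metric.infDist x S.boundary else Metric.diam Ω

/-- The class `B̃(r, L, ω)` of compact sets `K ⊆ closure Ω` such that `K ∪ ∂Ω` is a finite union
of Lipschitz hypersurfaces contained in `closure Ω`, any two of them being separated away from
their boundaries in the way that `ω` prescribes. -/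
def BTilde {N : ℕ} (r L : ℝ) (ω : ℝ → ℝ) (Ω : Set (Rn N)) : Set (Set (Rn N)) :=
  {K | IsCompact K ∧ K ⊆ closure Ω ∧
    ∃ (M : ℕ) (S : Fin M → LipschitzHypersurface N r L),
      (∀ i, (S i).carrier ⊆ closure Ω) ∧
      K ∪ frontier Ω = ⋃ i, (S i).carrier ∧
      ∀ i, ∀ x ∈ (S i).carrier, 0 < (S i).distBoundary Ω x →
        ∀ j, j ≠ i → ∀ y ∈ (S j).carrier, ω ((S i).distBoundary Ω x) ≤ dist x y}

/-! The upper limit is the easy half. A test function supported in Ω ∖ K has positive distance from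
K, so it is eventually supported in Ω ∖ K_n, and the identity defining the weak gradient passes to
weak limits (`weakUpperLimit_subset_H1`). The work lies in the strong approximation of a given u ∈
H¹(Ω ∖ K) by u_n ∈ H¹(Ω ∖ K_n). Extended by zero, u becomes a field on ℝ^N with singular set C = K ∪
∂Ω, to be approximated by fields with singular sets C_n = K_n ∪ ∂Ω, which are finite unions of
hypersurfaces. It is enough to do this along every ultrafilter finer than `atTop`; limits then exist
without extraction of subsequences.

Away from the boundaries of the hypersurfaces, ω prevents distinct sheets from accumulating: in a
ball whose size does not depend on n, C_n is exactly the zero set of the last coordinate of one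
chart Φ_n (`exists_flattening_chart`). The charts converge to a bi-Lipschitz Φ whose last coordinate
vanishes on C (`exists_limit_chart`). The parts of u on the two sides of this zero set extend across
it by reflection in the chart (`exists_two_reflections`). Gluing the two extensions along the zero
set of the last coordinate of Φ_n gives a field that jumps only on C_n and differs from u only in a
thin layer (`mem_approximable_of_charts`).

There remains the limit Z of the boundaries. A hypersurface with boundary has a point far from its
boundary; such points are separated by ω, so the number of these hypersurfaces is bounded. As
boundaries have codimension two, the ε-neighbourhood of Z has volume O(ε²)
(`exists_volume_singularLimit_le`). For bounded u, cutoffs near Z then give a bounded sequence in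
H¹. The approximable fields form a closed subspace, hence a weakly closed one, so boundedness is
enough and Z is negligible (`mem_of_mem_of_support_disjoint`); truncation removes the boundedness of
u (`mem_of_truncations_mem`).

That charts cover discs, and that the boundary of a hypersurface does not depend on the chart, rests
on invariance of domain for bi-Lipschitz maps (`mem_interior_image_of_biLipschitz`). Its proof is
analytic: if the image of a ball missed points near the image of the centre, det Df would be
orthogonal to all functions θ ∘ f and would vanish near the centre. -/

set_option linter.unusedSectionVars false

/-! ### Jacobian determinants of compactly supported Lipschitz maps -/

section BiLipschitz

open scoped NNReal ENNReal

variable {E : Type*} [NormedAddCommGroup E] [InnerProductSpace ℝ E] [FiniteDimensional ℝ E]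

/-- The map t ↦ det(t + A) is the characteristic polynomial of -A, of degree n, so n + 1 nodes
recover its value at 0. This trades det A for determinants at large τ, where x ↦ τx + G x is
bijective. -/
theorem LinearMap.det_smul_id_add_eq_sum {τ : Fin (Module.finrank ℝ E + 1) → ℝ}
    (hτ : Function.Injective τ) (A : E →L[ℝ] E) :
    A.det = ∑ k, (Lagrange.basis Finset.univ τ k).eval 0 *
      (τ k • ContinuousLinearMap.id ℝ E + A).det := by
  have h1 : ∀ t : ℝ, (LinearMap.charpoly (-(A : E →ₗ[ℝ] E))).eval t =
      (t • ContinuousLinearMap.id ℝ E + A).det := by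
    intro t
    rw [LinearMap.eval_charpoly, ContinuousLinearMap.det]
    congr 1
    ext x
    simp [Algebra.algebraMap_eq_smul_one]
  have h2 := Lagrange.eq_interpolate (s := Finset.univ) (v := τ)
    (f := LinearMap.charpoly (-(A : E →ₗ[ℝ] E))) hτ.injOn (by
      refine lt_of_le_of_lt Polynomial.degree_le_natDegree ?_
      rw [LinearMap.charpoly_natDegree]
      simp only [Finset.card_univ, Fintype.card_fin]
      exact_mod_cast Nat.lt_succ_self _)
  have h3 := congrArg (Polynomial.eval 0) h2
  rw [h1, Lagrange.interpolate_apply, Polynomial.eval_finsetSum] at h3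
  simp only [Polynomial.eval_mul, Polynomial.eval_C, h1] at h3
  rw [zero_smul, zero_add] at h3
  rw [h3]
  exact Finset.sum_congr rfl fun k _ => mul_comm _ _

/-- Interpolation at n + 1 nodes reproduces X ^ n, which vanishes at 0 because n ≠ 0. -/
theorem sum_lagrange_mul_pow_eq_zero {n : ℕ} (hn : n ≠ 0) {τ : Fin (n + 1) → ℝ}
    (hτ : Function.Injective τ) :
    ∑ k, (Lagrange.basis Finset.univ τ k).eval 0 * τ k ^ n = 0 := by
  have h2 := Lagrange.eq_interpolate (s := Finset.univ) (v := τ)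
    (f := (Polynomial.X : Polynomial ℝ) ^ n) hτ.injOn (by
      rw [Polynomial.degree_X_pow]
      simp only [Finset.card_univ, Fintype.card_fin]
      exact_mod_cast Nat.lt_succ_self _)
  have h3 := congrArg (Polynomial.eval 0) h2
  rw [Lagrange.interpolate_apply, Polynomial.eval_finsetSum] at h3
  simp only [Polynomial.eval_mul, Polynomial.eval_C, Polynomial.eval_pow, Polynomial.eval_X] at h3
  rw [zero_pow hn] at h3
  exact (Finset.sum_congr rfl fun k _ => mul_comm _ _).trans h3.symm

/-- Homotopy in s: τ + sA is injective for 0 ≤ s ≤ 1 since ‖sA‖ < τ, so the determinant keeps the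
sign it has at s = 0. -/
theorem det_smul_id_add_pos {K τ : ℝ} (hK : K < τ) {A : E →L[ℝ] E} (hA : ‖A‖ ≤ K) :
    0 < (τ • ContinuousLinearMap.id ℝ E + A).det := by
  have hK0 : 0 ≤ K := (norm_nonneg _).trans hA
  have hτ : 0 < τ := lt_of_le_of_lt hK0 hK
  set g : ℝ → ℝ := fun s => (τ • ContinuousLinearMap.id ℝ E + s • A).det with hg
  have hc : Continuous g := ContinuousLinearMap.continuous_det.comp (by fun_prop)
  have hne : ∀ s ∈ Set.Icc (0 : ℝ) 1, g s ≠ 0 := by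
    intro s hs h0
    have hker : ∃ v : E, v ≠ 0 ∧ (τ • ContinuousLinearMap.id ℝ E + s • A) v = 0 := by
      by_contra! hcon
      have hinj : Function.Injective
          ((τ • ContinuousLinearMap.id ℝ E + s • A : E →L[ℝ] E) : E →ₗ[ℝ] E) := by
        rw [← LinearMap.ker_eq_bot, LinearMap.ker_eq_bot']
        intro m hm
        by_contra hm0
        exact hcon m hm0 hm
      have : IsUnit ((τ • ContinuousLinearMap.id ℝ E + s • A : E →L[ℝ] E) : E →ₗ[ℝ] E) :=
        (Module.End.isUnit_iff _).2 ⟨hinj, LinearMap.injective_iff_surjective.1 hinj⟩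
      exact ((LinearMap.isUnit_iff_isUnit_det _).1 this).ne_zero h0
    obtain ⟨v, hv0, hv⟩ := hker
    have hv' : τ • v = -(s • A v) := by
      simpa using eq_neg_of_add_eq_zero_left hv
    have h1 : τ * ‖v‖ ≤ K * ‖v‖ := by
      calc τ * ‖v‖ = ‖τ • v‖ := by rw [norm_smul, Real.norm_of_nonneg hτ.le]
        _ = s * ‖A v‖ := by rw [hv', norm_neg, norm_smul, Real.norm_of_nonneg hs.1]
        _ ≤ 1 * ‖A v‖ := by gcongr; exact hs.2
        _ ≤ K * ‖v‖ := by rw [one_mul]; exact A.le_of_opNorm_le hA v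
    have hvp : 0 < ‖v‖ := norm_pos_iff.2 hv0
    exact absurd (le_of_mul_le_mul_right h1 hvp) (not_le.2 hK)
  have h0 : 0 < g 0 := by
    simp only [hg, zero_smul, add_zero, ContinuousLinearMap.det]
    rw [ContinuousLinearMap.toLinearMap_smul, LinearMap.det_smul]
    simp; positivity
  by_contra hneg
  have h1 : g 1 ≤ 0 := by simpa [hg] using hneg
  obtain ⟨s, hs, hs0⟩ := intermediate_value_Icc' (zero_le_one' ℝ) hc.continuousOn ⟨h1, h0.le⟩
  exact hne s hs hs0

/-- Injectivity holds because τ exceeds the Lipschitz constant, surjectivity by the contraction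
principle for x ↦ τ⁻¹(y - G x). Off the ball the map is the dilation by τ, so a bijection has to
send the ball onto the dilated ball. -/
theorem image_ball_smul_add {G : E → E} {K : ℝ≥0} (hG : LipschitzWith K G) {R : ℝ}
    (hR : Function.support G ⊆ Metric.ball 0 R) {τ : ℝ} (hτ : K < τ) :
    Function.Injective (fun x => τ • x + G x) ∧
      (fun x => τ • x + G x) '' Metric.ball 0 R = Metric.ball 0 (τ * R) := by
  have hτ0 : 0 < τ := lt_of_le_of_lt K.coe_nonneg hτ
  have hinj : Function.Injective (fun x => τ • x + G x) := by
    intro x y hxy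
    have h1 : τ • (x - y) = G y - G x := by
      have : τ • x + G x = τ • y + G y := hxy
      rw [smul_sub, sub_eq_sub_iff_add_eq_add, this, add_comm]
    have h2 : τ * ‖x - y‖ ≤ K * ‖x - y‖ := by
      calc τ * ‖x - y‖ = ‖τ • (x - y)‖ := by rw [norm_smul, Real.norm_of_nonneg hτ0.le]
        _ = dist (G y) (G x) := by rw [h1, dist_eq_norm]
        _ ≤ K * dist y x := hG.dist_le_mul _ _
        _ = K * ‖x - y‖ := by rw [dist_comm, dist_eq_norm]
    by_contra hne
    have : 0 < ‖x - y‖ := norm_pos_iff.2 (sub_ne_zero.2 hne)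
    exact absurd (le_of_mul_le_mul_right h2 this) (not_le.2 hτ)
  have hsurj : Function.Surjective (fun x => τ • x + G x) := by
    intro y
    have hc : ContractingWith (Real.toNNReal τ⁻¹ * K) (fun x => τ⁻¹ • (y - G x)) := by
      constructor
      · rw [← NNReal.coe_lt_coe]
        push_cast
        rw [Real.coe_toNNReal _ (by positivity), inv_mul_lt_iff₀ hτ0, mul_one]
        exact hτ
      · refine LipschitzWith.of_dist_le_mul fun a b => ?_
        rw [dist_smul₀, dist_sub_left]
        push_cast
        rw [Real.coe_toNNReal _ (by positivity), Real.norm_of_nonneg (by positivity), mul_assoc]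
        gcongr
        exact hG.dist_le_mul _ _
    refine ⟨hc.fixedPoint, ?_⟩
    have := hc.fixedPoint_isFixedPt
    have h : τ⁻¹ • (y - G hc.fixedPoint) = hc.fixedPoint := this
    show τ • hc.fixedPoint + G hc.fixedPoint = y
    conv_lhs => rw [← h]
    rw [smul_inv_smul₀ hτ0.ne', h]; simp
  refine ⟨hinj, ?_⟩
  have hout : ∀ x, x ∉ Metric.ball (0 : E) R → G x = 0 := fun x hx => by
    by_contra h; exact hx (hR h)
  apply Set.Subset.antisymm
  · rintro _ ⟨x, hx, rfl⟩
    by_contra hcon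
    set y := τ • x + G x with hy
    have hy' : τ⁻¹ • y ∉ Metric.ball (0 : E) R := by
      simp only [Metric.mem_ball, dist_zero_right, not_lt] at hcon ⊢
      rw [norm_smul, norm_inv, Real.norm_of_nonneg hτ0.le, le_inv_mul_iff₀ hτ0]
      exact hcon
    have : (fun x => τ • x + G x) (τ⁻¹ • y) = (fun x => τ • x + G x) x := by
      simp only [hout _ hy', add_zero, smul_inv_smul₀ hτ0.ne']; exact hy
    exact hy' (hinj this ▸ hx)
  · intro y hy
    obtain ⟨x, rfl⟩ := hsurj y
    refine ⟨x, ?_, rfl⟩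
    by_contra hx
    simp only [hout x hx, add_zero, Metric.mem_ball, dist_zero_right, norm_smul,
      Real.norm_of_nonneg hτ0.le] at hy hx
    exact hx (lt_of_mul_lt_mul_left hy hτ0.le)

variable [MeasurableSpace E] [BorelSpace E]

/-- Lipschitz maps expand the volume at most by the `n`-th power of their constant. -/
theorem LipschitzOnWith.volume_image_le {f : E → E} {K : ℝ≥0} {s : Set E}
    (hf : LipschitzOnWith K f s) :
    volume (f '' s) ≤ (K : ℝ≥0∞) ^ (Module.finrank ℝ E) * volume s := by
  have h := hf.hausdorffMeasure_image_le (d := Module.finrank ℝ E) (by positivity)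
  have e : (volume : Measure E) =
      Measure.addHaarScalarFactor volume (Measure.hausdorffMeasure (X := E) (Module.finrank ℝ E))
        • Measure.hausdorffMeasure (X := E) (Module.finrank ℝ E) :=
    Measure.isAddLeftInvariant_eq_smul _ _
  rw [e]
  simp only [Measure.smul_apply, ENNReal.smul_def, smul_eq_mul]
  rw [ENNReal.rpow_natCast] at h
  calc _ ≤ _ := mul_le_mul_right h _
    _ = _ := by ring

/-- Change of variables on the points of differentiability; the other points form a null set, whose
image under a Lipschitz map is null. The determinant is positive, so no absolute value remains. -/
theorem integral_ball_det_smul_id_add {G : E → E} {K : ℝ≥0} (hG : LipschitzWith K G) {R : ℝ}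
    (hR : Function.support G ⊆ Metric.ball 0 R) {τ : ℝ} (hτ : K < τ) :
    IntegrableOn (fun x => (τ • ContinuousLinearMap.id ℝ E + fderiv ℝ G x).det)
      (Metric.ball 0 R) ∧
    ∫ x in Metric.ball 0 R, (τ • ContinuousLinearMap.id ℝ E + fderiv ℝ G x).det =
      τ ^ Module.finrank ℝ E * volume.real (Metric.ball (0 : E) R) := by
  have hτ0 : 0 < τ := lt_of_le_of_lt K.coe_nonneg hτ
  obtain ⟨hinj, himg⟩ := image_ball_smul_add hG hR hτ
  set J : E → ℝ := fun x => (τ • ContinuousLinearMap.id ℝ E + fderiv ℝ G x).det with hJ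
  have hJm : Measurable J := by
    refine ContinuousLinearMap.continuous_det.measurable.comp ?_
    exact measurable_const.add (measurable_fderiv ℝ G)
  have hJpos : ∀ x, 0 < J x := fun x =>
    det_smul_id_add_pos hτ (norm_fderiv_le_of_lipschitz ℝ hG)
  set D : Set E := {x | DifferentiableAt ℝ G x} with hD
  have hDm : MeasurableSet D := measurableSet_of_differentiableAt ℝ G
  have hDae : volume Dᶜ = 0 := hG.ae_differentiableAt
  have hlip : LipschitzWith (Real.toNNReal τ + K) (fun x => τ • x + G x) := by
    refine LipschitzWith.add ?_ hG
    refine LipschitzWith.of_dist_le_mul fun a b => ?_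
    rw [dist_smul₀, Real.norm_of_nonneg hτ0.le, Real.coe_toNNReal _ hτ0.le]
  have hvol : volume ((fun x => τ • x + G x) '' (Metric.ball 0 R ∩ D)) =
      volume (Metric.ball (0 : E) (τ * R)) := by
    rw [← himg]
    refine le_antisymm (measure_mono (Set.image_mono Set.inter_subset_left)) ?_
    have hs : Metric.ball (0 : E) R ⊆ (Metric.ball 0 R ∩ D) ∪ Dᶜ := by
      intro x hx
      by_cases h : x ∈ D
      · exact Or.inl ⟨hx, h⟩
      · exact Or.inr h
    calc _ ≤ volume ((fun x => τ • x + G x) '' ((Metric.ball 0 R ∩ D) ∪ Dᶜ)) :=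
          measure_mono (Set.image_mono hs)
      _ ≤ _ + volume ((fun x => τ • x + G x) '' Dᶜ) := by
          rw [Set.image_union]; exact measure_union_le _ _
      _ = _ := by
          have := (hlip.lipschitzOnWith (s := Dᶜ)).volume_image_le
          rw [hDae, mul_zero] at this
          rw [nonpos_iff_eq_zero.1 this, add_zero]
  have hder : ∀ x ∈ Metric.ball (0 : E) R ∩ D, HasFDerivWithinAt (fun x => τ • x + G x)
      (τ • ContinuousLinearMap.id ℝ E + fderiv ℝ G x) (Metric.ball (0 : E) R ∩ D) x := by
    intro x hx
    have h2 : HasFDerivAt G (fderiv ℝ G x) x := (show DifferentiableAt ℝ G x from hx.2).hasFDerivAt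
    exact (((hasFDerivAt_id x).const_smul τ).add h2).hasFDerivWithinAt
  have hlint : ∫⁻ x in Metric.ball 0 R, ENNReal.ofReal (J x) =
      volume (Metric.ball (0 : E) (τ * R)) := by
    rw [← hvol, ← lintegral_abs_det_fderiv_eq_addHaar_image volume
      (measurableSet_ball.inter hDm) hder hinj.injOn]
    have : volume.restrict (Metric.ball (0 : E) R ∩ D) = volume.restrict (Metric.ball 0 R) := by
      refine Measure.restrict_congr_set ?_
      refine inter_ae_eq_left_of_ae_eq_univ ?_
      exact eventuallyEq_univ.2 hDae
    rw [this]
    refine lintegral_congr fun x => ?_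
    rw [abs_of_pos (hJpos x)]
  constructor
  · refine ⟨hJm.aestronglyMeasurable, ?_⟩
    rw [hasFiniteIntegral_iff_ofReal (ae_of_all _ fun x => (hJpos x).le), hlint]
    exact measure_ball_lt_top
  · rw [integral_eq_lintegral_of_nonneg_ae (ae_of_all _ fun x => (hJpos x).le)
      hJm.aestronglyMeasurable, hlint, Measure.addHaar_ball_mul_of_pos volume 0 hτ0 R, ENNReal.toReal_mul,
      ENNReal.toReal_ofReal (by positivity)]
    rfl

/-- The integral of the Jacobian determinant of a compactly supported Lipschitz map vanishes. -/
theorem integral_det_fderiv_eq_zero {G : E → E} {K : ℝ≥0} (hG : LipschitzWith K G)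
    (hc : HasCompactSupport G) (hn : Module.finrank ℝ E ≠ 0) :
    Integrable (fun x => (fderiv ℝ G x).det) ∧ ∫ x, (fderiv ℝ G x).det = 0 := by
  obtain ⟨R, hR⟩ := hc.isCompact.isBounded.subset_ball (0 : E)
  have hR' : Function.support G ⊆ Metric.ball 0 R := (subset_tsupport G).trans hR
  -- Distinct nodes, all above the Lipschitz constant, so that the volume formula is available at
  -- each of them.
  set τ : Fin (Module.finrank ℝ E + 1) → ℝ := fun k => K + 1 + k with hτ
  have hτi : Function.Injective τ := fun a b h => by
    simpa [hτ, Fin.val_inj] using h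
  have hτK : ∀ k, (K : ℝ) < τ k := fun k => by
    have : (0 : ℝ) ≤ (k : ℕ) := by positivity
    simp only [hτ]; linarith
  have hout : ∀ x, x ∉ Metric.ball (0 : E) R → (fderiv ℝ G x).det = 0 := by
    intro x hx
    have : fderiv ℝ G x = 0 := by
      by_contra h
      exact hx (hR (support_fderiv_subset ℝ h))
    rw [this, ContinuousLinearMap.det]
    have : Nontrivial E := Module.finrank_pos_iff.1 (Nat.pos_of_ne_zero hn)
    exact LinearMap.det_zero''
  have e : (fun x => (fderiv ℝ G x).det) = fun x => ∑ k,
      (Lagrange.basis Finset.univ τ k).eval 0 *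
        (τ k • ContinuousLinearMap.id ℝ E + fderiv ℝ G x).det :=
    funext fun x => LinearMap.det_smul_id_add_eq_sum hτi _
  have hI : IntegrableOn (fun x => (fderiv ℝ G x).det) (Metric.ball (0 : E) R) := by
    rw [e]
    exact integrable_finsetSum _ fun k _ =>
      (integral_ball_det_smul_id_add hG hR' (hτK k)).1.const_mul _
  have hsupp : Function.support (fun x => (fderiv ℝ G x).det) ⊆ Metric.ball (0 : E) R := by
    intro x hx; by_contra h; exact hx (hout x h)
  refine ⟨(integrableOn_iff_integrable_of_support_subset hsupp).1 hI, ?_⟩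
  rw [← setIntegral_eq_integral_of_forall_compl_eq_zero hout]
  -- The integral is the interpolation at 0 of τ ↦ τ ^ n · |B_R|, that is 0.
  rw [e, integral_finsetSum _ fun k _ =>
      (integral_ball_det_smul_id_add hG hR' (hτK k)).1.const_mul _]
  simp_rw [integral_const_mul, (integral_ball_det_smul_id_add hG hR' (hτK _)).2, ← mul_assoc]
  rw [← Finset.sum_mul, sum_lagrange_mul_pow_eq_zero hn hτi, zero_mul]

end BiLipschitz

/-! ### Invariance of domain for bi-Lipschitz maps -/

section InvarianceOfDomain

open scoped NNReal ENNReal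

variable {E : Type*} [NormedAddCommGroup E] [InnerProductSpace ℝ E]

theorem exists_lipschitz_cutoff (x : E) {a b : ℝ} (hab : a < b) :
    ∃ (K : ℝ≥0) (c : E → ℝ), LipschitzWith K c ∧ (∀ z, 0 ≤ c z ∧ c z ≤ 1) ∧
      (∀ z, dist z x ≤ a → c z = 1) ∧ ∀ z, b ≤ dist z x → c z = 0 := by
  have hba : 0 < b - a := sub_pos.2 hab
  refine ⟨Real.toNNReal (b - a)⁻¹, fun z => max 0 (min 1 ((b - a)⁻¹ * (b - dist z x))), ?_, ?_, ?_, ?_⟩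
  · refine (LipschitzWith.const_min ?_ 1).const_max 0
    refine LipschitzWith.of_dist_le_mul fun z w => ?_
    rw [Real.coe_toNNReal _ (by positivity), Real.dist_eq, ← mul_sub, abs_mul,
      abs_of_pos (inv_pos.2 hba)]
    gcongr
    rw [sub_sub_sub_cancel_left, dist_comm z w]
    exact abs_dist_sub_le _ _ _
  · exact fun z => ⟨le_max_left _ _, max_le zero_le_one (min_le_left _ _)⟩
  · intro z hz
    have : 1 ≤ (b - a)⁻¹ * (b - dist z x) := by
      rw [le_inv_mul_iff₀ hba]; linarith
    simp [min_eq_left this]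
  · intro z hz
    have : (b - a)⁻¹ * (b - dist z x) ≤ 0 :=
      mul_nonpos_of_nonneg_of_nonpos (inv_pos.2 hba).le (by linarith)
    exact max_eq_left ((min_le_right _ _).trans this)

/-- The difference is expanded so that the values of f are needed in norm only at a point where c
does not vanish; f itself may be unbounded elsewhere. -/
theorem LipschitzWith.smul_of_bounded_on_support {X F : Type*} [PseudoMetricSpace X]
    [NormedAddCommGroup F]
    [NormedSpace ℝ F] {K K' M : ℝ≥0} {c : X → ℝ} {f : X → F} (hc : LipschitzWith K' c)
    (hc1 : ∀ z, 0 ≤ c z ∧ c z ≤ 1) (hf : LipschitzWith K f) (hM : ∀ z, c z ≠ 0 → ‖f z‖ ≤ M) :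
    LipschitzWith (K + K' * M) (fun z => c z • f z) := by
  have key : ∀ x y, c y ≠ 0 → dist (c x • f x) (c y • f y) ≤ (K + K' * M : ℝ≥0) * dist x y := by
    intro x y hy
    have e : c x • f x - c y • f y = c x • (f x - f y) + (c x - c y) • f y := by
      rw [smul_sub, sub_smul]; abel
    rw [dist_eq_norm, e]
    refine (norm_add_le _ _).trans ?_
    rw [norm_smul, norm_smul, Real.norm_of_nonneg (hc1 x).1]
    have h1 := hf.dist_le_mul x y
    have h2 := hc.dist_le_mul x y
    rw [dist_eq_norm] at h1 h2
    push_cast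
    have h3 : c x * ‖f x - f y‖ ≤ 1 * (K * dist x y) :=
      mul_le_mul (hc1 x).2 h1 (norm_nonneg _) zero_le_one
    have h4 : ‖c x - c y‖ * ‖f y‖ ≤ (K' * dist x y) * M :=
      mul_le_mul h2 (hM y hy) (norm_nonneg _) (by positivity)
    nlinarith
  refine LipschitzWith.of_dist_le_mul fun x y => ?_
  by_cases hy : c y = 0
  · by_cases hx : c x = 0
    · simp only [hx, hy, zero_smul, dist_self]; positivity
    · rw [dist_comm, dist_comm x y]; exact key y x hx
  · exact key x y hy

/-- The average of `θ` over the segment from `y - e` to `y`. -/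
noncomputable def segmentAverage (θ : E → ℝ) (e y : E) : ℝ := ∫ s in (0 : ℝ)..1, θ (y - s • e)

theorem segmentAverage_lipschitz {θ : E → ℝ} {K : ℝ≥0} (hθ : LipschitzWith K θ) (e : E) :
    LipschitzWith K (segmentAverage θ e) := by
  refine LipschitzWith.of_dist_le_mul fun y z => ?_
  have hi : ∀ y, IntervalIntegrable (fun s : ℝ => θ (y - s • e)) volume 0 1 := fun y =>
    (hθ.continuous.comp (by fun_prop)).intervalIntegrable _ _
  rw [dist_eq_norm, segmentAverage, segmentAverage, ← intervalIntegral.integral_sub (hi y) (hi z)]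
  refine (intervalIntegral.norm_integral_le_of_norm_le_const (C := K * dist y z) ?_).trans_eq (by simp)
  intro s _
  rw [← dist_eq_norm]
  refine (hθ.dist_le_mul _ _).trans_eq ?_
  rw [dist_sub_right]

/-- Along e the average is an integral over a sliding unit interval, so its derivative is the
difference of the end values. This supplies a primitive of θ in the direction e, up to the translate
of θ by e. -/
theorem segmentAverage_hasDerivAt {θ : E → ℝ} (hθ : Continuous θ) (e y : E) :
    HasDerivAt (fun t : ℝ => segmentAverage θ e (y + t • e)) (θ y - θ (y - e)) 0 := by
  set q : ℝ → ℝ := fun v => θ (y + v • e) with hq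
  have hqc : Continuous q := hθ.comp (by fun_prop)
  have e1 : (fun t : ℝ => segmentAverage θ e (y + t • e)) =
      fun t => (∫ v in (0 : ℝ)..t, q v) - ∫ v in (0 : ℝ)..(t - 1), q v := by
    funext t
    have h1 : segmentAverage θ e (y + t • e) = ∫ s in (0 : ℝ)..1, q (t - s) := by
      refine intervalIntegral.integral_congr fun s _ => ?_
      simp only [hq]; congr 1; rw [sub_smul]; abel
    rw [h1, intervalIntegral.integral_comp_sub_left (fun v => q v) t, sub_zero,
      intervalIntegral.integral_interval_sub_left (hqc.intervalIntegrable _ _)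
        (hqc.intervalIntegrable _ _)]
  rw [e1]
  have d1 : HasDerivAt (fun t : ℝ => ∫ v in (0 : ℝ)..t, q v) (q 0) 0 :=
    intervalIntegral.integral_hasDerivAt_right (hqc.intervalIntegrable _ _)
      (hqc.stronglyMeasurableAtFilter _ _) hqc.continuousAt
  have d2 : HasDerivAt (fun t : ℝ => ∫ v in (0 : ℝ)..(t - 1), q v) (q (0 - 1)) 0 := by
    have := (intervalIntegral.integral_hasDerivAt_right (a := 0) (b := (0 : ℝ) - 1)
      (hqc.intervalIntegrable _ _) (hqc.stronglyMeasurableAtFilter _ _) hqc.continuousAt)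
    exact HasDerivAt.comp_sub_const (0 : ℝ) 1 this
  have h0 : q 0 = θ y := by simp [hq]
  have h1 : q (0 - 1) = θ (y - e) := by simp [hq, sub_eq_add_neg]
  rw [← h0, ← h1]
  exact d1.sub d2

variable [FiniteDimensional ℝ E]

/-- The map factors as the transvection x ↦ x + l(x)e after A. -/
theorem det_add_smulRight_comp (A : E →L[ℝ] E) (l : E →L[ℝ] ℝ) (e : E) :
    (A + (l.comp A).smulRight e).det = (1 + l e) * A.det := by
  have h := LinearMap.transvection.det (R := ℝ) (V := E) (l : E →ₗ[ℝ] ℝ) e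
  have e1 : ((A + (l.comp A).smulRight e : E →L[ℝ] E) : E →ₗ[ℝ] E) =
      (LinearMap.transvection (l : E →ₗ[ℝ] ℝ) e) * (A : E →ₗ[ℝ] E) := by
    ext x
    simp [LinearMap.transvection.apply]
  rw [ContinuousLinearMap.det, e1, map_mul, h]
  rfl

variable [MeasurableSpace E] [BorelSpace E]

/-- The inverse of f on f(U) is L-Lipschitz and maps part of s onto the preimage. No measurability
of s is involved; in particular preimages of null sets are null. -/
theorem volume_inter_preimage_le {f : E → E} {U s : Set E} {L : ℝ≥0}
    (hf : ∀ z₁ ∈ U, ∀ z₂ ∈ U, dist z₁ z₂ ≤ L * dist (f z₁) (f z₂)) :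
    volume (U ∩ f ⁻¹' s) ≤ (L : ℝ≥0∞) ^ (Module.finrank ℝ E) * volume s := by
  rcases U.eq_empty_or_nonempty with rfl | hne
  · simp
  have : Nonempty E := ⟨hne.some⟩
  have hinj : Set.InjOn f U := fun a ha b hb hab => by
    have := hf a ha b hb
    rw [hab, dist_self, mul_zero] at this
    exact dist_le_zero.1 this
  have hg : LipschitzOnWith L (Function.invFunOn f U) (f '' (U ∩ f ⁻¹' s)) := by
    refine LipschitzOnWith.of_dist_le_mul ?_
    rintro _ ⟨a, ha, rfl⟩ _ ⟨b, hb, rfl⟩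
    rw [hinj.leftInvOn_invFunOn ha.1, hinj.leftInvOn_invFunOn hb.1]
    exact hf a ha.1 b hb.1
  have himg : Function.invFunOn f U '' (f '' (U ∩ f ⁻¹' s)) = U ∩ f ⁻¹' s := by
    rw [Set.image_image]
    refine Set.EqOn.image_eq_self fun x hx => ?_
    exact hinj.leftInvOn_invFunOn hx.1
  calc volume (U ∩ f ⁻¹' s) = volume (Function.invFunOn f U '' (f '' (U ∩ f ⁻¹' s))) := by rw [himg]
    _ ≤ _ := hg.volume_image_le
    _ ≤ _ := by
      gcongr
      rintro _ ⟨a, ha, rfl⟩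
      exact ha.2

/-- A Lipschitz map whose inverse is Lipschitz, and whose image of a ball misses a point close to
the image of the centre, has a Jacobian determinant which is orthogonal to all functions of the
form `θ ∘ f`, with `θ` supported close to the image of the centre. -/
theorem setIntegral_comp_mul_det_eq_zero (hn : Module.finrank ℝ E ≠ 0) {f : E → E} {K L : ℝ≥0}
    (hfK : LipschitzWith K f) {x₀ p : E} {ρ η₁ : ℝ}
    (hfL : ∀ z₁ ∈ Metric.ball x₀ (2 * ρ), ∀ z₂ ∈ Metric.ball x₀ (2 * ρ),
      dist z₁ z₂ ≤ L * dist (f z₁) (f z₂))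
    (hρ : 0 < ρ) (hp : L * (dist p (f x₀) + η₁) ≤ ρ / 2)
    (hmiss : ∀ x ∈ Metric.ball x₀ (2 * ρ), f x ∉ Metric.ball p η₁)
    {θ : E → ℝ} {Kθ : ℝ≥0} (hθ : LipschitzWith Kθ θ)
    (hθs : ∀ y, θ y ≠ 0 → y ∈ Metric.ball (f x₀) η₁) :
    ∫ x in Metric.ball x₀ ρ, θ (f x) * (fderiv ℝ f x).det = 0 := by
  -- The vector from f(x₀) to the missed point p. The derivative of ψ along e at f(x) is θ(f x) -
  -- θ(f x - e), and the second term vanishes: otherwise f(x) would lie within η₁ of p.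
  set e := p - f x₀ with he
  set ψ := segmentAverage θ e with hψ
  have hψL : LipschitzWith Kθ ψ := segmentAverage_lipschitz hθ e
  -- the support of `ψ`
  have hψs : ∀ y, ψ y ≠ 0 → dist y (f x₀) < dist p (f x₀) + η₁ := by
    intro y hy
    by_contra! hcon
    apply hy
    refine (intervalIntegral.integral_congr (g := fun _ => 0) fun s hs => ?_).trans (by simp)
    by_contra h0
    have h1 : dist (y - s • e) (f x₀) < η₁ := hθs _ h0
    rw [Set.uIcc_of_le zero_le_one] at hs
    have h2 : dist y (y - s • e) ≤ dist p (f x₀) := by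
      rw [dist_self_sub_right, norm_smul, Real.norm_of_nonneg hs.1, dist_eq_norm, ← he]
      exact mul_le_of_le_one_left (norm_nonneg _) hs.2
    linarith [dist_triangle y (y - s • e) (f x₀)]
  have hψx : ∀ x ∈ Metric.ball x₀ (2 * ρ), ψ (f x) ≠ 0 → dist x x₀ ≤ ρ / 2 := by
    intro x hx h
    refine (hfL x hx x₀ (Metric.mem_ball_self (by linarith))).trans (le_trans ?_ hp)
    gcongr
    exact (hψs _ h).le
  obtain ⟨K', c, hcL, hc01, hc1, hc0⟩ := exists_lipschitz_cutoff x₀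
    (show ρ < 3 / 2 * ρ by linarith)
  have hcs : ∀ z, c z ≠ 0 → dist z x₀ < 3 / 2 * ρ := fun z hz => by
    by_contra! h; exact hz (hc0 z h)
  have hcc : ∀ F : E → E, HasCompactSupport (fun z => c z • F z) := fun F => by
    refine HasCompactSupport.intro (isCompact_closedBall x₀ (3 / 2 * ρ)) fun z hz => ?_
    rw [hc0 z (by simpa using (not_le.1 hz).le), zero_smul]
  have hlip : ∀ (F : E → E) (k : ℝ≥0), LipschitzWith k F →
      ∃ k', LipschitzWith k' (fun z => c z • F z) := by
    intro F k hF
    obtain ⟨M, hM⟩ := (isCompact_closedBall x₀ (3 / 2 * ρ)).exists_bound_of_continuousOn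
      hF.continuous.continuousOn
    refine ⟨_, hcL.smul_of_bounded_on_support (M := Real.toNNReal M) hc01 hF fun z hz => ?_⟩
    exact (hM z (hcs z hz).le).trans (Real.le_coe_toNNReal M)
  -- F₁ differs from f only where ψ ∘ f ≠ 0, which inside the ball of radius 2ρ means within ρ/2 of
  -- x₀; there det DF₁ = (1 + θ ∘ f) det Df almost everywhere. After multiplication by the cutoff c
  -- both Jacobians integrate to zero, and the difference of the integrals is the claim.
  set F₁ : E → E := fun x => f x + ψ (f x) • e with hF₁
  have hF₁L : LipschitzWith (K + ‖e‖₊ * (Kθ * K)) F₁ := by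
    refine hfK.add ?_
    refine LipschitzWith.of_dist_le_mul fun a b => ?_
    rw [dist_eq_norm, ← sub_smul, norm_smul, mul_comm]
    push_cast
    rw [mul_assoc]
    gcongr
    exact (hψL.comp hfK).dist_le_mul a b
  obtain ⟨k₀, hk₀⟩ := hlip f K hfK
  obtain ⟨k₁, hk₁⟩ := hlip F₁ _ hF₁L
  obtain ⟨hi₀, he₀⟩ := integral_det_fderiv_eq_zero hk₀ (hcc f) hn
  obtain ⟨hi₁, he₁⟩ := integral_det_fderiv_eq_zero hk₁ (hcc F₁) hn
  have hdiff : ∫ x, ((fderiv ℝ (fun z => c z • F₁ z) x).det -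
      (fderiv ℝ (fun z => c z • f z) x).det) = 0 := by
    rw [integral_sub hi₁ hi₀, he₀, he₁, sub_zero]
  rw [← integral_indicator measurableSet_ball, ← hdiff]
  refine integral_congr_ae ?_
  -- The chain rule needs ψ differentiable at f(x). The exceptional points of ψ form a null set,
  -- whose preimage is null because f has a Lipschitz inverse.
  have hN : volume (Metric.ball x₀ (2 * ρ) ∩ f ⁻¹' {y | ¬ DifferentiableAt ℝ ψ y}) = 0 := by
    refine nonpos_iff_eq_zero.1 ((volume_inter_preimage_le hfL).trans_eq ?_)
    rw [show volume {y | ¬ DifferentiableAt ℝ ψ y} = 0 from hψL.ae_differentiableAt, mul_zero]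
  have hN' : ∀ᵐ x, x ∉ Metric.ball x₀ (2 * ρ) ∩ f ⁻¹' {y | ¬ DifferentiableAt ℝ ψ y} :=
    measure_eq_zero_iff_ae_notMem.1 hN
  filter_upwards [hN', hfK.ae_differentiableAt] with x hx hfx
  by_cases hxb : x ∈ Metric.ball x₀ ρ
  · have hx2 : x ∈ Metric.ball x₀ (2 * ρ) := Metric.ball_subset_ball (by linarith) hxb
    have hψd : DifferentiableAt ℝ ψ (f x) := by
      by_contra h; exact hx ⟨hx2, h⟩
    have hloc : ∀ F : E → E, (fun z => c z • F z) =ᶠ[𝓝 x] F := fun F => by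
      filter_upwards [Metric.isOpen_ball.mem_nhds hxb] with z hz
      rw [hc1 z (le_of_lt hz), one_smul]
    rw [Set.indicator_of_mem hxb, (hloc F₁).fderiv_eq, (hloc f).fderiv_eq]
    have hd : HasFDerivAt F₁ (fderiv ℝ f x + ((fderiv ℝ ψ (f x)).comp (fderiv ℝ f x)).smulRight e) x :=
      hfx.hasFDerivAt.add ((hψd.hasFDerivAt.comp x hfx.hasFDerivAt).smul_const e)
    rw [hd.fderiv, det_add_smulRight_comp]
    have hl : fderiv ℝ ψ (f x) e = θ (f x) := by
      have h1 : HasDerivAt (fun t : ℝ => ψ (f x + t • e)) (fderiv ℝ ψ (f x) e) 0 := by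
        have := hψd.hasFDerivAt.hasLineDerivAt e
        exact this
      have h2 := segmentAverage_hasDerivAt hθ.continuous e (f x)
      rw [h1.unique h2]
      have h3 : θ (f x - e) = 0 := by
        by_contra h
        refine hmiss x hx2 ?_
        have := hθs _ h
        rw [Metric.mem_ball, dist_eq_norm] at this ⊢
        rwa [he, show f x - (p - f x₀) - f x₀ = f x - p by abel] at this
      rw [h3, sub_zero]
    rw [hl]; ring
  · rw [Set.indicator_of_notMem hxb]
    have hloc : (fun z => c z • F₁ z) =ᶠ[𝓝 x] (fun z => c z • f z) := by
      have hxo : x ∈ (Metric.closedBall x₀ (ρ / 2))ᶜ := by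
        simp only [Metric.mem_ball, Set.mem_compl_iff, Metric.mem_closedBall] at hxb ⊢
        linarith
      filter_upwards [Metric.isClosed_closedBall.isOpen_compl.mem_nhds hxo] with z hz
      by_cases hcz : c z = 0
      · simp [hcz]
      · have : ψ (f z) = 0 := by
          by_contra h
          exact hz (hψx z (by have := hcs z hcz; simp only [Metric.mem_ball]; linarith) h)
        simp [hF₁, this]
    rw [hloc.fderiv_eq, sub_self]

/-- A kernel vector v would give f(x + tv) - f(x) = o(t), against |t|‖v‖ ≤ L‖f(x + tv) - f(x)‖. -/
theorem det_fderiv_ne_zero_of_antilipschitz {f : E → E} {L : ℝ≥0} {U : Set E} (hU : IsOpen U)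
    (hfL : ∀ z₁ ∈ U, ∀ z₂ ∈ U, dist z₁ z₂ ≤ L * dist (f z₁) (f z₂)) {x : E} (hx : x ∈ U)
    (hd : DifferentiableAt ℝ f x) : (fderiv ℝ f x).det ≠ 0 := by
  intro h0
  obtain ⟨v, hv, hv0⟩ : ∃ v : E, v ≠ 0 ∧ fderiv ℝ f x v = 0 := by
    have := LinearMap.bot_lt_ker_of_det_eq_zero (f := (fderiv ℝ f x : E →ₗ[ℝ] E)) h0
    obtain ⟨v, hv, hne⟩ := Submodule.exists_mem_ne_zero_of_ne_bot this.ne'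
    exact ⟨v, hne, hv⟩
  have h1 : HasDerivAt (fun t : ℝ => f (x + t • v)) 0 0 := by
    have := hd.hasFDerivAt.hasLineDerivAt v
    rw [hv0] at this; exact this
  have hvp : 0 < ‖v‖ := norm_pos_iff.2 hv
  have hc : 0 < ‖v‖ / (2 * ((L : ℝ) + 1)) := by positivity
  have h2 := (hasDerivAt_iff_isLittleO.1 h1).def hc
  have h3 : ∀ᶠ t : ℝ in 𝓝 0, x + t • v ∈ U := by
    have : Tendsto (fun t : ℝ => x + t • v) (𝓝 0) (𝓝 x) := by
      have : Continuous (fun t : ℝ => x + t • v) := by fun_prop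
      simpa using this.tendsto 0
    exact this.eventually (hU.mem_nhds hx)
  have h4 : ∀ᶠ t : ℝ in 𝓝[≠] 0, False := by
    filter_upwards [h2.filter_mono nhdsWithin_le_nhds, h3.filter_mono nhdsWithin_le_nhds,
      self_mem_nhdsWithin] with t ht2 ht3 ht0
    have ht0' : 0 < |t| := abs_pos.2 ht0
    simp only [zero_smul, add_zero, sub_zero, smul_zero, Real.norm_eq_abs] at ht2
    have h5 := hfL _ ht3 x hx
    rw [dist_eq_norm, dist_eq_norm, add_sub_cancel_left, norm_smul, Real.norm_eq_abs] at h5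
    have h6 : |t| * ‖v‖ ≤ L * (‖v‖ / (2 * ((L : ℝ) + 1)) * |t|) :=
      h5.trans (mul_le_mul_of_nonneg_left ht2 L.coe_nonneg)
    have h7 : (L : ℝ) * (‖v‖ / (2 * ((L : ℝ) + 1)) * |t|) < |t| * ‖v‖ := by
      have hL : (0 : ℝ) ≤ L := L.coe_nonneg
      rw [show (L : ℝ) * (‖v‖ / (2 * ((L : ℝ) + 1)) * |t|) =
        (L / (2 * ((L : ℝ) + 1))) * (|t| * ‖v‖) by field_simp]
      refine mul_lt_of_lt_one_left (by positivity) ?_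
      rw [div_lt_one (by positivity)]; linarith
    linarith
  have : (𝓝[≠] (0 : ℝ)).NeBot := inferInstance
  exact h4.exists.elim fun _ h => h

theorem locallyIntegrable_det_fderiv {f : E → E} {K : ℝ≥0} (hf : LipschitzWith K f) :
    LocallyIntegrable (fun x => (fderiv ℝ f x).det) := by
  obtain ⟨M, hM⟩ := (isCompact_closedBall (0 : E →L[ℝ] E) K).exists_bound_of_continuousOn
    (ContinuousLinearMap.continuous_det (𝕜 := ℝ) (E := E)).continuousOn
  have : MemLp (fun x => (fderiv ℝ f x).det) ∞ volume := by
    refine memLp_top_of_bound ?_ M (ae_of_all _ fun x => hM _ ?_)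
    · exact (ContinuousLinearMap.continuous_det.measurable.comp
        (measurable_fderiv ℝ f)).aestronglyMeasurable
    · simpa using norm_fderiv_le_of_lipschitz ℝ hf
  exact this.locallyIntegrable le_top

/-- **Invariance of domain** for bi-Lipschitz maps. -/
theorem mem_interior_image_of_biLipschitz (hn : Module.finrank ℝ E ≠ 0) {f : E → E} {K L : ℝ≥0}
    {x₀ : E} {ρ : ℝ} (hρ : 0 < ρ) (hfK : LipschitzOnWith K f (Metric.ball x₀ ρ))
    (hfL : ∀ z₁ ∈ Metric.ball x₀ ρ, ∀ z₂ ∈ Metric.ball x₀ ρ,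
      dist z₁ z₂ ≤ L * dist (f z₁) (f z₂)) :
    f x₀ ∈ interior (f '' Metric.ball x₀ ρ) := by
  wlog hL1 : 1 ≤ L generalizing L
  · refine this (L := max L 1) (fun z₁ h₁ z₂ h₂ => (hfL z₁ h₁ z₂ h₂).trans ?_) (le_max_right _ _)
    gcongr
    exact le_max_left _ _
  obtain ⟨g, hg, hfg⟩ := hfK.extend_finite_dimension
  have hx₀ : x₀ ∈ Metric.ball x₀ ρ := Metric.mem_ball_self hρ
  rw [hfg.image_eq, hfg hx₀]
  have hgL : ∀ z₁ ∈ Metric.ball x₀ ρ, ∀ z₂ ∈ Metric.ball x₀ ρ,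
      dist z₁ z₂ ≤ L * dist (g z₁) (g z₂) := fun z₁ h₁ z₂ h₂ => by
    rw [← hfg h₁, ← hfg h₂]; exact hfL z₁ h₁ z₂ h₂
  generalize lipschitzExtensionConstant E * K = K' at hg
  clear hfK hfL hfg f K
  have hL0 : (0 : ℝ) < L := lt_of_lt_of_le one_pos hL1
  obtain ⟨ρ₁, rfl⟩ : ∃ ρ₁, ρ = 2 * ρ₁ := ⟨ρ / 2, by ring⟩
  have hρ₁ : 0 < ρ₁ := by linarith
  -- If g(x₀) is not interior, the compact image of the closed ball of radius ρ₁ omits a ball around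
  -- some p close to g(x₀). Points of the large ball at distance more than ρ₁ from x₀ cannot reach
  -- that ball either, by the lower Lipschitz bound.
  by_contra hcon
  have hsub : Metric.closedBall x₀ ρ₁ ⊆ Metric.ball x₀ (2 * ρ₁) :=
    Metric.closedBall_subset_ball (by linarith)
  have hC : IsClosed (g '' Metric.closedBall x₀ ρ₁) :=
    ((isCompact_closedBall x₀ ρ₁).image hg.continuous).isClosed
  set η : ℝ := ρ₁ / (4 * L) with hη
  have hη0 : 0 < η := by positivity
  obtain ⟨p, hp, hpC⟩ : ∃ p ∈ Metric.ball (g x₀) η, p ∉ g '' Metric.closedBall x₀ ρ₁ := by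
    by_contra! h
    apply hcon
    rw [mem_interior_iff_mem_nhds]
    exact mem_of_superset (Metric.ball_mem_nhds _ hη0) fun y hy =>
      Set.image_mono hsub (h y hy)
  obtain ⟨η₂, hη₂, hη₂C⟩ := Metric.isOpen_iff.1 hC.isOpen_compl p hpC
  set η₁ := min η η₂ with hη₁
  have hη₁0 : 0 < η₁ := lt_min hη0 hη₂
  have hpη : L * (dist p (g x₀) + η₁) ≤ ρ₁ / 2 := by
    have h1 : dist p (g x₀) + η₁ ≤ 2 * η := by
      have := min_le_left η η₂
      have := Metric.mem_ball.1 hp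
      linarith
    calc L * (dist p (g x₀) + η₁) ≤ L * (2 * η) := by gcongr
      _ = ρ₁ / 2 := by rw [hη]; field_simp; norm_num
  have hmiss : ∀ x ∈ Metric.ball x₀ (2 * ρ₁), g x ∉ Metric.ball p η₁ := by
    intro x hx hxp
    by_cases hxc : x ∈ Metric.closedBall x₀ ρ₁
    · exact hη₂C (Metric.ball_subset_ball (min_le_right _ _) hxp) ⟨x, hxc, rfl⟩
    · have h1 := hgL x hx x₀ hx₀
      have h2 : dist (g x) (g x₀) ≤ dist p (g x₀) + η₁ := by
        have := Metric.mem_ball.1 hxp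
        linarith [dist_triangle (g x) p (g x₀)]
      have h3 := h1.trans ((mul_le_mul_of_nonneg_left h2 hL0.le).trans hpη)
      simp only [Metric.mem_closedBall, not_le] at hxc
      linarith
  -- Chosen so that g maps the ball of radius κ into the ball of radius η₁/2 around g(x₀), where the
  -- cutoff used below equals 1.
  set κ : ℝ := min ρ₁ (η₁ / (2 * (K' + 1))) with hκ
  have hκ0 : 0 < κ := lt_min hρ₁ (by positivity)
  have hκ1 : K' * κ ≤ η₁ / 2 := by
    have h1 : κ ≤ η₁ / (2 * (K' + 1)) := min_le_right _ _
    calc (K' : ℝ) * κ ≤ (K' + 1) * (η₁ / (2 * (K' + 1))) := by gcongr; linarith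
      _ = η₁ / 2 := by field_simp
  have hinj : Set.InjOn g (Metric.ball x₀ (2 * ρ₁)) := fun a ha b hb hab => by
    have := hgL a ha b hb
    rw [hab, dist_self, mul_zero] at this
    exact dist_le_zero.1 this
  have hzero : ∀ᵐ x, x ∈ Metric.ball x₀ κ → (fderiv ℝ g x).det = 0 := by
    refine Metric.isOpen_ball.ae_eq_zero_of_integral_contDiff_smul_eq_zero
      ((locallyIntegrable_det_fderiv hg).locallyIntegrableOn _) fun ζ hζ hζc hζs => ?_
    obtain ⟨Kζ, hKζ⟩ := hζ.lipschitzWith_of_hasCompactSupport hζc (by simp)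
    obtain ⟨M, hM⟩ := hζc.exists_bound_of_continuous hζ.continuous
    -- Every test function ζ near x₀ has the form θ ∘ g: it is transported by the inverse of g,
    -- extended as a Lipschitz function, truncated and cut off near g(x₀). Orthogonality to all θ ∘
    -- g therefore makes the Jacobian vanish.
    have hq : LipschitzOnWith (Kζ * L) (ζ ∘ Function.invFunOn g (Metric.ball x₀ (2 * ρ₁)))
        (g '' Metric.ball x₀ (2 * ρ₁)) := by
      refine LipschitzOnWith.of_dist_le_mul ?_
      rintro _ ⟨a, ha, rfl⟩ _ ⟨b, hb, rfl⟩
      simp only [Function.comp]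
      rw [hinj.leftInvOn_invFunOn ha, hinj.leftInvOn_invFunOn hb]
      refine (hKζ.dist_le_mul a b).trans ?_
      push_cast
      rw [mul_assoc]
      gcongr
      exact hgL a ha b hb
    obtain ⟨θ₀, hθ₀, hθ₀q⟩ := hq.extend_real
    have hθ₀ζ : ∀ x ∈ Metric.ball x₀ (2 * ρ₁), θ₀ (g x) = ζ x := fun x hx => by
      rw [← hθ₀q ⟨x, hx, rfl⟩, Function.comp, hinj.leftInvOn_invFunOn hx]
    set θ₁ : E → ℝ := fun y => max (-M) (min M (θ₀ y)) with hθ₁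
    have hM0 : 0 ≤ M := (norm_nonneg _).trans (hM 0)
    have hθ₁L : LipschitzWith (Kζ * L) θ₁ := (hθ₀.const_min M).const_max (-M)
    have hθ₁M : ∀ y, ‖θ₁ y‖ ≤ Real.toNNReal M := fun y => by
      rw [Real.coe_toNNReal _ hM0, Real.norm_eq_abs, abs_le]
      exact ⟨le_max_left _ _, max_le (by linarith) (min_le_left _ _)⟩
    obtain ⟨Kc, c, hcL, hc01, hc1, hc0⟩ := exists_lipschitz_cutoff (g x₀)
      (show η₁ / 2 < η₁ by linarith)
    have hθL := hcL.smul_of_bounded_on_support hc01 hθ₁L (fun z _ => hθ₁M z)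
    have hint := setIntegral_comp_mul_det_eq_zero hn hg hgL hρ₁ hpη hmiss hθL (fun y hy => by
      by_contra h
      exact hy (by rw [hc0 y (by simpa using h), zero_smul]))
    rw [← setIntegral_eq_integral_of_forall_compl_eq_zero (s := Metric.ball x₀ ρ₁), ← hint]
    · refine setIntegral_congr_fun measurableSet_ball fun x hx => ?_
      have hx2 : x ∈ Metric.ball x₀ (2 * ρ₁) := Metric.ball_subset_ball (by linarith) hx
      have h1 : θ₁ (g x) = ζ x := by
        have := abs_le.1 (hM x)
        simp only [hθ₁, hθ₀ζ x hx2]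
        rw [min_eq_right this.2, max_eq_right this.1]
      simp only [h1, smul_eq_mul]
      by_cases hxκ : x ∈ Metric.ball x₀ κ
      · rw [hc1 (g x), one_mul]
        refine (hg.dist_le_mul x x₀).trans (le_trans ?_ hκ1)
        gcongr
        exact (Metric.mem_ball.1 hxκ).le
      · rw [image_eq_zero_of_notMem_tsupport fun h => hxκ (hζs h)]; simp
    · intro x hx
      rw [image_eq_zero_of_notMem_tsupport fun h =>
        hx (Metric.ball_subset_ball (min_le_left _ _) (hζs h)), zero_smul]
  have hnull : volume (Metric.ball x₀ κ) = 0 := by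
    refine measure_eq_zero_iff_ae_notMem.2 ?_
    filter_upwards [hzero, hg.ae_differentiableAt] with x hx hd hxκ
    refine det_fderiv_ne_zero_of_antilipschitz Metric.isOpen_ball hgL ?_ hd (hx hxκ)
    exact Metric.ball_subset_ball (by have := min_le_left ρ₁ (η₁ / (2 * (K' + 1))); linarith) hxκ
  exact (Metric.measure_ball_pos volume x₀ hκ0).ne' hnull

/-- A bi-Lipschitz map covers a ball around the image of the centre. -/
theorem ball_subset_image_of_biLipschitz (hn : Module.finrank ℝ E ≠ 0) {f : E → E} {L : ℝ}
    (hL : 0 < L) {x₀ : E} {ρ : ℝ}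
    (hf : ∀ z₁ ∈ Metric.ball x₀ ρ, ∀ z₂ ∈ Metric.ball x₀ ρ,
      L⁻¹ * ‖z₁ - z₂‖ ≤ ‖f z₁ - f z₂‖ ∧ ‖f z₁ - f z₂‖ ≤ L * ‖z₁ - z₂‖) :
    IsOpen (f '' Metric.ball x₀ ρ) ∧
      Metric.ball (f x₀) (ρ / L) ⊆ f '' Metric.ball x₀ ρ := by
  have hK : LipschitzOnWith (Real.toNNReal L) f (Metric.ball x₀ ρ) := by
    refine LipschitzOnWith.of_dist_le_mul fun a ha b hb => ?_
    rw [Real.coe_toNNReal _ hL.le, dist_eq_norm, dist_eq_norm]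
    exact (hf a ha b hb).2
  have hA : ∀ z₁ ∈ Metric.ball x₀ ρ, ∀ z₂ ∈ Metric.ball x₀ ρ,
      dist z₁ z₂ ≤ Real.toNNReal L * dist (f z₁) (f z₂) := by
    intro a ha b hb
    rw [Real.coe_toNNReal _ hL.le, dist_eq_norm, dist_eq_norm]
    exact (inv_mul_le_iff₀ hL).1 (hf a ha b hb).1
  have hopen : IsOpen (f '' Metric.ball x₀ ρ) := by
    rw [isOpen_iff_mem_nhds]
    rintro _ ⟨x, hx, rfl⟩
    obtain ⟨δ, hδ, hδs⟩ := Metric.isOpen_iff.1 Metric.isOpen_ball x hx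
    have := mem_interior_image_of_biLipschitz hn hδ (hK.mono hδs)
      (fun z₁ h₁ z₂ h₂ => hA z₁ (hδs h₁) z₂ (hδs h₂))
    exact mem_of_superset (mem_interior_iff_mem_nhds.1 this) (Set.image_mono hδs)
  refine ⟨hopen, ?_⟩
  rcases le_or_gt ρ 0 with hρ | hρ
  · rw [Metric.ball_eq_empty.2 (div_nonpos_of_nonpos_of_nonneg hρ hL.le)]; exact Set.empty_subset _
  have hx₀ : x₀ ∈ Metric.ball x₀ ρ := Metric.mem_ball_self hρ
  -- The open image is also relatively closed in the ball of radius ρ/L: preimages of points close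
  -- to y stay in a compact ball of radius t < ρ. Connectedness concludes.
  refine (convex_ball (f x₀) (ρ / L)).isPreconnected.subset_of_closure_inter_subset hopen
    ⟨f x₀, Metric.mem_ball_self (by positivity), x₀, hx₀, rfl⟩ ?_
  rintro y ⟨hyc, hyb⟩
  obtain ⟨t, ht, hyt⟩ : ∃ t, t < ρ ∧ L * dist y (f x₀) < t := by
    have : L * dist y (f x₀) < ρ := by
      have := (lt_div_iff₀ hL).1 (Metric.mem_ball.1 hyb)
      linarith
    obtain ⟨t, h1, h2⟩ := exists_between this
    exact ⟨t, h2, h1⟩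
  have hcl : IsClosed (f '' Metric.closedBall x₀ t) :=
    ((isCompact_closedBall x₀ t).image_of_continuousOn
      (hK.continuousOn.mono (Metric.closedBall_subset_ball ht))).isClosed
  refine Set.image_mono (Metric.closedBall_subset_ball ht) (hcl.closure_subset ?_)
  rw [mem_closure_iff_nhds] at hyc ⊢
  intro s hs
  have hs' : s ∩ {y | L * dist y (f x₀) < t} ∈ 𝓝 y := by
    refine inter_mem hs (IsOpen.mem_nhds ?_ hyt)
    exact isOpen_lt (by fun_prop) continuous_const
  obtain ⟨_, ⟨hws, hwt⟩, x, hx, rfl⟩ := hyc _ hs'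
  refine ⟨f x, hws, x, ?_, rfl⟩
  have := hA x hx x₀ hx₀
  rw [Real.coe_toNNReal _ hL.le] at this
  exact (this.trans_lt hwt).le

end InvarianceOfDomain

/-! ### Sobolev fields on the whole space with a singular set -/

section Sobolev

open scoped NNReal ENNReal

variable {N : ℕ}

/-- `L²(ℝ^N, ℝ^{N+1})`. -/
abbrev L2Field (N : ℕ) : Type := Lp (EuclideanSpace ℝ (Fin (N + 1))) 2 (volume : Measure (Rn N))

/-- `φ` is a test function whose support does not meet `C`. -/
def IsTest (C : Set (Rn N)) (φ : Rn N → ℝ) : Prop :=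
  ContDiff ℝ (⊤ : ℕ∞) φ ∧ HasCompactSupport φ ∧ Disjoint (tsupport φ) C

/-- `g` is the weak gradient of `u` on the complement of `C`. -/
def IsWeakGrad (C : Set (Rn N)) (u : Rn N → ℝ) (g : Fin N → Rn N → ℝ) : Prop :=
  ∀ φ, IsTest C φ → ∀ i, ∫ x, u x * partialDeriv i φ x = -∫ x, g i x * φ x

theorem IsTest.mono {C C' : Set (Rn N)} (h : C ⊆ C') {φ : Rn N → ℝ} (hφ : IsTest C' φ) :
    IsTest C φ := ⟨hφ.1, hφ.2.1, hφ.2.2.mono_right h⟩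

theorem IsTest.memLp {C : Set (Rn N)} {φ : Rn N → ℝ} (hφ : IsTest C φ) {p : ℝ≥0∞}
    (μ : Measure (Rn N)) [IsFiniteMeasureOnCompacts μ] : MemLp φ p μ :=
  hφ.1.continuous.memLp_of_hasCompactSupport hφ.2.1

theorem IsTest.memLp_partialDeriv {C : Set (Rn N)} {φ : Rn N → ℝ} (hφ : IsTest C φ) (i : Fin N)
    {p : ℝ≥0∞} (μ : Measure (Rn N)) [IsFiniteMeasureOnCompacts μ] :
    MemLp (partialDeriv i φ) p μ :=
  (partialDeriv_continuous i hφ.1).memLp_of_hasCompactSupport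
    (partialDeriv_hasCompactSupport i hφ.2.1)

theorem memLp_coord {μ : Measure (Rn N)} (F : Lp (EuclideanSpace ℝ (Fin (N + 1))) 2 μ)
    (j : Fin (N + 1)) : MemLp (fun x => F x j) 2 μ :=
  (EuclideanSpace.proj j : EuclideanSpace ℝ (Fin (N + 1)) →L[ℝ] ℝ).comp_memLp' (Lp.memLp F)

theorem memLp_toLp_single {μ : Measure (Rn N)} {ψ : Rn N → ℝ} (hψ : MemLp ψ 2 μ)
    (j : Fin (N + 1)) :
    MemLp (fun x => EuclideanSpace.single j (ψ x) : Rn N → EuclideanSpace ℝ (Fin (N + 1))) 2 μ := by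
  have := (((1 : ℝ →L[ℝ] ℝ).smulRight
    (EuclideanSpace.single j (1 : ℝ) : EuclideanSpace ℝ (Fin (N + 1))))).comp_memLp' hψ
  refine this.ae_eq (ae_of_all _ fun x => ?_)
  ext k
  simp

/-- The functional `F ↦ ∫ F_j ψ`. -/
noncomputable def coordCLM {μ : Measure (Rn N)} {ψ : Rn N → ℝ} (hψ : MemLp ψ 2 μ)
    (j : Fin (N + 1)) : Lp (EuclideanSpace ℝ (Fin (N + 1))) 2 μ →L[ℝ] ℝ :=
  innerSL ℝ (memLp_toLp_single hψ j).toLp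

theorem inner_toLp_single {μ : Measure (Rn N)} {ψ : Rn N → ℝ} (hψ : MemLp ψ 2 μ)
    (j : Fin (N + 1)) (F : Lp (EuclideanSpace ℝ (Fin (N + 1))) 2 μ) :
    inner ℝ (memLp_toLp_single hψ j).toLp F = ∫ x, F x j * ψ x ∂μ := by
  rw [L2.inner_def]
  refine integral_congr_ae ?_
  filter_upwards [(memLp_toLp_single hψ j).coeFn_toLp] with x hx
  rw [hx, EuclideanSpace.inner_single_left]
  simp [mul_comm]

theorem coordCLM_apply {μ : Measure (Rn N)} {ψ : Rn N → ℝ} (hψ : MemLp ψ 2 μ)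
    (j : Fin (N + 1)) (F : Lp (EuclideanSpace ℝ (Fin (N + 1))) 2 μ) :
    coordCLM hψ j F = ∫ x, F x j * ψ x ∂μ := inner_toLp_single hψ j F

/-- The fields `(u, ∇u)`, where `u` has a square integrable weak gradient off `C`. -/
noncomputable def sobolev (C : Set (Rn N)) : Submodule ℝ (L2Field N) :=
  ⨅ (φ : {φ : Rn N → ℝ // IsTest C φ}) (i : Fin N),
    LinearMap.ker ((coordCLM (φ.2.memLp_partialDeriv i volume) 0
      + coordCLM (φ.2.memLp volume) i.succ : L2Field N →L[ℝ] ℝ) : L2Field N →ₗ[ℝ] ℝ)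

theorem mem_sobolev {C : Set (Rn N)} {F : L2Field N} :
    F ∈ sobolev C ↔ IsWeakGrad C (fun x => F x 0) (fun i x => F x i.succ) := by
  simp only [sobolev, Submodule.mem_iInf, LinearMap.mem_ker, Subtype.forall, IsWeakGrad]
  refine forall_congr' fun φ => forall_congr' fun hφ => forall_congr' fun i => ?_
  change coordCLM _ 0 F + coordCLM _ i.succ F = 0 ↔ _
  rw [coordCLM_apply, coordCLM_apply, add_eq_zero_iff_eq_neg]

theorem sobolev_mono {C C' : Set (Rn N)} (h : C ⊆ C') : sobolev C ≤ sobolev C' := fun F hF => by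
  rw [mem_sobolev] at hF ⊢
  exact fun φ hφ i => hF φ (hφ.mono h) i

theorem exists_field {u : Rn N → ℝ} {g : Fin N → Rn N → ℝ} (hu : MemLp u 2 volume)
    (hg : ∀ i, MemLp (g i) 2 volume) :
    ∃ F : L2Field N, (∀ᵐ x, F x 0 = u x) ∧ ∀ i, ∀ᵐ x, F x i.succ = g i x := by
  have h : MemLp (fun x => WithLp.toLp 2 (Fin.cons (u x) (fun i => g i x)) :
      Rn N → EuclideanSpace ℝ (Fin (N + 1))) 2 volume := by
    refine MemLp.of_eval_piLp fun j => ?_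
    refine Fin.cases ?_ (fun i => ?_) j
    · simpa using hu
    · simpa using hg i
  refine ⟨h.toLp, ?_, fun i => ?_⟩
  · filter_upwards [h.coeFn_toLp] with x hx
    rw [hx]; simp
  · filter_upwards [h.coeFn_toLp] with x hx
    rw [hx]; simp

theorem mem_sobolev_of_ae {C : Set (Rn N)} {u : Rn N → ℝ} {g : Fin N → Rn N → ℝ}
    (h : IsWeakGrad C u g) {F : L2Field N} (h0 : ∀ᵐ x, F x 0 = u x)
    (hs : ∀ i, ∀ᵐ x, F x i.succ = g i x) : F ∈ sobolev C := by
  rw [mem_sobolev]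
  intro φ hφ i
  rw [integral_congr_ae (g := fun x => u x * partialDeriv i φ x) (h0.mono fun x hx => by simp [hx]),
    integral_congr_ae (f := fun x => F x i.succ * φ x) (g := fun x => g i x * φ x)
      ((hs i).mono fun x hx => by simp [hx])]
  exact h φ hφ i

theorem field_ext {F G : L2Field N} (h0 : ∀ᵐ x, F x 0 = G x 0)
    (hs : ∀ i : Fin N, ∀ᵐ x, F x i.succ = G x i.succ) : F = G := by
  refine Lp.ext ?_
  filter_upwards [h0, ae_all_iff.2 hs] with x h1 h2
  ext j
  exact Fin.cases h1 h2 j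

/-- A field of the Sobolev space whose first coordinate vanishes on an open set `U` vanishes
on `U`. -/
theorem sobolev_ae_eq_zero {C : Set (Rn N)} (hC : IsClosed C) {F : L2Field N} (hF : F ∈ sobolev C)
    {U : Set (Rn N)} (hU : IsOpen U) (h0 : ∀ᵐ x, x ∈ U → F x 0 = 0) :
    ∀ᵐ x, x ∈ U → x ∉ C → F x = 0 := by
  rw [mem_sobolev] at hF
  have hs : ∀ i : Fin N, ∀ᵐ x, x ∈ U \ C → F x i.succ = 0 := by
    intro i
    refine (hU.sdiff hC).ae_eq_zero_of_integral_contDiff_smul_eq_zero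
      (((memLp_coord F i.succ).locallyIntegrable (by norm_num)).locallyIntegrableOn _)
      fun φ h1 h2 h3 => ?_
    have := hF φ ⟨h1, h2, Set.disjoint_left.2 fun x hx => (h3 hx).2⟩ i
    have e : ∫ x, F x 0 * partialDeriv i φ x = 0 := by
      refine integral_eq_zero_of_ae ?_
      filter_upwards [h0] with x hx
      by_cases hxU : x ∈ U
      · simp [hx hxU]
      · have : fderiv ℝ φ x = 0 := by
          by_contra h
          exact hxU (h3 (support_fderiv_subset ℝ h)).1
        simp [partialDeriv, this]
    rw [e] at this
    simp_rw [smul_eq_mul, mul_comm (φ _)]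
    linarith
  filter_upwards [h0, ae_all_iff.2 hs] with x hx1 hx2 hxU hxC
  ext j
  exact Fin.cases (hx1 hxU) (fun i => hx2 i ⟨hxU, hxC⟩) j

theorem partialDeriv_mul {ζ φ : Rn N → ℝ} {x : Rn N} (i : Fin N) (hζ : DifferentiableAt ℝ ζ x)
    (hφ : DifferentiableAt ℝ φ x) : partialDeriv i (fun y => ζ y * φ y) x =
      ζ x * partialDeriv i φ x + partialDeriv i ζ x * φ x := by
  rw [partialDeriv, fderiv_fun_mul hζ hφ]
  simp [partialDeriv, mul_comm]

theorem partialDeriv_eq_zero_of_notMem_tsupport {φ : Rn N → ℝ} {x : Rn N} (i : Fin N)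
    (hx : x ∉ tsupport φ) : partialDeriv i φ x = 0 := by
  have : fderiv ℝ φ x = 0 := by
    by_contra h
    exact hx (support_fderiv_subset ℝ h)
  simp [partialDeriv, this]

theorem measurable_partialDeriv (i : Fin N) (ζ : Rn N → ℝ) : Measurable (partialDeriv i ζ) :=
  measurable_fderiv_apply_const ℝ ζ _

/-- The product of a Sobolev field with a multiplier which is smooth off `C'`. -/
theorem exists_mul_mem_sobolev {C C' : Set (Rn N)} {ζ : Rn N → ℝ} (hm : Measurable ζ)
    (hζ : ∀ x, x ∉ C' → ContDiffAt ℝ (⊤ : ℕ∞) ζ x) (hCC' : tsupport ζ ∩ C ⊆ C') {M : ℝ}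
    (hM : ∀ᵐ x, |ζ x| ≤ M ∧ ∀ i, |partialDeriv i ζ x| ≤ M) {F : L2Field N} (hF : F ∈ sobolev C) :
    ∃ G ∈ sobolev C', (∀ᵐ x, G x 0 = ζ x * F x 0) ∧
      ∀ i : Fin N, ∀ᵐ x, G x i.succ = ζ x * F x i.succ + partialDeriv i ζ x * F x 0 := by
  have hb : ∀ j, MemLp (fun x => ζ x * F x j) 2 volume := fun j =>
    (memLp_coord F j).of_le_mul (c := M)
      (hm.aestronglyMeasurable.mul (memLp_coord F j).1) (hM.mono fun x hx => by
        rw [norm_mul]; exact mul_le_mul_of_nonneg_right hx.1 (norm_nonneg _))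
  have hb' : ∀ i, MemLp (fun x => partialDeriv i ζ x * F x 0) 2 volume := fun i =>
    (memLp_coord F 0).of_le_mul (c := M)
      ((measurable_partialDeriv i ζ).aestronglyMeasurable.mul (memLp_coord F 0).1)
      (hM.mono fun x hx => by
        rw [norm_mul]; exact mul_le_mul_of_nonneg_right (hx.2 i) (norm_nonneg _))
  obtain ⟨G, hG0, hGs⟩ := exists_field (hb 0) (fun i => (hb (Fin.succ i)).add (hb' i))
  refine ⟨G, mem_sobolev_of_ae ?_ hG0 hGs, hG0, hGs⟩
  intro φ hφ i
  -- ζ is smooth wherever φ lives, as the support of φ avoids C'; and a point of C in both supports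
  -- would belong to C'. So the multiplier is moved onto the test function.
  have hφt : IsTest C (fun x => ζ x * φ x) := by
    refine ⟨?_, hφ.2.1.mul_left, ?_⟩
    · rw [contDiff_iff_contDiffAt]
      intro x
      by_cases hx : x ∈ tsupport φ
      · exact (hζ x (Set.disjoint_left.1 hφ.2.2 hx)).mul hφ.1.contDiffAt
      · refine (contDiffAt_const (c := (0 : ℝ))).congr_of_eventuallyEq ?_
        filter_upwards [(isClosed_tsupport φ).isOpen_compl.mem_nhds hx] with y hy
        rw [image_eq_zero_of_notMem_tsupport hy, mul_zero]
    · rw [Set.disjoint_left]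
      intro x hx hxC
      have h1 : x ∈ tsupport ζ := tsupport_mul_subset_left hx
      have h2 : x ∈ tsupport φ := tsupport_mul_subset_right hx
      exact Set.disjoint_left.1 hφ.2.2 h2 (hCC' ⟨h1, hxC⟩)
  have key := mem_sobolev.1 hF _ hφt i
  have e : ∀ x, partialDeriv i (fun y => ζ y * φ y) x =
      ζ x * partialDeriv i φ x + partialDeriv i ζ x * φ x := by
    intro x
    by_cases hx : x ∈ tsupport φ
    · exact partialDeriv_mul i
        ((hζ x (Set.disjoint_left.1 hφ.2.2 hx)).differentiableAt (by simp))
        (hφ.1.differentiable (by simp) x)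
    · rw [partialDeriv_eq_zero_of_notMem_tsupport i hx, image_eq_zero_of_notMem_tsupport hx,
        partialDeriv_eq_zero_of_notMem_tsupport i fun h => hx (tsupport_mul_subset_right h)]
      ring
  have i1 : Integrable (fun x => ζ x * F x 0 * partialDeriv i φ x) :=
    (hb 0).integrable_mul (hφ.memLp_partialDeriv i (p := 2) volume)
  have i2 : Integrable (fun x => partialDeriv i ζ x * F x 0 * φ x) :=
    (hb' i).integrable_mul (hφ.memLp (p := 2) volume)
  have i3 : Integrable (fun x => ζ x * F x i.succ * φ x) :=
    (hb i.succ).integrable_mul (hφ.memLp (p := 2) volume)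
  have k1 : ∫ x, F x 0 * partialDeriv i (fun y => ζ y * φ y) x =
      (∫ x, ζ x * F x 0 * partialDeriv i φ x) + ∫ x, partialDeriv i ζ x * F x 0 * φ x := by
    rw [← integral_add i1 i2]
    refine integral_congr_ae (ae_of_all _ fun x => ?_)
    simp only [e]; ring
  have k2 : ∫ x, F x i.succ * (ζ x * φ x) = ∫ x, ζ x * F x i.succ * φ x :=
    integral_congr_ae (ae_of_all _ fun x => by simp only []; ring)
  have k3 : ∫ x, (ζ x * F x i.succ + partialDeriv i ζ x * F x 0) * φ x =
      (∫ x, ζ x * F x i.succ * φ x) + ∫ x, partialDeriv i ζ x * F x 0 * φ x := by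
    rw [← integral_add i3 i2]
    exact integral_congr_ae (ae_of_all _ fun x => by simp only []; ring)
  rw [k1, k2] at key
  simp only [Pi.add_apply]
  rw [k3]
  linarith

end Sobolev

/-! ### Riesz representation and weak closedness in a Hilbert space -/

section Hilbert

variable {H : Type*} [NormedAddCommGroup H] [InnerProductSpace ℝ H] [CompleteSpace H]

/-- The bound lets l factor through the range of e as a bounded functional; Hahn–Banach extends it
and Riesz represents it. It is applied to the pairing of a function with derivatives of test
functions. -/
theorem exists_inner_eq_of_bound {V : Type*} [AddCommGroup V] [Module ℝ V] (l : V →ₗ[ℝ] ℝ)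
    (e : V →ₗ[ℝ] H) {A : ℝ} (hA : 0 ≤ A) (h : ∀ v, |l v| ≤ A * ‖e v‖) :
    ∃ g : H, ‖g‖ ≤ A ∧ ∀ v, inner ℝ g (e v) = l v := by
  obtain ⟨f, hf, hfn⟩ := exists_extension_norm_eq (𝕜 := ℝ) (LinearMap.range e) (l.compLeftInverse e)
  refine ⟨(InnerProductSpace.toDual ℝ H).symm f, ?_, fun v => ?_⟩
  · rw [LinearIsometryEquiv.norm_map, hfn]
    refine ContinuousLinearMap.opNorm_le_bound _ hA ?_
    rintro ⟨_, v, rfl⟩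
    rw [LinearMap.compLeftInverse_apply_of_bdd _ _ ⟨A, h⟩ v _ rfl]
    exact h v
  · rw [InnerProductSpace.toDual_symm_apply, hf ⟨e v, v, rfl⟩,
      LinearMap.compLeftInverse_apply_of_bdd _ _ ⟨A, h⟩ v _ rfl]

/-- A closed subspace contains the limit of a bounded sequence which converges when it is tested
against a total set of vectors. -/
theorem mem_of_bounded_of_tendsto_inner {S T : Submodule ℝ H} (hS : IsClosed (S : Set H))
    (hT : Tᗮ = ⊥) {x : H} {u : ℕ → H} (huS : ∀ k, u k ∈ S) {A : ℝ} (hu : ∀ k, ‖u k‖ ≤ A)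
    (hlim : ∀ q ∈ T, Tendsto (fun k => inner ℝ q (u k)) atTop (𝓝 (inner ℝ q x))) : x ∈ S := by
  have hall : ∀ q : H, Tendsto (fun k => inner ℝ q (u k)) atTop (𝓝 (inner ℝ q x)) := by
    intro q
    have hq : q ∈ closure (T : Set H) := by
      have := T.topologicalClosure_eq_top_iff.2 hT
      rw [← Submodule.topologicalClosure_coe, this]; trivial
    have hA : 0 ≤ A := (norm_nonneg _).trans (hu 0)
    rw [Metric.tendsto_nhds]
    intro ε hε
    have hB : 0 < A + ‖x‖ + 1 := by positivity
    obtain ⟨q', hq', hd⟩ := Metric.mem_closure_iff.1 hq (ε / 2 / (A + ‖x‖ + 1)) (by positivity)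
    have h1 := Metric.tendsto_nhds.1 (hlim q' hq') (ε / 2) (by positivity)
    filter_upwards [h1] with k hk
    rw [Real.dist_eq] at hk ⊢
    have e : inner ℝ q (u k) - inner ℝ q x =
        (inner ℝ q' (u k) - inner ℝ q' x) + inner ℝ (q - q') (u k - x) := by
      simp only [inner_sub_left, inner_sub_right]; ring
    rw [e]
    refine (abs_add_le _ _).trans_lt ?_
    have h2 : |inner ℝ (q - q') (u k - x)| ≤ ε / 2 := by
      refine (abs_real_inner_le_norm _ _).trans ?_
      rw [dist_eq_norm] at hd
      have h3 : ‖u k - x‖ ≤ A + ‖x‖ + 1 := by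
        linarith [norm_sub_le (u k) x, hu k]
      calc ‖q - q'‖ * ‖u k - x‖ ≤ ε / 2 / (A + ‖x‖ + 1) * (A + ‖x‖ + 1) := by gcongr
        _ = ε / 2 := by field_simp
    linarith
  -- S is its own double orthogonal complement, and orthogonality to a fixed p ∈ Sᗮ passes to the
  -- weak limit.
  rw [← hS.submodule_topologicalClosure_eq, ← Submodule.orthogonal_orthogonal_eq_closure]
  intro p hp
  have h0 : ∀ k, inner ℝ p (u k) = 0 := fun k => by
    rw [real_inner_comm]; exact hp _ (huS k)
  have := hall p
  simp only [h0] at this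
  exact tendsto_nhds_unique this tendsto_const_nhds

end Hilbert

/-! ### Weak compactness and duality for Sobolev fields -/

section SobolevFunctional

open scoped NNReal ENNReal

variable {N : ℕ}

theorem IsTest.partialDeriv {C : Set (Rn N)} {φ : Rn N → ℝ} (hφ : IsTest C φ) (i : Fin N) :
    IsTest C (partialDeriv i φ) := by
  refine ⟨?_, partialDeriv_hasCompactSupport i hφ.2.1, ?_⟩
  · exact (hφ.1.fderiv_right (m := (⊤ : ℕ∞)) (by simp)).clm_apply contDiff_const
  · refine hφ.2.2.mono_left (closure_minimal ?_ (isClosed_tsupport φ))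
    intro x hx
    by_contra h
    exact hx (partialDeriv_eq_zero_of_notMem_tsupport i h)

theorem norm_field_le (F : L2Field N) :
    ‖F‖ ≤ ∑ j, (eLpNorm (fun x => F x j) 2 volume).toReal := by
  have h1 : eLpNorm F 2 volume ≤ ∑ j, eLpNorm (fun x => F x j) 2 volume := by
    have h2 : eLpNorm F 2 volume ≤ eLpNorm (∑ j, fun x => |F x j|) 2 volume := by
      refine eLpNorm_mono_real fun x => ?_
      rw [Finset.sum_apply, EuclideanSpace.norm_eq]
      refine Real.sqrt_le_iff.2 ⟨Finset.sum_nonneg fun _ _ => abs_nonneg _, ?_⟩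
      refine (Finset.sum_sq_le_sq_sum_of_nonneg (fun _ _ => abs_nonneg _)).trans' ?_
      simp
    refine h2.trans ((eLpNorm_sum_le (fun j _ => ?_) (by norm_num)).trans_eq ?_)
    · exact (memLp_coord F j).1.norm
    · exact Finset.sum_congr rfl fun j _ => eLpNorm_norm (fun x => F x j)
  rw [Lp.norm_def, ← ENNReal.toReal_sum fun j _ => (memLp_coord F j).eLpNorm_ne_top]
  exact ENNReal.toReal_mono (ENNReal.sum_ne_top.2 fun j _ => (memLp_coord F j).eLpNorm_ne_top) h1

/-- Bounded sequences of Sobolev fields whose first coordinates converge weakly: a closed subspace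
which contains the sequence contains the limit. -/
theorem mem_of_bounded_of_tendsto_coord {C : Set (Rn N)} (hC : IsClosed C) (hC0 : volume C = 0)
    {S : Submodule ℝ (L2Field N)} (hS : IsClosed (S : Set (L2Field N))) {F : L2Field N}
    (hF : F ∈ sobolev C) {u : ℕ → L2Field N} (hu : ∀ k, u k ∈ sobolev C) (huS : ∀ k, u k ∈ S)
    {A : ℝ} (hA : ∀ k, ‖u k‖ ≤ A)
    (hlim : ∀ φ, IsTest C φ →
      Tendsto (fun k => ∫ x, u k x 0 * φ x) atTop (𝓝 (∫ x, F x 0 * φ x))) : F ∈ S := by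
  -- Test functions off the null set C, placed in one coordinate, are total. Only coordinate 0 needs
  -- a hypothesis: in coordinate i + 1, integration by parts turns φ into ∂_i φ tested against
  -- coordinate 0.
  set T : Submodule ℝ (L2Field N) := Submodule.span ℝ {q | ∃ (φ : Rn N → ℝ) (hφ : IsTest C φ)
    (j : Fin (N + 1)), q = (memLp_toLp_single (hφ.memLp volume) j).toLp} with hTdef
  refine mem_of_bounded_of_tendsto_inner hS (T := T) ?_ huS hA ?_
  · rw [Submodule.eq_bot_iff]
    intro p hp
    have h1 : ∀ j : Fin (N + 1), ∀ᵐ x, x ∈ Cᶜ → p x j = 0 := by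
      intro j
      refine hC.isOpen_compl.ae_eq_zero_of_integral_contDiff_smul_eq_zero
        (((memLp_coord p j).locallyIntegrable (by norm_num)).locallyIntegrableOn _)
        fun φ h1 h2 h3 => ?_
      have hφ : IsTest C φ := ⟨h1, h2, Set.disjoint_left.2 fun x hx => h3 hx⟩
      have := hp _ (Submodule.subset_span ⟨φ, hφ, j, rfl⟩)
      rw [inner_toLp_single (hφ.memLp volume)] at this
      simpa [mul_comm] using this
    refine Lp.ext ?_
    filter_upwards [ae_all_iff.2 h1, Lp.coeFn_zero (EuclideanSpace ℝ (Fin (N + 1))) 2 volume,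
      measure_eq_zero_iff_ae_notMem.1 hC0] with x hx h0 hxC
    rw [h0]
    ext j
    exact hx j hxC
  · intro q hq
    induction hq using Submodule.span_induction with
    | mem q hq =>
      obtain ⟨φ, hφ, j, rfl⟩ := hq
      simp only [inner_toLp_single (hφ.memLp volume)]
      refine Fin.cases ?_ (fun i => ?_) j
      · exact hlim φ hφ
      · have e : ∀ G ∈ sobolev C, ∫ x, G x i.succ * φ x = -∫ x, G x 0 * partialDeriv i φ x :=
          fun G hG => by rw [mem_sobolev.1 hG φ hφ i, neg_neg]
        simp only [e _ (hu _), e _ hF]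
        exact (hlim _ (hφ.partialDeriv i)).neg
    | zero => simp
    | add a b _ _ ha hb => simp only [inner_add_left]; exact ha.add hb
    | smul c a _ ha => simp only [inner_smul_left]; exact ha.const_mul _

/-- The test functions off `C`, as a space of functions. -/
def testSpace (C : Set (Rn N)) : Submodule ℝ (Rn N → ℝ) where
  carrier := {φ | IsTest C φ}
  zero_mem' := ⟨contDiff_const, HasCompactSupport.zero, by simp [tsupport]⟩
  add_mem' := fun {a b} ha hb => ⟨ha.1.add hb.1, ha.2.1.add hb.2.1, by
    rw [Set.disjoint_left]
    intro x hx
    rcases tsupport_add a b hx with h | h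
    · exact Set.disjoint_left.1 ha.2.2 h
    · exact Set.disjoint_left.1 hb.2.2 h⟩
  smul_mem' := fun c a ha => ⟨contDiff_const.smul ha.1, ha.2.1.smul_left, by
    rw [Set.disjoint_left]
    intro x hx
    exact Set.disjoint_left.1 ha.2.2 (tsupport_smul_subset_right (fun _ => c) a hx)⟩

theorem partialDeriv_add {a b : Rn N → ℝ} (i : Fin N) (ha : Differentiable ℝ a)
    (hb : Differentiable ℝ b) :
    partialDeriv i (a + b) = fun x => partialDeriv i a x + partialDeriv i b x := by
  funext x
  rw [partialDeriv, fderiv_add (ha x) (hb x)]; rfl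

theorem partialDeriv_const_smul {a : Rn N → ℝ} (i : Fin N) (c : ℝ) (ha : Differentiable ℝ a) :
    partialDeriv i (c • a) = fun x => c * partialDeriv i a x := by
  funext x
  rw [partialDeriv, fderiv_const_smul (ha x)]; rfl

/-- A square integrable function whose distributional gradient off `C` is bounded with respect to
the `L²` norm is the first coordinate of a Sobolev field. -/
theorem exists_mem_sobolev_of_bound {C : Set (Rn N)} {u : Rn N → ℝ} (hu : MemLp u 2 volume)
    {A : ℝ} (hA : 0 ≤ A) (h : ∀ φ, IsTest C φ → ∀ i,
      |∫ x, u x * partialDeriv i φ x| ≤ A * (eLpNorm φ 2 volume).toReal) :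
    ∃ F ∈ sobolev C, (∀ᵐ x, F x 0 = u x) ∧ ‖F‖ ≤ (eLpNorm u 2 volume).toReal + N * A := by
  have hd : ∀ φ ∈ testSpace C, Differentiable ℝ φ := fun φ hφ =>
    (show IsTest C φ from hφ).1.differentiable (by simp)
  have key : ∀ i : Fin N, ∃ g : Rn N → ℝ, MemLp g 2 volume ∧
      (eLpNorm g 2 volume).toReal ≤ A ∧
      ∀ φ, IsTest C φ → ∫ x, g x * φ x = -∫ x, u x * partialDeriv i φ x := by
    intro i
    let e : testSpace C →ₗ[ℝ] Lp ℝ 2 (volume : Measure (Rn N)) :=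
      { toFun := fun φ => (φ.2.memLp volume).toLp
        map_add' := fun _ _ => rfl
        map_smul' := fun _ _ => rfl }
    have hint : ∀ φ : testSpace C, Integrable (fun x => u x * partialDeriv i φ.1 x) := fun φ =>
      hu.integrable_mul (φ.2.memLp_partialDeriv i (p := 2) volume)
    let l : testSpace C →ₗ[ℝ] ℝ :=
      { toFun := fun φ => -∫ x, u x * partialDeriv i φ.1 x
        map_add' := fun a b => by
          have : ∀ x, u x * partialDeriv i (a + b).1 x =
              u x * partialDeriv i a.1 x + u x * partialDeriv i b.1 x := fun x => by
            rw [Submodule.coe_add, partialDeriv_add i (hd _ a.2) (hd _ b.2), mul_add]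
          simp only [this]
          rw [integral_add (hint a) (hint b), neg_add]
        map_smul' := fun c a => by
          have : ∀ x, u x * partialDeriv i (c • a).1 x = c * (u x * partialDeriv i a.1 x) :=
            fun x => by
              rw [Submodule.coe_smul, partialDeriv_const_smul i c (hd _ a.2)]; ring
          simp only [this]
          rw [integral_const_mul]
          simp }
    -- The i-th weak derivative is the Riesz representative of φ ↦ -∫ u ∂_i φ.
    obtain ⟨g, hg1, hg2⟩ := exists_inner_eq_of_bound l e hA (fun φ => by
      change |-∫ x, u x * partialDeriv i φ.1 x| ≤ A * ‖(φ.2.memLp volume).toLp‖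
      rw [abs_neg, Lp.norm_toLp]
      exact h φ.1 φ.2 i)
    refine ⟨g, Lp.memLp g, ?_, fun φ hφ => ?_⟩
    · rw [← Lp.norm_def]; exact hg1
    · have := hg2 ⟨φ, hφ⟩
      change inner ℝ g (hφ.memLp volume).toLp = -∫ x, u x * partialDeriv i φ x at this
      rw [← this, L2.inner_def]
      refine integral_congr_ae ?_
      filter_upwards [(hφ.memLp (p := 2) volume).coeFn_toLp] with x hx
      rw [hx]
      simp [mul_comm]
  choose g hg1 hg2 hg3 using key
  obtain ⟨F, hF0, hFs⟩ := exists_field hu hg1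
  refine ⟨F, mem_sobolev_of_ae (fun φ hφ i => ?_) hF0 hFs, hF0, ?_⟩
  · rw [hg3 i φ hφ, neg_neg]
  · refine (norm_field_le F).trans ?_
    rw [Fin.sum_univ_succ, eLpNorm_congr_ae (show (fun x => F x 0) =ᵐ[volume] u from hF0)]
    gcongr
    calc _ ≤ ∑ i : Fin N, A := Finset.sum_le_sum fun i _ => by
          rw [eLpNorm_congr_ae (show (fun x => F x i.succ) =ᵐ[volume] g i from hFs i)]
          exact hg2 i
      _ = N * A := by simp

end SobolevFunctional

/-! ### Mollification and smooth approximation -/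

section Mollification

open scoped NNReal ENNReal Convolution

variable {N : ℕ}

/-- Smooth cutoff functions. -/
theorem exists_smooth_cutoff {Q U : Set (Rn N)} (hQ : IsCompact Q) (hU : IsOpen U) (hQU : Q ⊆ U) :
    ∃ χ : Rn N → ℝ, ContDiff ℝ (⊤ : ℕ∞) χ ∧ HasCompactSupport χ ∧ tsupport χ ⊆ U ∧
      (∀ x, 0 ≤ χ x ∧ χ x ≤ 1) ∧ ∀ x ∈ Q, ∀ᶠ y in 𝓝 x, χ y = 1 := by
  obtain ⟨K, hK, hQK, hKU⟩ := exists_compact_between hQ hU hQU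
  obtain ⟨f, h0, h1, h01⟩ := exists_contMDiffMap_zero_one_nhds_of_isClosed (n := (⊤ : ℕ∞))
    (modelWithCornersSelf ℝ (Rn N)) (s := (interior K)ᶜ) (t := Q) isOpen_interior.isClosed_compl
    hQ.isClosed (Set.disjoint_left.2 fun x hx hxQ => hx (hQK hxQ))
  have hs : tsupport f ⊆ interior K := by
    intro x hx
    by_contra hxK
    have := (eventually_nhdsSet_iff_forall.1 h0) x hxK
    exact notMem_tsupport_iff_eventuallyEq.2 this hx
  exact ⟨f, f.contMDiff.contDiff, hK.of_isClosed_subset (isClosed_tsupport _)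
    (hs.trans interior_subset), (hs.trans interior_subset).trans hKU, h01,
    fun x hx => eventually_nhdsSet_iff_forall.1 h1 x hx⟩

/-- Convolution with a normalized bump function. -/
noncomputable def mollify (φ : ContDiffBump (0 : Rn N)) (u : Rn N → ℝ) : Rn N → ℝ :=
  φ.normed volume ⋆[ContinuousLinearMap.lsmul ℝ ℝ, volume] u

theorem mollify_apply (φ : ContDiffBump (0 : Rn N)) (u : Rn N → ℝ) (x : Rn N) :
    mollify φ u x = ∫ t, φ.normed volume t * u (x - t) := rfl

theorem mollify_contDiff (φ : ContDiffBump (0 : Rn N)) {u : Rn N → ℝ}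
    (hu : LocallyIntegrable u) : ContDiff ℝ (⊤ : ℕ∞) (mollify φ u) :=
  φ.hasCompactSupport_normed.contDiff_convolution_left _ φ.contDiff_normed hu

theorem mollify_hasCompactSupport (φ : ContDiffBump (0 : Rn N)) {u : Rn N → ℝ}
    (hu : HasCompactSupport u) : HasCompactSupport (mollify φ u) :=
  φ.hasCompactSupport_normed.convolution _ hu

theorem mollify_integrable (φ : ContDiffBump (0 : Rn N)) {u : Rn N → ℝ}
    (hu : LocallyIntegrable u) (x : Rn N) :
    Integrable (fun t => φ.normed volume t * u (x - t)) :=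
  φ.hasCompactSupport_normed.convolutionExists_left (ContinuousLinearMap.lsmul ℝ ℝ)
    φ.continuous_normed hu x

theorem mollify_sub (φ : ContDiffBump (0 : Rn N)) {u v : Rn N → ℝ}
    (hu : LocallyIntegrable u) (hv : LocallyIntegrable v) :
    mollify φ (u - v) = mollify φ u - mollify φ v := by
  funext x
  rw [Pi.sub_apply, mollify_apply, mollify_apply, mollify_apply,
    ← integral_sub (mollify_integrable φ hu x) (mollify_integrable φ hv x)]
  exact integral_congr_ae (ae_of_all _ fun t => by simp [mul_sub])

theorem eLpNorm_two_sq {α : Type*} [MeasurableSpace α] (μ : Measure α) (f : α → ℝ) :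
    eLpNorm f 2 μ ^ 2 = ∫⁻ x, ‖f x‖ₑ ^ 2 ∂μ := by
  rw [eLpNorm_eq_lintegral_rpow_enorm_toReal (by norm_num) (by norm_num), ← ENNReal.rpow_natCast,
    ← ENNReal.rpow_mul]
  simp

/-- Jensen's inequality for the probability measure whose density is the kernel, followed by Tonelli
and translation invariance. -/
theorem eLpNorm_mollify_le (φ : ContDiffBump (0 : Rn N)) {u : Rn N → ℝ}
    (hu : MemLp u 2 volume) : eLpNorm (mollify φ u) 2 volume ≤ eLpNorm u 2 volume := by
  set w : Rn N → ℝ≥0∞ := fun t => ENNReal.ofReal (φ.normed volume t) with hw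
  have hwm : Measurable w := φ.continuous_normed.measurable.ennreal_ofReal
  set ν : Measure (Rn N) := volume.withDensity w with hν
  have hν1 : IsProbabilityMeasure ν := by
    constructor
    rw [hν, withDensity_apply _ MeasurableSet.univ, Measure.restrict_univ, hw,
      ← ofReal_integral_eq_lintegral_ofReal φ.integrable_normed
        (ae_of_all _ fun x => φ.nonneg_normed x), φ.integral_normed, ENNReal.ofReal_one]
  have hνac : ν ≪ volume := withDensity_absolutelyContinuous _ _
  -- it suffices to treat a measurable representative
  have hqm : ∀ x : Rn N, Measure.QuasiMeasurePreserving (fun t => x - t) volume volume := fun x =>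
    (Measure.measurePreserving_sub_left volume x).quasiMeasurePreserving
  have hptw : ∀ x, ‖mollify φ u x‖ₑ ^ 2 ≤ ∫⁻ t, ‖u (x - t)‖ₑ ^ 2 ∂ν := by
    intro x
    have hm : AEStronglyMeasurable (fun t => u (x - t)) ν :=
      (hu.1.comp_quasiMeasurePreserving (hqm x)).mono_ac hνac
    have h1 : ‖mollify φ u x‖ₑ ≤ eLpNorm (fun t => u (x - t)) 1 ν := by
      rw [eLpNorm_one_eq_lintegral_enorm, hν,
        lintegral_withDensity_eq_lintegral_mul_non_measurable _ hwm
          (ae_of_all _ fun t => ENNReal.ofReal_lt_top)]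
      rw [mollify_apply]
      refine (enorm_integral_le_lintegral_enorm _).trans (le_of_eq (lintegral_congr fun t => ?_))
      rw [enorm_mul, Pi.mul_apply, hw, Real.enorm_of_nonneg (φ.nonneg_normed t)]
    have h2 := h1.trans (eLpNorm_le_eLpNorm_of_exponent_le (q := 2) (by norm_num) hm)
    calc ‖mollify φ u x‖ₑ ^ 2 ≤ eLpNorm (fun t => u (x - t)) 2 ν ^ 2 := by gcongr
      _ = _ := eLpNorm_two_sq _ _
  rw [← ENNReal.pow_le_pow_left_iff (n := 2) (by norm_num), eLpNorm_two_sq, eLpNorm_two_sq]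
  have hjm : AEMeasurable (Function.uncurry fun (x t : Rn N) => ‖u (x - t)‖ₑ ^ 2)
      (volume.prod ν) := by
    have : Measure.QuasiMeasurePreserving (fun p : Rn N × Rn N => p.1 - p.2) (volume.prod ν)
        volume := by
      refine ⟨by fun_prop, ?_⟩
      refine ((Measure.AbsolutelyContinuous.rfl.prod hνac).map (by fun_prop)).trans ?_
      exact (quasiMeasurePreserving_sub (μ := (volume : Measure (Rn N)))
        (ν := (volume : Measure (Rn N)))).absolutelyContinuous
    exact ((hu.1.comp_quasiMeasurePreserving this).enorm).pow_const 2
  calc ∫⁻ x, ‖mollify φ u x‖ₑ ^ 2 ≤ ∫⁻ x, (∫⁻ t, ‖u (x - t)‖ₑ ^ 2 ∂ν) := lintegral_mono hptw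
    _ = ∫⁻ t, (∫⁻ x, ‖u (x - t)‖ₑ ^ 2) ∂ν := lintegral_lintegral_swap hjm
    _ = ∫⁻ _, (∫⁻ x, ‖u x‖ₑ ^ 2) ∂ν := by
        refine lintegral_congr fun t => ?_
        exact lintegral_sub_right_eq_self (fun x => ‖u x‖ₑ ^ 2) t
    _ = ∫⁻ x, ‖u x‖ₑ ^ 2 := by simp

/-- By the uniform L² bound it suffices to treat continuous f with compact support; for those the
convergence is uniform and takes place in a fixed compact set. -/
theorem mollify_tendsto {φ : ℕ → ContDiffBump (0 : Rn N)}
    (hφ : Tendsto (fun k => (φ k).rOut) atTop (𝓝 0)) {u : Rn N → ℝ} (hu : MemLp u 2 volume) :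
    Tendsto (fun k => eLpNorm (mollify (φ k) u - u) 2 volume) atTop (𝓝 0) := by
  rw [ENNReal.tendsto_nhds_zero]
  intro ε hε
  rcases eq_or_ne ε ∞ with rfl | hεt
  · simp
  obtain ⟨f, hfc, hfu, hfcont, hfm⟩ := hu.exists_hasCompactSupport_eLpNorm_sub_le (by norm_num)
    (ε := ε / 3) (by simpa using hε.ne')
  have hlu := hu.locallyIntegrable (by norm_num)
  have hlf := hfm.locallyIntegrable (by norm_num)
  set Q := Metric.cthickening 1 (tsupport f) with hQ
  have hQc : IsCompact Q := hfc.isCompact.cthickening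
  have huc := hfc.uniformContinuous_of_continuous hfcont
  obtain ⟨δ, hδ, hδQ⟩ : ∃ δ : ℝ, 0 < δ ∧
      ENNReal.ofReal δ * (volume Q) ^ (1 / (2 : ℝ)) ≤ ε / 3 := by
    have hV : (volume Q) ^ (1 / (2 : ℝ)) ≠ ∞ :=
      ENNReal.rpow_ne_top_of_nonneg (by norm_num) hQc.measure_lt_top.ne
    have ht : Tendsto (fun δ : ℝ => ENNReal.ofReal δ * (volume Q) ^ (1 / (2 : ℝ))) (𝓝[>] 0)
        (𝓝 0) := by
      have := ENNReal.Tendsto.mul_const (b := (volume Q) ^ (1 / (2 : ℝ)))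
        (ENNReal.tendsto_ofReal (tendsto_id (α := ℝ) (x := 𝓝 0))) (Or.inr hV)
      simp only [id, ENNReal.ofReal_zero, zero_mul] at this
      exact this.mono_left nhdsWithin_le_nhds
    have h3 : (0 : ℝ≥0∞) < ε / 3 := ENNReal.div_pos hε.ne' (by norm_num)
    obtain ⟨δ, h1, h2⟩ := ((ht.eventually (gt_mem_nhds h3)).and self_mem_nhdsWithin).exists
    exact ⟨δ, h2, h1.le⟩
  obtain ⟨r, hr, hrδ⟩ := Metric.uniformContinuous_iff.1 huc δ hδ
  filter_upwards [hφ.eventually (gt_mem_nhds hr), hφ.eventually (gt_mem_nhds one_pos)] with k hk hk1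
  have e : mollify (φ k) u - u = mollify (φ k) (u - f) + (mollify (φ k) f - f) + (f - u) := by
    rw [mollify_sub _ hlu hlf]; abel
  have hmu : AEStronglyMeasurable (mollify (φ k) (u - f)) volume :=
    (mollify_contDiff _ (hlu.sub hlf)).continuous.aestronglyMeasurable
  have hmf : AEStronglyMeasurable (mollify (φ k) f) volume :=
    (mollify_contDiff _ hlf).continuous.aestronglyMeasurable
  have hmid : eLpNorm (mollify (φ k) f - f) 2 volume ≤ ε / 3 := by
    have hpt : ∀ x, ‖(mollify (φ k) f - f) x‖ ≤ ‖Q.indicator (fun _ => δ) x‖ := by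
      intro x
      by_cases hx : x ∈ Q
      · rw [Set.indicator_of_mem hx, Real.norm_of_nonneg hδ.le, Pi.sub_apply, ← dist_eq_norm]
        refine (φ k).dist_normed_convolution_le hfcont.aestronglyMeasurable fun y hy => ?_
        exact (hrδ (lt_trans (Metric.mem_ball.1 hy) hk)).le
      · have hball : ∀ y ∈ Metric.ball x (φ k).rOut, f y = f x := by
          have hz : ∀ y ∈ Metric.ball x (φ k).rOut, f y = 0 := by
            intro y hy
            by_contra h
            refine hx (Metric.mem_cthickening_of_dist_le x y _ _ (subset_tsupport f h) ?_)
            rw [dist_comm]; exact (lt_trans (Metric.mem_ball.1 hy) hk1).le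
          intro y hy
          rw [hz y hy, hz x (Metric.mem_ball_self (φ k).rOut_pos)]
        rw [Set.indicator_of_notMem hx, Pi.sub_apply, mollify,
          (φ k).normed_convolution_eq_right hball, sub_self]
    refine (eLpNorm_mono hpt).trans ?_
    rw [eLpNorm_indicator_const hQc.measurableSet (by norm_num) (by norm_num)]
    rw [Real.enorm_of_nonneg hδ.le]
    simpa using hδQ
  have h1 := (eLpNorm_mollify_le (φ k) (hu.sub hfm)).trans hfu
  have h3 : eLpNorm (f - u) 2 volume ≤ ε / 3 := by rw [eLpNorm_sub_comm]; exact hfu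
  rw [e]
  calc _ ≤ eLpNorm (mollify (φ k) (u - f)) 2 volume + eLpNorm (mollify (φ k) f - f) 2 volume +
        eLpNorm (f - u) 2 volume :=
        (eLpNorm_add_le (hmu.add (hmf.sub hfm.1)) (hfm.1.sub hu.1) (by norm_num)).trans
          (add_le_add (eLpNorm_add_le hmu (hmf.sub hfm.1) (by norm_num)) le_rfl)
    _ ≤ ε / 3 + ε / 3 + ε / 3 := by gcongr
    _ = ε := ENNReal.add_thirds ε

/-- The derivative falls on the kernel, and y ↦ ψ(x - y) is itself an admissible test function
because the singular set is empty. -/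
theorem partialDeriv_mollify (φ : ContDiffBump (0 : Rn N)) {u : Rn N → ℝ} {g : Fin N → Rn N → ℝ}
    (hu : LocallyIntegrable u) (h : IsWeakGrad ∅ u g) (i : Fin N) :
    partialDeriv i (mollify φ u) = mollify φ (g i) := by
  funext x
  set ψ := φ.normed volume with hψ
  have hψ1 : ContDiff ℝ (⊤ : ℕ∞) ψ := φ.contDiff_normed
  have hψc : HasCompactSupport ψ := φ.hasCompactSupport_normed
  have h1 := hψc.hasFDerivAt_convolution_left (ContinuousLinearMap.lsmul ℝ ℝ)
    (hψ1.of_le (by exact_mod_cast le_top)) hu x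
  have hex := (hψc.fderiv (𝕜 := ℝ)).convolutionExists_left
    ((ContinuousLinearMap.lsmul ℝ ℝ : ℝ →L[ℝ] ℝ →L[ℝ] ℝ).precompL (Rn N))
    (hψ1.continuous_fderiv (by simp)) hu x
  have h2 : partialDeriv i (mollify φ u) x = ∫ t, partialDeriv i ψ t * u (x - t) := by
    rw [partialDeriv, mollify, h1.fderiv, convolution_def, ContinuousLinearMap.integral_apply hex]
    rfl
  have htest : IsTest ∅ (fun y => ψ (x - y)) := by
    refine ⟨hψ1.comp (contDiff_const.sub contDiff_id), ?_, Set.disjoint_empty _⟩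
    exact hψc.comp_homeomorph (Homeomorph.subLeft x)
  have hpd : ∀ y, partialDeriv i (fun y => ψ (x - y)) y = -partialDeriv i ψ (x - y) := by
    intro y
    have hd : HasFDerivAt ψ (fderiv ℝ ψ (x - y)) (x - y) :=
      (hψ1.differentiable (by simp) _).hasFDerivAt
    have := hd.comp y ((hasFDerivAt_const x y).sub (hasFDerivAt_id y))
    have e := this.fderiv
    simp only [partialDeriv]
    change fderiv ℝ (fun y => ψ (x - y)) y _ = _
    rw [show (fun y => ψ (x - y)) = ψ ∘ HSub.hSub x from rfl, e]
    simp
  have key := h _ htest i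
  simp only [hpd] at key
  rw [h2, mollify_apply, ← integral_sub_left_eq_self (fun t => partialDeriv i ψ t * u (x - t)) volume x,
    ← integral_sub_left_eq_self (fun t => ψ t * g i (x - t)) volume x]
  simp only [sub_sub_cancel]
  simp only [mul_neg, integral_neg, neg_inj] at key
  simp only [mul_comm (partialDeriv i ψ _), mul_comm (ψ _)]
  exact key

/-- Sobolev fields are approximated by smooth functions on the compact sets that do not meet `C`. -/
theorem exists_smooth_approx {C Q : Set (Rn N)} (hC : IsClosed C) (hQ : IsCompact Q)
    (hQC : Disjoint Q C) {F : L2Field N} (hF : F ∈ sobolev C) :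
    ∃ v : ℕ → Rn N → ℝ, (∀ k, ContDiff ℝ (⊤ : ℕ∞) (v k)) ∧ (∀ k, HasCompactSupport (v k)) ∧
      Tendsto (fun k => eLpNorm (fun x => v k x - F x 0) 2 (volume.restrict Q)) atTop (𝓝 0) ∧
      ∀ i : Fin N, Tendsto (fun k => eLpNorm (fun x => partialDeriv i (v k) x - F x i.succ) 2
        (volume.restrict Q)) atTop (𝓝 0) := by
  obtain ⟨χ, hχ, hχc, hχs, hχ01, hχ1⟩ := exists_smooth_cutoff hQ hC.isOpen_compl
    (Set.disjoint_left.1 hQC)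
  obtain ⟨M, hM⟩ : ∃ M, ∀ x, |χ x| ≤ M ∧ ∀ i, |partialDeriv i χ x| ≤ M := by
    have hb : ∀ i, ∃ M, ∀ x, |partialDeriv i χ x| ≤ M := fun i =>
      (partialDeriv_hasCompactSupport i hχc).exists_bound_of_continuous (partialDeriv_continuous i hχ)
    choose M hM using hb
    refine ⟨1 + ∑ i, |M i|, fun x => ⟨?_, fun i => ?_⟩⟩
    · rw [abs_of_nonneg (hχ01 x).1]
      have : 0 ≤ ∑ i, |M i| := Finset.sum_nonneg fun _ _ => abs_nonneg _
      linarith [(hχ01 x).2]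
    · have := Finset.single_le_sum (f := fun i => |M i|) (fun _ _ => abs_nonneg _)
        (Finset.mem_univ i)
      linarith [hM i x, le_abs_self (M i)]
  -- The cutoff removes the singular set, so the product can be mollified on the whole space; as χ =
  -- 1 near Q, nothing changes on Q.
  obtain ⟨G, hG, hG0, hGs⟩ := exists_mul_mem_sobolev (C' := ∅) hχ.continuous.measurable
    (fun x _ => hχ.contDiffAt) (fun x hx => (hχs hx.1 hx.2).elim) (ae_of_all _ hM) hF
  set u : Rn N → ℝ := fun x => χ x * F x 0 with hu
  set g : Fin N → Rn N → ℝ := fun i x => χ x * F x i.succ + partialDeriv i χ x * F x 0 with hg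
  have hum : MemLp u 2 volume := (memLp_coord G 0).ae_eq hG0
  have hgm : ∀ i, MemLp (g i) 2 volume := fun i => (memLp_coord G i.succ).ae_eq (hGs i)
  have hul := hum.locallyIntegrable (by norm_num)
  have hw : IsWeakGrad ∅ u g := by
    intro φ hφ i
    have := mem_sobolev.1 hG φ hφ i
    rw [integral_congr_ae (g := fun x => u x * partialDeriv i φ x)
      (hG0.mono fun x hx => by simp only [hx, hu]),
      integral_congr_ae (f := fun x => G x i.succ * φ x) (g := fun x => g i x * φ x)
        ((hGs i).mono fun x hx => by simp only [hx, hg])] at this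
    exact this
  let φ : ℕ → ContDiffBump (0 : Rn N) := fun k => ⟨1 / (k + 2), 1 / (k + 1), by positivity, by
    apply one_div_lt_one_div_of_lt <;> linarith [show (0 : ℝ) ≤ k by positivity]⟩
  have hφ : Tendsto (fun k => (φ k).rOut) atTop (𝓝 0) :=
    tendsto_one_div_add_atTop_nhds_zero_nat
  have hQ1 : ∀ x ∈ Q, χ x = 1 ∧ ∀ i, partialDeriv i χ x = 0 := by
    intro x hx
    refine ⟨(hχ1 x hx).self_of_nhds, fun i => ?_⟩
    have : χ =ᶠ[𝓝 x] fun _ => 1 := hχ1 x hx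
    rw [partialDeriv, this.fderiv_eq]; simp
  refine ⟨fun k => mollify (φ k) u, fun k => mollify_contDiff _ hul,
    fun k => mollify_hasCompactSupport _ hχc.mul_right, ?_, fun i => ?_⟩
  · refine tendsto_of_tendsto_of_tendsto_of_le_of_le tendsto_const_nhds (mollify_tendsto hφ hum)
      (fun _ => zero_le) fun k => ?_
    refine le_trans (le_of_eq (eLpNorm_congr_ae ?_)) (eLpNorm_mono_measure _ Measure.restrict_le_self)
    filter_upwards [ae_restrict_mem hQ.measurableSet] with x hx
    simp [hu, (hQ1 x hx).1]
  · refine tendsto_of_tendsto_of_tendsto_of_le_of_le tendsto_const_nhds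
      (mollify_tendsto hφ (hgm i)) (fun _ => zero_le) fun k => ?_
    refine le_trans (le_of_eq (eLpNorm_congr_ae ?_)) (eLpNorm_mono_measure _ Measure.restrict_le_self)
    filter_upwards [ae_restrict_mem hQ.measurableSet] with x hx
    rw [partialDeriv_mollify (φ k) hul hw i]
    simp [hg, (hQ1 x hx).1, (hQ1 x hx).2 i]

end Mollification

/-! ### Composition of Sobolev functions with Lipschitz maps -/

section Composition

open scoped NNReal ENNReal

variable {N : ℕ}

theorem abs_integral_mul_le {α : Type*} [MeasurableSpace α] {μ : Measure α} {f g : α → ℝ}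
    (hf : MemLp f 2 μ) (hg : MemLp g 2 μ) :
    |∫ x, f x * g x ∂μ| ≤ (eLpNorm f 2 μ).toReal * (eLpNorm g 2 μ).toReal := by
  have h := abs_real_inner_le_norm hg.toLp hf.toLp
  rw [L2.inner_def, Lp.norm_toLp, Lp.norm_toLp, mul_comm] at h
  refine le_trans (le_of_eq ?_) h
  congr 1
  refine integral_congr_ae ?_
  filter_upwards [hf.coeFn_toLp, hg.coeFn_toLp] with x h1 h2
  simp [h1, h2]

theorem integral_abs_mul_le {α : Type*} [MeasurableSpace α] {μ : Measure α} {f g : α → ℝ}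
    (hf : MemLp f 2 μ) (hg : MemLp g 2 μ) :
    ∫ x, |f x| * |g x| ∂μ ≤ (eLpNorm f 2 μ).toReal * (eLpNorm g 2 μ).toReal := by
  have := (le_abs_self _).trans (abs_integral_mul_le hf.norm hg.norm)
  rwa [eLpNorm_norm, eLpNorm_norm] at this

theorem norm_fderiv_le_sum (v : Rn N → ℝ) (x : Rn N) :
    ‖fderiv ℝ v x‖ ≤ ∑ j, |partialDeriv j v x| := by
  refine ContinuousLinearMap.opNorm_le_bound _ (Finset.sum_nonneg fun _ _ => abs_nonneg _)
    fun w => ?_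
  have e : w = ∑ j, w j • EuclideanSpace.single j (1 : ℝ) := by
    ext k
    simp [Finset.sum_apply, Pi.single_apply]
  conv_lhs => rw [e]
  rw [map_sum, Finset.sum_mul]
  refine (norm_sum_le _ _).trans (Finset.sum_le_sum fun j _ => ?_)
  rw [map_smul, norm_smul, mul_comm]
  exact mul_le_mul_of_nonneg_left (PiLp.norm_apply_le w j) (abs_nonneg _)

theorem map_restrict_le_smul {Ψ : Rn N → Rn N} {Q' Q : Set (Rn N)} {a : ℝ≥0∞}
    (hΨ : AEMeasurable Ψ (volume.restrict Q')) (hQ : MeasurableSet Q) (hmap : Set.MapsTo Ψ Q' Q)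
    (hvol : ∀ s, MeasurableSet s → volume (Q' ∩ Ψ ⁻¹' s) ≤ a * volume s) :
    (volume.restrict Q').map Ψ ≤ a • volume.restrict Q := by
  refine Measure.le_iff.2 fun s hs => ?_
  rw [Measure.map_apply_of_aemeasurable hΨ hs, Measure.smul_apply, smul_eq_mul,
    Measure.restrict_apply₀ (hΨ.nullMeasurable hs), Measure.restrict_apply hs]
  refine (measure_mono ?_).trans (hvol _ (hs.inter hQ))
  rintro x ⟨h1, h2⟩
  exact ⟨h2, h1, hmap h2⟩

/-- The push-forward of the volume is dominated by a multiple of the volume. This gives the norm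
bound and also makes the composition meaningful for f defined only almost everywhere. -/
theorem eLpNorm_comp_le {Ψ : Rn N → Rn N} {Q' Q : Set (Rn N)} {a : ℝ≥0∞}
    (hΨ : AEMeasurable Ψ (volume.restrict Q')) (hQ : MeasurableSet Q) (hmap : Set.MapsTo Ψ Q' Q)
    (hvol : ∀ s, MeasurableSet s → volume (Q' ∩ Ψ ⁻¹' s) ≤ a * volume s) {f : Rn N → ℝ}
    (hf : AEStronglyMeasurable f (volume.restrict Q)) :
    AEStronglyMeasurable (f ∘ Ψ) (volume.restrict Q') ∧
    eLpNorm (f ∘ Ψ) 2 (volume.restrict Q') ≤ a ^ (1 / (2 : ℝ)) * eLpNorm f 2 (volume.restrict Q) := by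
  have hle := map_restrict_le_smul hΨ hQ hmap hvol
  have hac : (volume.restrict Q').map Ψ ≪ volume.restrict Q :=
    hle.absolutelyContinuous.trans (Measure.smul_absolutelyContinuous)
  have hf' := hf.mono_ac hac
  refine ⟨hf'.comp_aemeasurable hΨ, ?_⟩
  rw [← eLpNorm_map_measure hf' hΨ]
  refine (eLpNorm_mono_measure _ hle).trans (le_of_eq ?_)
  rw [eLpNorm_smul_measure_of_ne_top (by norm_num)]
  simp

/-- A Lipschitz chain rule, as an inequality. -/
theorem norm_lineDeriv_le_of_comp {V : Set (Rn N)} (hV : IsOpen V) {Ψ : Rn N → Rn N} {l : ℝ≥0}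
    (hΨ : LipschitzOnWith l Ψ V) {T : ℝ → ℝ} (hT : LipschitzWith 1 T) {v : Rn N → ℝ}
    (hv : ContDiff ℝ (⊤ : ℕ∞) v) {h : Rn N → ℝ} (hh : Set.EqOn h (fun x => T (v (Ψ x))) V)
    {x : Rn N} (hx : x ∈ V) (i : Fin N) :
    |lineDeriv ℝ h x (EuclideanSpace.single i 1)| ≤ l * ‖fderiv ℝ v (Ψ x)‖ := by
  have hstrict : HasStrictFDerivAt v (fderiv ℝ v (Ψ x)) (Ψ x) :=
    hv.contDiffAt.hasStrictFDerivAt (by simp)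
  -- A C¹ function is K-Lipschitz near Ψ(x) for each K above its gradient norm, and a local
  -- Lipschitz bound controls the line derivative. Differentiability of Ψ or T is not needed: where
  -- the line derivative fails to exist its default value is 0.
  have key : ∀ K : ℝ≥0, ‖fderiv ℝ v (Ψ x)‖₊ < K →
      |lineDeriv ℝ h x (EuclideanSpace.single i 1)| ≤ l * K := by
    intro K hK
    obtain ⟨s, hs, hvs⟩ := hstrict.exists_lipschitzOnWith_of_nnnorm_lt K hK
    have hc : ContinuousAt Ψ x := hΨ.continuousOn.continuousAt (hV.mem_nhds hx)
    have hev : ∀ᶠ y in 𝓝 x, y ∈ V ∧ Ψ y ∈ s := (hV.mem_nhds hx |> fun h => h) |> fun h =>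
      (Filter.Eventually.and h (hc.eventually hs))
    have hline : Tendsto (fun t : ℝ => x + t • (EuclideanSpace.single i 1 : Rn N)) (𝓝 0) (𝓝 x) := by
      have : Continuous (fun t : ℝ => x + t • (EuclideanSpace.single i 1 : Rn N)) := by fun_prop
      simpa using this.tendsto 0
    rw [← Real.norm_eq_abs]
    refine norm_deriv_le_of_lip' (C := (l : ℝ) * K) (by positivity) ?_
    filter_upwards [hline.eventually hev] with t ht
    simp only [zero_smul, add_zero, sub_zero]
    rw [hh ht.1, hh hx, ← dist_eq_norm]
    calc dist (T (v (Ψ (x + t • (EuclideanSpace.single i 1 : Rn N))))) (T (v (Ψ x)))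
        ≤ dist (v (Ψ (x + t • (EuclideanSpace.single i 1 : Rn N)))) (v (Ψ x)) := by
          simpa using hT.dist_le_mul _ _
      _ ≤ K * dist (Ψ (x + t • (EuclideanSpace.single i 1 : Rn N))) (Ψ x) :=
          hvs.dist_le_mul _ ht.2 _ (mem_of_mem_nhds hs)
      _ ≤ K * (l * dist (x + t • (EuclideanSpace.single i 1 : Rn N)) x) := by
          gcongr; exact hΨ.dist_le_mul _ ht.1 _ hx
      _ = l * K * ‖t‖ := by
          rw [dist_eq_norm, add_sub_cancel_left, norm_smul]; simp; ring
  have hlim : Tendsto (fun K : ℝ≥0 => (l : ℝ) * K) (𝓝[>] ‖fderiv ℝ v (Ψ x)‖₊)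
      (𝓝 (l * ‖fderiv ℝ v (Ψ x)‖)) := by
    have : Continuous (fun K : ℝ≥0 => (l : ℝ) * K) := by fun_prop
    exact (this.tendsto _).mono_left nhdsWithin_le_nhds
  refine ge_of_tendsto hlim ?_
  filter_upwards [self_mem_nhdsWithin] with K hK using key K hK

theorem lineDeriv_neg_single {φ : Rn N → ℝ} (hφ : Differentiable ℝ φ) (x : Rn N) (i : Fin N) :
    lineDeriv ℝ φ x (-(EuclideanSpace.single i 1)) = -partialDeriv i φ x := by
  rw [(hφ x).lineDeriv_eq_fderiv, map_neg]; rfl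

/-- The composition estimate for a smooth function. -/
theorem abs_integral_comp_smooth_le {V : Set (Rn N)} (hV : IsOpen V) {Ψ : Rn N → Rn N} {l : ℝ≥0}
    (hΨ : LipschitzOnWith l Ψ V) {a : ℝ≥0∞} (ha : a ≠ ∞)
    (hvol : ∀ s, MeasurableSet s → volume (V ∩ Ψ ⁻¹' s) ≤ a * volume s)
    {T : ℝ → ℝ} (hT : LipschitzWith 1 T) {v : Rn N → ℝ} (hv : ContDiff ℝ (⊤ : ℕ∞) v)
    (hvc : HasCompactSupport v) {φ : Rn N → ℝ} (hφ : IsTest Vᶜ φ) (i : Fin N) :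
    |∫ x in tsupport φ, T (v (Ψ x)) * partialDeriv i φ x| ≤
      l * (∑ j, (a ^ (1 / (2 : ℝ))).toReal *
        (eLpNorm (partialDeriv j v) 2 (volume.restrict (Ψ '' tsupport φ))).toReal) *
          (eLpNorm φ 2 volume).toReal := by
  set Q' := tsupport φ with hQ'
  have hQ'V : Q' ⊆ V := fun x hx => by
    by_contra h; exact Set.disjoint_left.1 hφ.2.2 hx h
  have hQ'c : IsCompact Q' := hφ.2.1
  set Q := Ψ '' Q' with hQ
  have hQc : IsCompact Q := hQ'c.image_of_continuousOn (hΨ.continuousOn.mono hQ'V)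
  have hΨm : AEMeasurable Ψ (volume.restrict Q') :=
    (hΨ.continuousOn.mono hQ'V).aemeasurable hQ'c.measurableSet
  have hvol' : ∀ s, MeasurableSet s → volume (Q' ∩ Ψ ⁻¹' s) ≤ a * volume s := fun s hs =>
    (measure_mono (Set.inter_subset_inter_left _ hQ'V)).trans (hvol s hs)
  obtain ⟨Kv, hKv⟩ := hv.lipschitzWith_of_hasCompactSupport hvc (by simp)
  -- Integration by parts is available for globally Lipschitz functions, so T ∘ v ∘ Ψ is extended
  -- from V.
  obtain ⟨h, hhL, hh⟩ : ∃ h : Rn N → ℝ, LipschitzWith (1 * (Kv * l)) h ∧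
      Set.EqOn (fun x => T (v (Ψ x))) h V :=
    (hT.comp_lipschitzOnWith (hKv.comp_lipschitzOnWith hΨ)).extend_real
  obtain ⟨Kφ, hKφ⟩ := hφ.1.lipschitzWith_of_hasCompactSupport hφ.2.1 (by simp)
  have hibp := LipschitzWith.integral_lineDeriv_mul_eq (μ := volume) hhL hKφ hφ.2.1
    (EuclideanSpace.single i (1 : ℝ))
  have e1 : ∫ x in Q', T (v (Ψ x)) * partialDeriv i φ x =
      -∫ x in Q', lineDeriv ℝ h x (EuclideanSpace.single i 1) * φ x := by
    rw [setIntegral_eq_integral_of_forall_compl_eq_zero (s := Q')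
        (f := fun x => lineDeriv ℝ h x (EuclideanSpace.single i 1) * φ x)
        (fun x hx => by rw [image_eq_zero_of_notMem_tsupport hx, mul_zero]), hibp,
      ← setIntegral_eq_integral_of_forall_compl_eq_zero (s := Q')
        (f := fun x => lineDeriv ℝ φ x (-(EuclideanSpace.single i 1)) * h x)
        (fun x hx => by
          rw [lineDeriv_neg_single (hφ.1.differentiable (by simp)),
            partialDeriv_eq_zero_of_notMem_tsupport i hx, neg_zero, zero_mul]), ← integral_neg]
    refine setIntegral_congr_fun hQ'c.measurableSet fun x hx => ?_
    rw [lineDeriv_neg_single (hφ.1.differentiable (by simp)), ← hh (hQ'V hx)]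
    ring
  have hcomp : ∀ j, MemLp (partialDeriv j v ∘ Ψ) 2 (volume.restrict Q') ∧
      (eLpNorm (partialDeriv j v ∘ Ψ) 2 (volume.restrict Q')).toReal ≤
        (a ^ (1 / (2 : ℝ))).toReal * (eLpNorm (partialDeriv j v) 2 (volume.restrict Q)).toReal := by
    intro j
    have hm : MemLp (partialDeriv j v) 2 (volume.restrict Q) :=
      (partialDeriv_continuous j hv).memLp_of_hasCompactSupport (partialDeriv_hasCompactSupport j hvc)
    obtain ⟨h1, h2⟩ := eLpNorm_comp_le hΨm hQc.measurableSet (Set.mapsTo_image Ψ Q') hvol' hm.1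
    have hfin : a ^ (1 / (2 : ℝ)) * eLpNorm (partialDeriv j v) 2 (volume.restrict Q) ≠ ∞ :=
      ENNReal.mul_ne_top (ENNReal.rpow_ne_top_of_nonneg (by norm_num) ha) hm.eLpNorm_ne_top
    refine ⟨⟨h1, lt_of_le_of_lt h2 hfin.lt_top⟩, ?_⟩
    rw [← ENNReal.toReal_mul]
    exact ENNReal.toReal_mono hfin h2
  have hφm : MemLp φ 2 (volume.restrict Q') := hφ.memLp _
  have hφle : (eLpNorm φ 2 (volume.restrict Q')).toReal ≤ (eLpNorm φ 2 volume).toReal :=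
    ENNReal.toReal_mono (hφ.memLp volume).eLpNorm_ne_top
      (eLpNorm_mono_measure _ Measure.restrict_le_self)
  have hi : ∀ j, Integrable (fun x => |partialDeriv j v (Ψ x)| * |φ x|) (volume.restrict Q') :=
    fun j => (hcomp j).1.norm.integrable_mul hφm.norm
  rw [e1, abs_neg]
  calc |∫ x in Q', lineDeriv ℝ h x (EuclideanSpace.single i 1) * φ x|
      ≤ ∫ x in Q', ∑ j, l * (|partialDeriv j v (Ψ x)| * |φ x|) := by
        have hI : Integrable (fun x => ∑ j, (l : ℝ) * (|partialDeriv j v (Ψ x)| * |φ x|))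
            (volume.restrict Q') :=
          integrable_finsetSum Finset.univ fun j _ => (hi j).const_mul (l : ℝ)
        rw [← Real.norm_eq_abs]
        refine norm_integral_le_of_norm_le hI ?_
        filter_upwards [ae_restrict_mem hQ'c.measurableSet] with x hx
        rw [norm_mul, ← Finset.mul_sum, ← Finset.sum_mul, ← mul_assoc]
        refine mul_le_mul_of_nonneg_right ?_ (abs_nonneg _)
        refine (norm_lineDeriv_le_of_comp hV hΨ hT hv hh.symm (hQ'V hx) i).trans ?_
        gcongr
        exact norm_fderiv_le_sum v _
    _ = ∑ j, l * ∫ x in Q', |partialDeriv j v (Ψ x)| * |φ x| := by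
        rw [integral_finsetSum _ fun j _ => (hi j).const_mul _]
        simp_rw [integral_const_mul]
    _ ≤ ∑ j, l * ((a ^ (1 / (2 : ℝ))).toReal *
        (eLpNorm (partialDeriv j v) 2 (volume.restrict Q)).toReal *
          (eLpNorm φ 2 volume).toReal) := by
        gcongr with j
        refine (integral_abs_mul_le (hcomp j).1 hφm).trans ?_
        gcongr
        exact (hcomp j).2
    _ = _ := by
        rw [Finset.mul_sum, Finset.sum_mul]
        exact Finset.sum_congr rfl fun j _ => by ring

/-- The composition of a Sobolev function with a Lipschitz map which does not compress the
volume has a bounded distributional gradient. -/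
theorem abs_integral_comp_le {C : Set (Rn N)} (hC : IsClosed C) {F : L2Field N}
    (hF : F ∈ sobolev C) {V : Set (Rn N)} (hV : IsOpen V) {Ψ : Rn N → Rn N} {l : ℝ≥0}
    (hΨ : LipschitzOnWith l Ψ V) (hΨC : ∀ x ∈ V, Ψ x ∉ C) {a : ℝ≥0∞} (ha : a ≠ ∞)
    (hvol : ∀ s, MeasurableSet s → volume (V ∩ Ψ ⁻¹' s) ≤ a * volume s)
    {T : ℝ → ℝ} (hT : LipschitzWith 1 T) {φ : Rn N → ℝ} (hφ : IsTest Vᶜ φ) (i : Fin N) :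
    |∫ x in tsupport φ, T (F (Ψ x) 0) * partialDeriv i φ x| ≤
      l * (∑ j : Fin N, (a ^ (1 / (2 : ℝ))).toReal *
        (eLpNorm (fun x => F x j.succ) 2 volume).toReal) * (eLpNorm φ 2 volume).toReal := by
  set Q' := tsupport φ with hQ'
  have hQ'V : Q' ⊆ V := fun x hx => by
    by_contra h; exact Set.disjoint_left.1 hφ.2.2 hx h
  have hQ'c : IsCompact Q' := hφ.2.1
  set Q := Ψ '' Q' with hQ
  have hQc : IsCompact Q := hQ'c.image_of_continuousOn (hΨ.continuousOn.mono hQ'V)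
  have hQC : Disjoint Q C := by
    rw [Set.disjoint_left]
    rintro _ ⟨x, hx, rfl⟩
    exact hΨC x (hQ'V hx)
  have hΨm : AEMeasurable Ψ (volume.restrict Q') :=
    (hΨ.continuousOn.mono hQ'V).aemeasurable hQ'c.measurableSet
  have hvol' : ∀ s, MeasurableSet s → volume (Q' ∩ Ψ ⁻¹' s) ≤ a * volume s := fun s hs =>
    (measure_mono (Set.inter_subset_inter_left _ hQ'V)).trans (hvol s hs)
  -- Ψ maps the support of φ onto a compact set off C, where F and its gradient are L² limits of
  -- smooth functions; both sides of the smooth estimate pass to the limit.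
  obtain ⟨v, hv, hvc, hv0, hvs⟩ := exists_smooth_approx hC hQc hQC hF
  have ha' : a ^ (1 / (2 : ℝ)) ≠ ∞ := ENNReal.rpow_ne_top_of_nonneg (by norm_num) ha
  have hFm : ∀ j, MemLp (fun x => F x j) 2 (volume.restrict Q) := fun j =>
    (memLp_coord F j).mono_measure Measure.restrict_le_self
  have hvm : ∀ k, MemLp (v k) 2 (volume.restrict Q) := fun k =>
    (hv k).continuous.memLp_of_hasCompactSupport (hvc k)
  have hdm : ∀ k j, MemLp (partialDeriv j (v k)) 2 (volume.restrict Q) := fun k j =>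
    (partialDeriv_continuous j (hv k)).memLp_of_hasCompactSupport
      (partialDeriv_hasCompactSupport j (hvc k))
  have hφd : MemLp (partialDeriv i φ) 2 (volume.restrict Q') := hφ.memLp_partialDeriv i _
  have hmemcomp : ∀ f : Rn N → ℝ, MemLp f 2 (volume.restrict Q) →
      MemLp (f ∘ Ψ) 2 (volume.restrict Q') ∧
      (eLpNorm (f ∘ Ψ) 2 (volume.restrict Q')).toReal ≤
        (a ^ (1 / (2 : ℝ))).toReal * (eLpNorm f 2 (volume.restrict Q)).toReal := by
    intro f hf
    obtain ⟨h1, h2⟩ := eLpNorm_comp_le hΨm hQc.measurableSet (Set.mapsTo_image Ψ Q') hvol' hf.1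
    have hfin : a ^ (1 / (2 : ℝ)) * eLpNorm f 2 (volume.restrict Q) ≠ ∞ :=
      ENNReal.mul_ne_top ha' hf.eLpNorm_ne_top
    refine ⟨⟨h1, lt_of_le_of_lt h2 hfin.lt_top⟩, ?_⟩
    rw [← ENNReal.toReal_mul]
    exact ENNReal.toReal_mono hfin h2
  have hTm : ∀ f : Rn N → ℝ, MemLp f 2 (volume.restrict Q') →
      MemLp (fun x => T (f x)) 2 (volume.restrict Q') := by
    intro f hf
    have h0 : MemLp (fun _ : Rn N => T 0) 2 (volume.restrict Q') := by
      have : IsFiniteMeasure (volume.restrict Q') := ⟨by simpa using hQ'c.measure_lt_top⟩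
      exact memLp_const _
    have h1 : MemLp (fun x => T (f x) - T 0) 2 (volume.restrict Q') := by
      refine hf.mono ((hT.continuous.comp_aestronglyMeasurable hf.1).sub
        aestronglyMeasurable_const) (ae_of_all _ fun x => ?_)
      simpa [dist_eq_norm] using hT.dist_le_mul (f x) 0
    convert h1.add h0 using 2
    simp
  have hlimL : Tendsto (fun k => ∫ x in Q', T (v k (Ψ x)) * partialDeriv i φ x) atTop
      (𝓝 (∫ x in Q', T (F (Ψ x) 0) * partialDeriv i φ x)) := by
    rw [tendsto_iff_dist_tendsto_zero]
    have hb : ∀ k, dist (∫ x in Q', T (v k (Ψ x)) * partialDeriv i φ x)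
        (∫ x in Q', T (F (Ψ x) 0) * partialDeriv i φ x) ≤
        (a ^ (1 / (2 : ℝ))).toReal *
          (eLpNorm (fun x => v k x - F x 0) 2 (volume.restrict Q)).toReal *
          (eLpNorm (partialDeriv i φ) 2 (volume.restrict Q')).toReal := by
      intro k
      have m1 := (hmemcomp _ (hvm k)).1
      have m2 := (hmemcomp _ (hFm 0)).1
      obtain ⟨m3, m4⟩ := hmemcomp _ ((hvm k).sub (hFm 0))
      have i1 : Integrable (fun x => T (v k (Ψ x)) * partialDeriv i φ x) (volume.restrict Q') :=
        (hTm _ m1).integrable_mul hφd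
      have i2 : Integrable (fun x => T (F (Ψ x) 0) * partialDeriv i φ x) (volume.restrict Q') :=
        (hTm _ m2).integrable_mul hφd
      rw [dist_eq_norm, ← integral_sub i1 i2]
      refine (norm_integral_le_of_norm_le (m3.norm.integrable_mul hφd.norm)
        (ae_of_all _ fun x => ?_)).trans ((integral_abs_mul_le m3 hφd).trans ?_)
      · simp only [Pi.mul_apply, Function.comp, Pi.sub_apply]
        rw [← sub_mul, norm_mul]
        refine mul_le_mul_of_nonneg_right ?_ (norm_nonneg _)
        simpa [dist_eq_norm] using hT.dist_le_mul (v k (Ψ x)) (F (Ψ x) 0)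
      · gcongr
        exact m4
    refine squeeze_zero (fun _ => dist_nonneg) hb ?_
    have h0 : Tendsto (fun k => (eLpNorm (fun x => v k x - F x 0) 2 (volume.restrict Q)).toReal)
        atTop (𝓝 0) := by
      have := (ENNReal.tendsto_toReal ENNReal.zero_ne_top).comp hv0
      rwa [ENNReal.toReal_zero] at this
    simpa using (h0.const_mul (a ^ (1 / (2 : ℝ))).toReal).mul_const
      (eLpNorm (partialDeriv i φ) 2 (volume.restrict Q')).toReal
  have hlimR : Tendsto (fun k => l * (∑ j : Fin N, (a ^ (1 / (2 : ℝ))).toReal *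
      ((eLpNorm (fun x => partialDeriv j (v k) x - F x j.succ) 2 (volume.restrict Q)).toReal +
        (eLpNorm (fun x => F x j.succ) 2 volume).toReal)) * (eLpNorm φ 2 volume).toReal) atTop
      (𝓝 (l * (∑ j : Fin N, (a ^ (1 / (2 : ℝ))).toReal *
        (0 + (eLpNorm (fun x => F x j.succ) 2 volume).toReal)) * (eLpNorm φ 2 volume).toReal)) := by
    refine Tendsto.mul_const _ (Tendsto.const_mul _ (tendsto_finsetSum _ fun j _ =>
      Tendsto.const_mul _ (Tendsto.add_const _ ?_)))
    have := (ENNReal.tendsto_toReal ENNReal.zero_ne_top).comp (hvs j)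
    rwa [ENNReal.toReal_zero] at this
  simp only [zero_add] at hlimR
  refine le_of_tendsto_of_tendsto' hlimL.abs hlimR fun k => ?_
  refine (abs_integral_comp_smooth_le hV hΨ ha hvol hT (hv k) (hvc k) hφ i).trans ?_
  gcongr with j
  have hsub : MemLp (fun x => partialDeriv j (v k) x - F x j.succ) 2 (volume.restrict Q) :=
    (hdm k j).sub (hFm j.succ)
  have hle : eLpNorm (partialDeriv j (v k)) 2 (volume.restrict Q) ≤
      eLpNorm (fun x => partialDeriv j (v k) x - F x j.succ) 2 (volume.restrict Q) +
        eLpNorm (fun x => F x j.succ) 2 volume := by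
    have e : partialDeriv j (v k) = (fun x => partialDeriv j (v k) x - F x j.succ) +
        fun x => F x j.succ := by funext x; simp
    conv_lhs => rw [e]
    exact (eLpNorm_add_le hsub.1 (hFm _).1 (by norm_num)).trans
      (add_le_add le_rfl (eLpNorm_mono_measure _ Measure.restrict_le_self))
  rw [← ENNReal.toReal_add hsub.eLpNorm_ne_top (memLp_coord F _).eLpNorm_ne_top]
  exact ENNReal.toReal_mono (ENNReal.add_ne_top.2
    ⟨hsub.eLpNorm_ne_top, (memLp_coord F _).eLpNorm_ne_top⟩) hle

end Composition

/-! ### Limits of compositions, truncation, extension by zero, one-sided restriction -/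

section Consequences

open scoped NNReal ENNReal

variable {N : ℕ}

theorem memLp_comp_of_volume_le {Ψ : Rn N → Rn N} {Q : Set (Rn N)} {a : ℝ≥0∞} (ha : a ≠ ∞)
    (hΨ : AEMeasurable Ψ (volume.restrict Q))
    (hvol : ∀ s, MeasurableSet s → volume (Q ∩ Ψ ⁻¹' s) ≤ a * volume s) {f : Rn N → ℝ}
    (hf : MemLp f 2 volume) :
    MemLp (fun x => f (Ψ x)) 2 (volume.restrict Q) ∧
    eLpNorm (fun x => f (Ψ x)) 2 (volume.restrict Q) ≤ a ^ (1 / (2 : ℝ)) * eLpNorm f 2 volume := by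
  obtain ⟨h1, h2⟩ := eLpNorm_comp_le hΨ MeasurableSet.univ (Set.mapsTo_univ _ _) hvol
    (f := f) (by rw [Measure.restrict_univ]; exact hf.1)
  rw [Measure.restrict_univ] at h2
  exact ⟨⟨h1, h2.trans_lt (ENNReal.mul_lt_top (ENNReal.rpow_ne_top_of_nonneg (by norm_num) ha).lt_top
    hf.eLpNorm_lt_top)⟩, h2⟩

/-- Composition with maps which do not compress the volume is continuous with respect to
uniform convergence. -/
theorem tendsto_eLpNorm_comp_sub {Q : Set (Rn N)} (hQ : IsCompact Q) {Ψ : ℕ → Rn N → Rn N}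
    {Ψ₀ : Rn N → Rn N} (hΨ : ∀ k, ContinuousOn (Ψ k) Q) (hΨ₀ : ContinuousOn Ψ₀ Q)
    (hlim : TendstoUniformlyOn Ψ Ψ₀ atTop Q) {a : ℝ≥0∞} (ha : a ≠ ∞)
    (hvol : ∀ k s, MeasurableSet s → volume (Q ∩ Ψ k ⁻¹' s) ≤ a * volume s)
    (hvol₀ : ∀ s, MeasurableSet s → volume (Q ∩ Ψ₀ ⁻¹' s) ≤ a * volume s) {u : Rn N → ℝ}
    (hu : MemLp u 2 volume) :
    Tendsto (fun k => eLpNorm (fun x => u (Ψ k x) - u (Ψ₀ x)) 2 (volume.restrict Q)) atTop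
      (𝓝 0) := by
  have hm : ∀ k, AEMeasurable (Ψ k) (volume.restrict Q) := fun k =>
    (hΨ k).aemeasurable hQ.measurableSet
  have hm₀ : AEMeasurable Ψ₀ (volume.restrict Q) := hΨ₀.aemeasurable hQ.measurableSet
  set b := a ^ (1 / (2 : ℝ)) with hb
  have hbt : b ≠ ∞ := ENNReal.rpow_ne_top_of_nonneg (by norm_num) ha
  set m := volume Q ^ (1 / (2 : ℝ)) with hm'
  have hmt : m ≠ ∞ := ENNReal.rpow_ne_top_of_nonneg (by norm_num) hQ.measure_lt_top.ne
  rw [ENNReal.tendsto_nhds_zero]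
  intro ε hε
  rcases eq_or_ne ε ∞ with rfl | hεt
  · simp
  have hpos : ∀ c : ℝ≥0∞, c ≠ ∞ → ∃ η : ℝ≥0∞, η ≠ 0 ∧ η ≠ ∞ ∧ c * η ≤ ε / 3 := by
    intro c hc
    refine ⟨ε / 3 / (c + 1), ?_, ?_, ?_⟩
    · exact ENNReal.div_ne_zero.2 ⟨ENNReal.div_ne_zero.2 ⟨hε.ne', by norm_num⟩, by simp [hc]⟩
    · exact ENNReal.div_ne_top (ENNReal.div_ne_top hεt (by norm_num)) (by simp)
    · calc c * (ε / 3 / (c + 1)) ≤ (c + 1) * (ε / 3 / (c + 1)) := by gcongr; simp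
        _ = ε / 3 := ENNReal.mul_div_cancel (by simp) (by simp [hc])
  obtain ⟨η, hη0, -, hη⟩ := hpos b hbt
  obtain ⟨f, hfc, hfu, hfcont, hfm⟩ := hu.exists_hasCompactSupport_eLpNorm_sub_le (by norm_num) hη0
  obtain ⟨θ, hθ0, hθt, hθ⟩ := hpos m hmt
  have hθr : 0 < θ.toReal := ENNReal.toReal_pos hθ0 hθt
  obtain ⟨δ, hδ, hfδ⟩ := Metric.uniformContinuous_iff.1
    (hfc.uniformContinuous_of_continuous hfcont) _ hθr
  filter_upwards [Metric.tendstoUniformlyOn_iff.1 hlim δ hδ] with k hk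
  have hd : MemLp (fun x => u x - f x) 2 volume := hu.sub hfm
  obtain ⟨a1, a2⟩ := memLp_comp_of_volume_le ha (hm k) (hvol k) hd
  obtain ⟨c1, c2⟩ := memLp_comp_of_volume_le ha hm₀ hvol₀ hd
  have f1 := (memLp_comp_of_volume_le ha (hm k) (hvol k) hfm).1
  have f2 := (memLp_comp_of_volume_le ha hm₀ hvol₀ hfm).1
  have hbη : ∀ {y : ℝ≥0∞}, y ≤ b * eLpNorm (fun x => u x - f x) 2 volume → y ≤ ε / 3 := fun hy =>
    hy.trans ((mul_le_mul_right hfu b).trans hη)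
  have e : (fun x => u (Ψ k x) - u (Ψ₀ x)) = (fun x => (u (Ψ k x) - f (Ψ k x))) +
      ((fun x => f (Ψ k x) - f (Ψ₀ x)) - fun x => (u (Ψ₀ x) - f (Ψ₀ x)) ) + 0 := by
    funext x; simp
  have h3 : eLpNorm (fun x => f (Ψ k x) - f (Ψ₀ x)) 2 (volume.restrict Q) ≤ ε / 3 := by
    refine (eLpNorm_le_of_ae_bound (C := θ.toReal) ?_).trans ?_
    · filter_upwards [ae_restrict_mem hQ.measurableSet] with x hx
      have := hfδ (a := Ψ k x) (b := Ψ₀ x) (by rw [dist_comm]; exact hk x hx)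
      rw [dist_eq_norm] at this
      exact this.le
    · rw [ENNReal.ofReal_toReal hθt, Measure.restrict_apply_univ]
      refine le_trans (le_of_eq ?_) hθ
      simp [hm']
  rw [e, add_zero]
  calc _ ≤ _ := eLpNorm_add_le a1.1 ((f1.sub f2).sub c1).1 (by norm_num)
    _ ≤ ε / 3 + (ε / 3 + ε / 3) := by
      refine add_le_add (hbη a2) ((eLpNorm_sub_le (f1.sub f2).1 c1.1 (by norm_num)).trans
        (add_le_add h3 (hbη c2)))
    _ = ε := by rw [← add_assoc, ENNReal.add_thirds]

theorem tendsto_integral_mul_of_eLpNorm {α : Type*} [MeasurableSpace α] {μ : Measure α}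
    {u : ℕ → α → ℝ} {u₀ g : α → ℝ} (hu : ∀ k, MemLp (u k) 2 μ) (hu₀ : MemLp u₀ 2 μ)
    (hg : MemLp g 2 μ)
    (hlim : Tendsto (fun k => eLpNorm (fun x => u k x - u₀ x) 2 μ) atTop (𝓝 0)) :
    Tendsto (fun k => ∫ x, u k x * g x ∂μ) atTop (𝓝 (∫ x, u₀ x * g x ∂μ)) := by
  rw [tendsto_iff_dist_tendsto_zero]
  have h0 := (ENNReal.tendsto_toReal ENNReal.zero_ne_top).comp hlim
  rw [ENNReal.toReal_zero] at h0
  have h1 := h0.mul_const (eLpNorm g 2 μ).toReal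
  rw [zero_mul] at h1
  refine squeeze_zero (fun _ => dist_nonneg) (fun k => ?_) h1
  have i1 : Integrable (fun x => u k x * g x) μ := (hu k).integrable_mul hg
  have i2 : Integrable (fun x => u₀ x * g x) μ := hu₀.integrable_mul hg
  rw [dist_eq_norm, ← integral_sub i1 i2]
  simp_rw [← sub_mul]
  exact abs_integral_mul_le ((hu k).sub hu₀) hg

/-- The composition estimate passes to uniform limits. -/
theorem abs_integral_comp_le_of_tendsto {C : Set (Rn N)} (hC : IsClosed C) {F : L2Field N}
    (hF : F ∈ sobolev C) {V : Set (Rn N)} (hV : IsOpen V) {Ψ : ℕ → Rn N → Rn N} {Ψ₀ : Rn N → Rn N}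
    {l : ℝ≥0} (hΨ : ∀ k, LipschitzOnWith l (Ψ k) V) (hΨ₀ : ContinuousOn Ψ₀ V)
    (hlim : TendstoUniformlyOn Ψ Ψ₀ atTop V) (hΨC : ∀ k, ∀ x ∈ V, Ψ k x ∉ C) {a : ℝ≥0∞}
    (ha : a ≠ ∞) (hvol : ∀ k s, MeasurableSet s → volume (V ∩ Ψ k ⁻¹' s) ≤ a * volume s)
    (hvol₀ : ∀ s, MeasurableSet s → volume (V ∩ Ψ₀ ⁻¹' s) ≤ a * volume s)
    {φ : Rn N → ℝ} (hφ : IsTest Vᶜ φ) (i : Fin N) :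
    |∫ x in tsupport φ, F (Ψ₀ x) 0 * partialDeriv i φ x| ≤
      l * (∑ j : Fin N, (a ^ (1 / (2 : ℝ))).toReal *
        (eLpNorm (fun x => F x j.succ) 2 volume).toReal) * (eLpNorm φ 2 volume).toReal := by
  have hQV : tsupport φ ⊆ V := fun x hx => by
    by_contra h; exact Set.disjoint_left.1 hφ.2.2 hx h
  have hQ : IsCompact (tsupport φ) := hφ.2.1
  have hv : ∀ {Θ : Rn N → Rn N}, (∀ s, MeasurableSet s → volume (V ∩ Θ ⁻¹' s) ≤ a * volume s) →
      ∀ s, MeasurableSet s → volume (tsupport φ ∩ Θ ⁻¹' s) ≤ a * volume s := fun h s hs =>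
    (measure_mono (Set.inter_subset_inter_left _ hQV)).trans (h s hs)
  have hc : ∀ k, ContinuousOn (Ψ k) (tsupport φ) := fun k => (hΨ k).continuousOn.mono hQV
  have hm := memLp_coord F 0
  have h1 := tendsto_eLpNorm_comp_sub hQ hc (hΨ₀.mono hQV) (hlim.mono hQV) ha
    (fun k => hv (hvol k)) (hv hvol₀) hm
  have h2 := fun k => (memLp_comp_of_volume_le ha ((hc k).aemeasurable hQ.measurableSet)
    (hv (hvol k)) hm).1
  have h3 := (memLp_comp_of_volume_le ha ((hΨ₀.mono hQV).aemeasurable hQ.measurableSet)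
    (hv hvol₀) hm).1
  have h4 := tendsto_integral_mul_of_eLpNorm h2 h3 (hφ.memLp_partialDeriv i _) h1
  -- Only the maps Ψ k must avoid C. The limit Ψ₀ may hit it, as the folding onto one side of a
  -- hypersurface does.
  refine le_of_tendsto' h4.abs fun k => ?_
  exact abs_integral_comp_le hC hF hV (hΨ k) (hΨC k) ha (hvol k) (T := id) LipschitzWith.id hφ i

/-- Truncation of Sobolev functions. -/
theorem exists_truncation {C : Set (Rn N)} (hC : IsClosed C) {F : L2Field N} (hF : F ∈ sobolev C) :
    ∃ A : ℝ, ∀ M : ℝ, 0 ≤ M → ∃ G ∈ sobolev C, (∀ᵐ x, G x 0 = max (-M) (min M (F x 0))) ∧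
      ‖G‖ ≤ A := by
  set A₀ : ℝ := ((1 : ℝ≥0) : ℝ) * (∑ j : Fin N, ((1 : ℝ≥0∞) ^ (1 / (2 : ℝ))).toReal *
        (eLpNorm (fun x => F x j.succ) 2 volume).toReal) with hA₀
  have hA₀n : 0 ≤ A₀ := by positivity
  refine ⟨(eLpNorm (fun x => F x 0) 2 volume).toReal + N * A₀, fun M hM => ?_⟩
  set T : ℝ → ℝ := fun s => max (-M) (min M s) with hTdef
  have hT : LipschitzWith 1 T := (LipschitzWith.id.const_min M).const_max (-M)
  have hTle : ∀ s, |T s| ≤ |s| := by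
    intro s
    simpa [dist_eq_norm, hTdef, hM] using hT.dist_le_mul s 0
  have hm := memLp_coord F 0
  have hTm : MemLp (fun x => T (F x 0)) 2 volume :=
    hm.mono (hT.continuous.comp_aestronglyMeasurable hm.1) (ae_of_all _ fun x => hTle _)
  -- The composition estimate with Ψ the identity and the truncation as outer function; the bound
  -- does not depend on M.
  obtain ⟨G, hG, hG0, hGn⟩ := exists_mem_sobolev_of_bound (C := C) hTm hA₀n (fun φ hφ i => by
    have := abs_integral_comp_le hC hF hC.isOpen_compl (Ψ := id) (l := 1)
      LipschitzWith.id.lipschitzOnWith (fun x hx => hx) (a := 1) (by simp)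
      (fun s _ => by simpa using measure_mono Set.inter_subset_right) hT (φ := φ)
      (by rwa [compl_compl]) i
    rw [setIntegral_eq_integral_of_forall_compl_eq_zero fun x hx => by
      rw [partialDeriv_eq_zero_of_notMem_tsupport i hx, mul_zero]] at this
    exact this)
  refine ⟨G, hG, hG0, hGn.trans ?_⟩
  gcongr
  · exact hm.eLpNorm_ne_top
  · exact eLpNorm_mono fun x => hTle _

theorem IsTest.mul_cutoff {V : Set (Rn N)} {χ φ : Rn N → ℝ} (hχ : ContDiff ℝ (⊤ : ℕ∞) χ)
    (hχV : tsupport χ ⊆ V) {C : Set (Rn N)} (hφ : IsTest C φ) :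
    IsTest Vᶜ (fun x => χ x * φ x) := by
  refine ⟨hχ.mul hφ.1, hφ.2.1.mul_left, ?_⟩
  rw [Set.disjoint_compl_right_iff_subset]
  exact (tsupport_mul_subset_left (f := χ) (g := φ)).trans hχV

/-- Extension by zero of a compactly supported function. -/
theorem exists_extension {V Q : Set (Rn N)} (hV : IsOpen V) (hQ : IsCompact Q) (hQV : Q ⊆ V)
    {w : Rn N → ℝ} (hw : MemLp w 2 (volume.restrict Q)) (hw0 : ∀ᵐ x, x ∈ V → x ∉ Q → w x = 0)
    {A : ℝ} (hA : 0 ≤ A) (h : ∀ φ, IsTest Vᶜ φ → ∀ i : Fin N,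
      |∫ x in tsupport φ, w x * partialDeriv i φ x| ≤ A * (eLpNorm φ 2 volume).toReal) :
    ∃ G ∈ sobolev (∅ : Set (Rn N)), ∀ᵐ x, G x 0 = Q.indicator w x := by
  obtain ⟨χ, hχ, hχc, hχs, hχ01, hχ1⟩ := exists_smooth_cutoff hQ hV hQV
  have hu : MemLp (Q.indicator w) 2 volume := (memLp_indicator_iff_restrict hQ.measurableSet).2 hw
  -- An arbitrary test function φ may be replaced by χφ, supported in V: χ = 1 near Q, and w
  -- vanishes on the rest of V. The duality bound on V thus becomes one on the whole space.
  obtain ⟨G, hG, hG0, -⟩ := exists_mem_sobolev_of_bound (C := ∅) hu hA (fun φ hφ i => by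
    have ht := hφ.mul_cutoff hχ hχs
    have key : ∫ x, Q.indicator w x * partialDeriv i φ x =
        ∫ x in tsupport (fun x => χ x * φ x), w x * partialDeriv i (fun x => χ x * φ x) x := by
      rw [← integral_indicator (isClosed_tsupport _).measurableSet]
      refine integral_congr_ae ?_
      filter_upwards [hw0] with x hx
      by_cases hxQ : x ∈ Q
      · have he : partialDeriv i (fun x => χ x * φ x) x = partialDeriv i φ x := by
          have : (fun x => χ x * φ x) =ᶠ[𝓝 x] φ := by
            filter_upwards [hχ1 x hxQ] with y hy
            rw [hy, one_mul]
          rw [partialDeriv, this.fderiv_eq]; rfl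
        by_cases hxt : x ∈ tsupport (fun x => χ x * φ x)
        · simp [hxQ, hxt, he]
        · have := partialDeriv_eq_zero_of_notMem_tsupport i hxt
          rw [he] at this
          simp [hxt, this]
      · by_cases hxt : x ∈ tsupport (fun x => χ x * φ x)
        · have hxV : x ∈ V := by
            by_contra hh; exact Set.disjoint_left.1 ht.2.2 hxt hh
          simp [hxQ, hxt, hx hxV hxQ]
        · simp [hxQ, hxt]
    rw [key]
    refine (h _ ht i).trans ?_
    gcongr
    · exact (hφ.memLp volume).eLpNorm_ne_top
    · refine eLpNorm_mono fun x => ?_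
      rw [norm_mul]
      refine mul_le_of_le_one_left (norm_nonneg _) ?_
      rw [Real.norm_eq_abs, abs_of_nonneg (hχ01 x).1]
      exact (hχ01 x).2)
  exact ⟨G, hG, hG0⟩

/-- Restriction of a Sobolev field to one side of a null set. -/
theorem exists_indicator_mem_sobolev {C' : Set (Rn N)} (hC0 : volume C' = 0)
    {F : L2Field N} (hF : F ∈ sobolev (∅ : Set (Rn N))) {B Q : Set (Rn N)} (hB : IsOpen B)
    (hQ : IsCompact Q) (hQB : Q ⊆ B) (hF0 : ∀ᵐ x, x ∉ Q → F x = 0) {A : Set (Rn N)}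
    (hAm : MeasurableSet A)
    (hA : ∀ x ∈ B, x ∉ C' → (∀ᶠ y in 𝓝 x, y ∈ A) ∨ ∀ᶠ y in 𝓝 x, y ∉ A) :
    ∃ G ∈ sobolev C', ∀ᵐ x, G x = A.indicator F x := by
  obtain ⟨χ, hχ, hχc, hχs, hχ01, hχ1⟩ := exists_smooth_cutoff hQ hB hQB
  -- An admissible multiplier in spite of its jump: inside B the indicator of A is locally constant
  -- off C', and outside B the cutoff vanishes locally.
  set ζ : Rn N → ℝ := A.indicator χ with hζdef
  have hloc : ∀ x, x ∉ C' → (ζ =ᶠ[𝓝 x] χ ∧ x ∈ A) ∨ (ζ =ᶠ[𝓝 x] 0 ∧ (x ∉ A ∨ x ∉ B)) := by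
    intro x hx
    by_cases hxB : x ∈ B
    · rcases hA x hxB hx with h | h
      · exact Or.inl ⟨h.mono fun y hy => Set.indicator_of_mem hy _, h.self_of_nhds⟩
      · exact Or.inr ⟨h.mono fun y hy => Set.indicator_of_notMem hy _, Or.inl h.self_of_nhds⟩
    · refine Or.inr ⟨?_, Or.inr hxB⟩
      have : χ =ᶠ[𝓝 x] 0 := notMem_tsupport_iff_eventuallyEq.1 fun h => hxB (hχs h)
      filter_upwards [this] with y hy
      rw [hζdef]
      by_cases hyA : y ∈ A <;> simp [hyA, hy]
  obtain ⟨M, hM⟩ : ∃ M, ∀ x, ‖fderiv ℝ χ x‖ ≤ M :=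
    (hχ.continuous_fderiv (by simp)).bounded_above_of_compact_support (hχc.fderiv (𝕜 := ℝ))
  have hMi : ∀ x i, |partialDeriv i χ x| ≤ M := fun x i => by
    refine ((fderiv ℝ χ x).le_opNorm _).trans ?_
    simpa using hM x
  have hM0 : 0 ≤ M := (norm_nonneg _).trans (hM 0)
  have hnull : ∀ᵐ x, x ∉ C' := measure_eq_zero_iff_ae_notMem.1 hC0
  have hder : ∀ x, ζ =ᶠ[𝓝 x] 0 → ∀ i, partialDeriv i ζ x = 0 := fun x hx i => by
    rw [partialDeriv, hx.fderiv_eq]; simp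
  have hder' : ∀ x, ζ =ᶠ[𝓝 x] χ → ∀ i, partialDeriv i ζ x = partialDeriv i χ x := fun x hx i => by
    rw [partialDeriv, hx.fderiv_eq]; rfl
  obtain ⟨G, hG, hG0, hGs⟩ := exists_mul_mem_sobolev (C := ∅) (C' := C') (ζ := ζ)
    (hχ.continuous.measurable.indicator hAm)
    (fun x hx => by
      rcases hloc x hx with ⟨h, -⟩ | ⟨h, -⟩
      · exact hχ.contDiffAt.congr_of_eventuallyEq h
      · exact contDiffAt_const.congr_of_eventuallyEq h)
    (by simp) (M := max 1 M)
    (by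
      filter_upwards [hnull] with x hx
      refine ⟨le_max_of_le_left ?_, fun i => le_max_of_le_right ?_⟩
      · rw [hζdef]
        by_cases hxA : x ∈ A
        · simpa [hxA, abs_of_nonneg (hχ01 x).1] using (hχ01 x).2
        · simp [hxA]
      · rcases hloc x hx with ⟨h, -⟩ | ⟨h, -⟩
        · rw [hder' x h]; exact hMi x i
        · rw [hder x h]; simpa using hM0) hF
  refine ⟨G, hG, ?_⟩
  filter_upwards [hG0, ae_all_iff.2 hGs, hnull, hF0] with x h0 hs hx hxQ
  by_cases hQx : x ∈ Q
  · have hd : ∀ i, partialDeriv i ζ x = 0 := by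
      intro i
      rcases hloc x hx with ⟨h, -⟩ | ⟨h, -⟩
      · rw [hder' x h, partialDeriv, (show χ =ᶠ[𝓝 x] fun _ => 1 from hχ1 x hQx).fderiv_eq]
        simp
      · exact hder x h i
    have hz : ζ x = A.indicator (fun _ => (1 : ℝ)) x := by
      rw [hζdef]
      by_cases hxA : x ∈ A
      · simp [hxA, (hχ1 x hQx).self_of_nhds]
      · simp [hxA]
    ext j
    refine Fin.cases ?_ (fun i => ?_) j
    · rw [h0, hz]
      by_cases hxA : x ∈ A <;> simp [hxA]
    · rw [hs, hz, hd]
      by_cases hxA : x ∈ A <;> simp [hxA]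
  · have hF00 := hxQ hQx
    have : A.indicator F x = 0 := by
      by_cases hxA : x ∈ A <;> simp [hxA, hF00]
    rw [this]
    ext j
    refine Fin.cases ?_ (fun i => ?_) j
    · rw [h0, hF00]; simp
    · rw [hs, hF00]; simp

end Consequences

/-! ### Extension across a bi-Lipschitz hypersurface by reflection -/

section Reflection

open scoped NNReal ENNReal

variable {N : ℕ}

theorem norm_le_norm_of_abs_le {y y' : Rn N} (h : ∀ i, |y i| ≤ |y' i|) : ‖y‖ ≤ ‖y'‖ := by
  rw [EuclideanSpace.norm_eq, EuclideanSpace.norm_eq]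
  refine Real.sqrt_le_sqrt (Finset.sum_le_sum fun i _ => ?_)
  exact pow_le_pow_left₀ (norm_nonneg _) (h i) 2

theorem norm_eq_norm_of_abs_eq {y y' : Rn N} (h : ∀ i, |y i| = |y' i|) : ‖y‖ = ‖y'‖ :=
  le_antisymm (norm_le_norm_of_abs_le fun i => (h i).le) (norm_le_norm_of_abs_le fun i => (h i).ge)

/-- Folding along the hyperplane `y e = 0`, followed by a translation by `t`. -/
noncomputable def fold (e : Fin N) (t : ℝ) (y : Rn N) : Rn N :=
  y + (|y e| - y e + t) • EuclideanSpace.single e 1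

theorem fold_apply_self (e : Fin N) (t : ℝ) (y : Rn N) : fold e t y e = |y e| + t := by
  simp only [fold, PiLp.add_apply, PiLp.smul_apply, PiLp.single_apply, if_true, smul_eq_mul]
  ring

theorem fold_apply_of_ne {e i : Fin N} (h : i ≠ e) (t : ℝ) (y : Rn N) : fold e t y i = y i := by
  simp [fold, h]

theorem fold_zero_of_nonneg {e : Fin N} {y : Rn N} (h : 0 ≤ y e) : fold e 0 y = y := by
  simp [fold, abs_of_nonneg h]

theorem norm_fold_sub_fold_le (e : Fin N) (t : ℝ) (y y' : Rn N) :
    ‖fold e t y - fold e t y'‖ ≤ ‖y - y'‖ := by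
  refine norm_le_norm_of_abs_le fun i => ?_
  rcases eq_or_ne i e with rfl | h
  · simp only [PiLp.sub_apply, fold_apply_self, add_sub_add_right_eq_sub]
    exact abs_abs_sub_abs_le _ _
  · simp only [PiLp.sub_apply, fold_apply_of_ne h]; rfl

/-- Folding is isometric on each closed half-space separately; splitting a set into its two sides
then controls the volume of preimages. -/
theorem norm_fold_sub_fold_of_nonneg {e : Fin N} (t : ℝ) {y y' : Rn N} (h : 0 ≤ y e)
    (h' : 0 ≤ y' e) : ‖fold e t y - fold e t y'‖ = ‖y - y'‖ := by
  refine norm_eq_norm_of_abs_eq fun i => ?_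
  rcases eq_or_ne i e with rfl | hi
  · simp [fold_apply_self, abs_of_nonneg h, abs_of_nonneg h']
  · simp [fold_apply_of_ne hi]

theorem norm_fold_sub_fold_of_nonpos {e : Fin N} (t : ℝ) {y y' : Rn N} (h : y e ≤ 0)
    (h' : y' e ≤ 0) : ‖fold e t y - fold e t y'‖ = ‖y - y'‖ := by
  refine norm_eq_norm_of_abs_eq fun i => ?_
  rcases eq_or_ne i e with rfl | hi
  · simp only [PiLp.sub_apply, fold_apply_self, abs_of_nonpos h, abs_of_nonpos h']
    rw [← abs_neg]
    congr 1; ring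
  · simp [fold_apply_of_ne hi]

theorem norm_fold_zero (e : Fin N) (y : Rn N) : ‖fold e 0 y‖ = ‖y‖ := by
  refine norm_eq_norm_of_abs_eq fun i => ?_
  rcases eq_or_ne i e with rfl | hi
  · simp [fold_apply_self]
  · simp [fold_apply_of_ne hi]

theorem norm_fold_sub_fold_zero (e : Fin N) (t : ℝ) (y : Rn N) :
    ‖fold e t y - fold e 0 y‖ = |t| := by
  have : fold e t y - fold e 0 y = t • EuclideanSpace.single e 1 := by
    simp only [fold, add_sub_add_left_eq_sub, ← sub_smul]
    congr 1; ring
  rw [this, norm_smul]; simp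

theorem norm_fold_le (e : Fin N) (t : ℝ) (y : Rn N) : ‖fold e t y‖ ≤ ‖y‖ + |t| := by
  have := norm_add_le (fold e t y - fold e 0 y) (fold e 0 y)
  rw [sub_add_cancel, norm_fold_sub_fold_zero, norm_fold_zero] at this
  linarith

/-- `Φ` is bi-Lipschitz with constant `L` on `U`. -/
def BiLipOn (L : ℝ) (Φ : Rn N → Rn N) (U : Set (Rn N)) : Prop :=
  ∀ z₁ ∈ U, ∀ z₂ ∈ U, L⁻¹ * ‖z₁ - z₂‖ ≤ ‖Φ z₁ - Φ z₂‖ ∧ ‖Φ z₁ - Φ z₂‖ ≤ L * ‖z₁ - z₂‖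

theorem BiLipOn.mono {L : ℝ} {Φ : Rn N → Rn N} {U U' : Set (Rn N)} (h : BiLipOn L Φ U)
    (hU : U' ⊆ U) : BiLipOn L Φ U' := fun z₁ h₁ z₂ h₂ => h z₁ (hU h₁) z₂ (hU h₂)

theorem BiLipOn.norm_le {L : ℝ} (hL : 0 < L) {Φ : Rn N → Rn N} {U : Set (Rn N)}
    (h : BiLipOn L Φ U) {z₁ z₂ : Rn N} (h₁ : z₁ ∈ U) (h₂ : z₂ ∈ U) :
    ‖z₁ - z₂‖ ≤ L * ‖Φ z₁ - Φ z₂‖ := by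
  have := (h z₁ h₁ z₂ h₂).1
  rwa [inv_mul_le_iff₀ hL] at this

theorem BiLipOn.lipschitzOnWith {L : ℝ} (hL : 0 < L) {Φ : Rn N → Rn N} {U : Set (Rn N)}
    (h : BiLipOn L Φ U) : LipschitzOnWith L.toNNReal Φ U :=
  LipschitzOnWith.of_dist_le_mul fun x hx y hy => by
    rw [dist_eq_norm, dist_eq_norm, Real.coe_toNNReal _ hL.le]; exact (h x hx y hy).2

theorem BiLipOn.continuousOn {L : ℝ} (hL : 0 < L) {Φ : Rn N → Rn N} {U : Set (Rn N)}
    (h : BiLipOn L Φ U) : ContinuousOn Φ U := (h.lipschitzOnWith hL).continuousOn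

theorem BiLipOn.injOn {L : ℝ} (hL : 0 < L) {Φ : Rn N → Rn N} {U : Set (Rn N)}
    (h : BiLipOn L Φ U) : Set.InjOn Φ U := fun x hx y hy hxy => by
  have := h.norm_le hL hx hy
  rw [hxy, sub_self, norm_zero, mul_zero] at this
  exact sub_eq_zero.1 (norm_le_zero_iff.1 this)

/-- One side of a Sobolev function whose singular set lies on a bi-Lipschitz hypersurface extends
across it by reflection. -/
theorem exists_reflection (e : Fin N) {L : ℝ} (hL : 1 ≤ L) {C : Set (Rn N)} (hC : IsClosed C)
    {x₀ : Rn N} {s s' : ℝ} (hs' : 0 < s') (hss : L ^ 4 * s' < s) {Φ : Rn N → Rn N}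
    (hΦ : BiLipOn L Φ (Metric.ball x₀ s)) (hΦ0 : Φ x₀ = 0)
    (hΦC : ∀ z ∈ C, z ∈ Metric.ball x₀ s → Φ z e = 0) {F : L2Field N} (hF : F ∈ sobolev C)
    (hF0 : ∀ᵐ x, x ∉ Metric.closedBall x₀ s' → F x = 0) :
    ∃ G ∈ sobolev (∅ : Set (Rn N)),
      (∀ᵐ x, x ∈ Metric.ball x₀ s → 0 < Φ x e → G x = F x) ∧
      ∀ᵐ x, x ∉ Metric.closedBall x₀ (L ^ 2 * s') → G x = 0 := by
  have hL0 : 0 < L := zero_lt_one.trans_le hL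
  have hN : Module.finrank ℝ (Rn N) ≠ 0 := by
    rw [finrank_euclideanSpace_fin]; exact (Nat.pos_of_ne_zero fun h => by subst h; exact e.elim0).ne'
  have hs : 0 < s := lt_trans (by positivity) hss
  have hx₀ : x₀ ∈ Metric.ball x₀ s := Metric.mem_ball_self hs
  -- Φ of the ball covers the ball of radius c, while Φ(Q) stays within radius L ^ 3 * s' < c. The
  -- midpoint c' defines V, and τ = c - c' is the room left for translating after the folding.
  set c := s / L with hc
  have hcpos : 0 < c := by positivity
  have hcc : L ^ 3 * s' < c := by
    rw [hc, lt_div_iff₀ hL0]; linarith [hss, show L ^ 3 * s' * L = L ^ 4 * s' by ring]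
  set c' := (L ^ 3 * s' + c) / 2 with hc'
  set τ := c - c' with hτ
  have hτ0 : 0 < τ := by rw [hτ, hc']; linarith
  have hball : Metric.ball 0 c ⊆ Φ '' Metric.ball x₀ s := by
    have := (ball_subset_image_of_biLipschitz hN hL0 hΦ).2
    rwa [hΦ0] at this
  set g := Function.invFunOn Φ (Metric.ball x₀ s) with hg
  have hg1 : ∀ y ∈ Metric.ball (0 : Rn N) c, g y ∈ Metric.ball x₀ s ∧ Φ (g y) = y := fun y hy =>
    ⟨Function.invFunOn_mem (hball hy), Function.invFunOn_eq (hball hy)⟩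
  have hgΦ : ∀ z ∈ Metric.ball x₀ s, ‖Φ z‖ < c → g (Φ z) = z := fun z hz hzc =>
    hΦ.injOn hL0 (hg1 _ (by simpa using hzc)).1 hz (hg1 _ (by simpa using hzc)).2
  set V : Set (Rn N) := Metric.ball x₀ s ∩ Φ ⁻¹' Metric.ball 0 c' with hVdef
  have hV : IsOpen V := (hΦ.continuousOn hL0).isOpen_inter_preimage Metric.isOpen_ball
    Metric.isOpen_ball
  have hVc : ∀ z ∈ V, ‖Φ z‖ < c' := fun z hz => by simpa using hz.2
  -- In the chart: fold the lower side onto the upper one and lift by t. For t > 0 the image has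
  -- e-coordinate at least t and avoids C; the reflection itself is the uniform limit at t = 0.
  set Ψ : ℝ → Rn N → Rn N := fun t z => g (fold e t (Φ z)) with hΨ
  have hfb : ∀ t, 0 ≤ t → t ≤ τ → ∀ z ∈ V, fold e t (Φ z) ∈ Metric.ball (0 : Rn N) c := by
    intro t ht htτ z hz
    rw [mem_ball_zero_iff]
    have := norm_fold_le e t (Φ z)
    rw [abs_of_nonneg ht] at this
    linarith [hVc z hz]
  have hΨm : ∀ t, 0 ≤ t → t ≤ τ → ∀ z ∈ V, Ψ t z ∈ Metric.ball x₀ s ∧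
      Φ (Ψ t z) = fold e t (Φ z) := fun t ht htτ z hz => hg1 _ (hfb t ht htτ z hz)
  have hlip : ∀ t, 0 ≤ t → t ≤ τ → LipschitzOnWith (L.toNNReal * L.toNNReal) (Ψ t) V := by
    intro t ht htτ
    refine LipschitzOnWith.of_dist_le_mul fun z hz z' hz' => ?_
    obtain ⟨h1, h2⟩ := hΨm t ht htτ z hz
    obtain ⟨h1', h2'⟩ := hΨm t ht htτ z' hz'
    rw [dist_eq_norm, dist_eq_norm]
    refine (hΦ.norm_le hL0 h1 h1').trans ?_
    rw [h2, h2', NNReal.coe_mul, Real.coe_toNNReal _ hL0.le, mul_assoc]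
    refine mul_le_mul_of_nonneg_left ?_ hL0.le
    exact (norm_fold_sub_fold_le e t _ _).trans (hΦ z hz.1 z' hz'.1).2
  set a₁ : ℝ≥0∞ := ((L.toNNReal * L.toNNReal : ℝ≥0) : ℝ≥0∞) ^ Module.finrank ℝ (Rn N) with ha₁
  have ha₁t : a₁ ≠ ∞ := ENNReal.pow_ne_top ENNReal.coe_ne_top
  have hvol : ∀ t, 0 ≤ t → t ≤ τ → ∀ A, MeasurableSet A →
      volume (V ∩ Ψ t ⁻¹' A) ≤ 2 * a₁ * volume A := by
    intro t ht htτ A _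
    have key : ∀ U ⊆ V, (∀ z ∈ U, ∀ z' ∈ U, ‖fold e t (Φ z) - fold e t (Φ z')‖ = ‖Φ z - Φ z'‖) →
        volume (U ∩ Ψ t ⁻¹' A) ≤ a₁ * volume A := by
      intro U hU hiso
      refine volume_inter_preimage_le fun z hz z' hz' => ?_
      obtain ⟨h1, h2⟩ := hΨm t ht htτ z (hU hz)
      obtain ⟨h1', h2'⟩ := hΨm t ht htτ z' (hU hz')
      rw [dist_eq_norm, dist_eq_norm]
      refine (hΦ.norm_le hL0 (hU hz).1 (hU hz').1).trans ?_
      rw [← hiso z hz z' hz', ← h2, ← h2', NNReal.coe_mul, Real.coe_toNNReal _ hL0.le, mul_assoc]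
      exact mul_le_mul_of_nonneg_left (hΦ _ h1 _ h1').2 hL0.le
    have h1 := key {z | z ∈ V ∧ 0 ≤ Φ z e} (fun z hz => hz.1) fun z hz z' hz' =>
      norm_fold_sub_fold_of_nonneg t hz.2 hz'.2
    have h2 := key {z | z ∈ V ∧ Φ z e ≤ 0} (fun z hz => hz.1) fun z hz z' hz' =>
      norm_fold_sub_fold_of_nonpos t hz.2 hz'.2
    calc volume (V ∩ Ψ t ⁻¹' A) ≤ volume (({z | z ∈ V ∧ 0 ≤ Φ z e} ∩ Ψ t ⁻¹' A) ∪
          ({z | z ∈ V ∧ Φ z e ≤ 0} ∩ Ψ t ⁻¹' A)) := by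
          refine measure_mono ?_
          rintro z ⟨hz, hzA⟩
          rcases le_total 0 (Φ z e) with h | h
          · exact Or.inl ⟨⟨hz, h⟩, hzA⟩
          · exact Or.inr ⟨⟨hz, h⟩, hzA⟩
      _ ≤ a₁ * volume A + a₁ * volume A := (measure_union_le _ _).trans (add_le_add h1 h2)
      _ = 2 * a₁ * volume A := by rw [mul_assoc, two_mul]
  have hat : 2 * a₁ ≠ ∞ := ENNReal.mul_ne_top (by norm_num) ha₁t
  have ht : ∀ k : ℕ, 0 < τ / (k + 1) ∧ τ / (k + 1) ≤ τ := fun k =>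
    ⟨by positivity, div_le_self hτ0.le (by simp)⟩
  have hunif : TendstoUniformlyOn (fun k : ℕ => Ψ (τ / (k + 1))) (Ψ 0) atTop V := by
    rw [Metric.tendstoUniformlyOn_iff]
    intro ε hε
    have hl : Tendsto (fun k : ℕ => L * (τ / ((k : ℝ) + 1))) atTop (𝓝 0) := by
      simpa using (tendsto_const_div_atTop_nhds_zero_nat τ).comp (tendsto_add_atTop_nat 1)
        |>.const_mul L
    filter_upwards [hl.eventually (gt_mem_nhds hε)] with k hk z hz
    obtain ⟨h1, h2⟩ := hΨm _ (ht k).1.le (ht k).2 z hz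
    obtain ⟨h1', h2'⟩ := hΨm 0 le_rfl hτ0.le z hz
    rw [dist_comm, dist_eq_norm]
    refine ((hΦ.norm_le hL0 h1 h1').trans (le_of_eq ?_)).trans_lt hk
    rw [h2, h2', norm_fold_sub_fold_zero, abs_of_pos (ht k).1]
  have hoff : ∀ k : ℕ, ∀ x ∈ V, Ψ (τ / (k + 1)) x ∉ C := by
    intro k x hx hxC
    obtain ⟨h1, h2⟩ := hΨm _ (ht k).1.le (ht k).2 x hx
    have := hΦC _ hxC h1
    rw [h2, fold_apply_self] at this
    linarith [abs_nonneg (Φ x e), (ht k).1]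
  set Q := Metric.closedBall x₀ (L ^ 2 * s') with hQ
  have hL2 : 1 ≤ L ^ 2 := one_le_pow₀ hL
  have hQs : ∀ z ∈ Q, z ∈ Metric.ball x₀ s := by
    intro z hz
    refine Metric.mem_ball.2 ((Metric.mem_closedBall.1 hz).trans_lt (lt_of_le_of_lt ?_ hss))
    exact mul_le_mul_of_nonneg_right (pow_le_pow_right₀ hL (by norm_num)) hs'.le
  have hQV : Q ⊆ V := by
    intro z hz
    refine ⟨hQs z hz, ?_⟩
    have h1 := (hΦ z (hQs z hz) x₀ hx₀).2
    rw [hΦ0, sub_zero] at h1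
    have h2 : ‖z - x₀‖ ≤ L ^ 2 * s' := by rw [← dist_eq_norm]; exact hz
    simp only [Set.mem_preimage, mem_ball_zero_iff]
    calc ‖Φ z‖ ≤ L * (L ^ 2 * s') := h1.trans (mul_le_mul_of_nonneg_left h2 hL0.le)
      _ = L ^ 3 * s' := by ring
      _ < c' := by rw [hc']; linarith
  have hsQ : Metric.closedBall x₀ s' ⊆ Q := Metric.closedBall_subset_closedBall
    (le_mul_of_one_le_left hs'.le hL2)
  have hQc : IsCompact Q := isCompact_closedBall _ _
  have hcont₀ : ContinuousOn (Ψ 0) V := (hlip 0 le_rfl hτ0.le).continuousOn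
  have hw := (memLp_comp_of_volume_le hat ((hcont₀.mono hQV).aemeasurable hQc.measurableSet)
    (fun A hA => (measure_mono (Set.inter_subset_inter_left _ hQV)).trans
      (hvol 0 le_rfl hτ0.le A hA)) (memLp_coord F 0)).1
  -- Folding preserves the norm, and passing through Φ and back costs a factor L each way; hence the
  -- radius L ^ 2 * s' of Q.
  have hback : ∀ x ∈ V, Ψ 0 x ∈ Metric.closedBall x₀ s' → x ∈ Q := by
    intro x hx hxs
    obtain ⟨h1, h2⟩ := hΨm 0 le_rfl hτ0.le x hx
    have h3 := (hΦ _ h1 x₀ hx₀).2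
    rw [hΦ0, sub_zero, h2, norm_fold_zero] at h3
    have h4 := hΦ.norm_le hL0 hx.1 hx₀
    rw [hΦ0, sub_zero] at h4
    rw [hQ, Metric.mem_closedBall, dist_eq_norm]
    rw [Metric.mem_closedBall, dist_eq_norm] at hxs
    calc ‖x - x₀‖ ≤ L * (L * s') := h4.trans (mul_le_mul_of_nonneg_left
          (h3.trans (mul_le_mul_of_nonneg_left hxs hL0.le)) hL0.le)
      _ = L ^ 2 * s' := by ring
  -- F vanishes off the small ball only almost everywhere; the exceptional set is enclosed in a
  -- measurable null set, whose preimage is null by the volume bound.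
  have hw0 : ∀ᵐ x, x ∈ V → x ∉ Q → F (Ψ 0 x) 0 = 0 := by
    set Z : Set (Rn N) := {y | ¬ (y ∉ Metric.closedBall x₀ s' → F y = 0)} with hZ
    have hZ0 : volume Z = 0 := hF0
    have hnull : volume (V ∩ Ψ 0 ⁻¹' toMeasurable volume Z) = 0 := by
      have := hvol 0 le_rfl hτ0.le _ (measurableSet_toMeasurable volume Z)
      rw [measure_toMeasurable, hZ0, mul_zero] at this
      exact le_antisymm this bot_le
    filter_upwards [measure_eq_zero_iff_ae_notMem.1 hnull] with x hx hxV hxQ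
    have h1 : Ψ 0 x ∉ Z := fun h => hx ⟨hxV, subset_toMeasurable _ _ h⟩
    rw [hZ, Set.mem_ofPred_eq, not_not] at h1
    rw [h1 fun h => hxQ (hback x hxV h)]
    rfl
  obtain ⟨G, hG, hG0⟩ := exists_extension hV hQc hQV hw hw0 (A := _) (by positivity)
    fun φ hφ i => abs_integral_comp_le_of_tendsto hC hF hV
      (fun k => hlip _ (ht k).1.le (ht k).2) hcont₀ hunif hoff hat
      (fun k => hvol _ (ht k).1.le (ht k).2) (hvol 0 le_rfl hτ0.le) hφ i
  refine ⟨G, hG, ?_, ?_⟩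
  -- On the upper side Ψ 0 is the identity, so G and F have the same coordinate 0 there; their weak
  -- gradients then agree too.
  · set U := Metric.ball x₀ s ∩ Φ ⁻¹' {y | 0 < y e} with hU
    have hUo : IsOpen U := (hΦ.continuousOn hL0).isOpen_inter_preimage Metric.isOpen_ball
      (isOpen_lt continuous_const (by fun_prop))
    have hd := sobolev_ae_eq_zero hC
      (Submodule.sub_mem _ (sobolev_mono (Set.empty_subset C) hG) hF) hUo (by
        filter_upwards [Lp.coeFn_sub G F, hG0, hF0] with x h1 h2 h3 hx
        rw [h1, Pi.sub_apply, PiLp.sub_apply, h2]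
        by_cases hxQ : x ∈ Q
        · have : Ψ 0 x = x := by
            simp only [hΨ, fold_zero_of_nonneg (le_of_lt (show 0 < Φ x e from hx.2))]
            exact hgΦ x hx.1 ((hVc x (hQV hxQ)).trans (by rw [hτ] at hτ0; linarith))
          rw [Set.indicator_of_mem hxQ, this, sub_self]
        · rw [Set.indicator_of_notMem hxQ, h3 fun h => hxQ (hsQ h)]
          simp)
    filter_upwards [hd, Lp.coeFn_sub G F] with x h1 h2 hxs hxe
    have hxC : x ∉ C := fun h => hxe.ne' (hΦC x h hxs)
    have := h1 ⟨hxs, hxe⟩ hxC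
    rw [h2, Pi.sub_apply, sub_eq_zero] at this
    exact this
  · have := sobolev_ae_eq_zero isClosed_empty hG hQc.isClosed.isOpen_compl (by
      filter_upwards [hG0] with x hx hxQ
      rw [hx, Set.indicator_of_notMem hxQ])
    filter_upwards [this] with x hx hxQ using hx hxQ (Set.notMem_empty x)

/-- Both one-sided extensions of a Sobolev function whose singular set lies on a bi-Lipschitz
hypersurface. -/
theorem exists_two_reflections (e : Fin N) {L : ℝ} (hL : 1 ≤ L) {C : Set (Rn N)} (hC : IsClosed C)
    {x₀ : Rn N} {s s' : ℝ} (hs' : 0 < s') (hss : L ^ 4 * s' < s) {Φ : Rn N → Rn N}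
    (hΦ : BiLipOn L Φ (Metric.ball x₀ s)) (hΦ0 : Φ x₀ = 0)
    (hΦC : ∀ z ∈ C, z ∈ Metric.ball x₀ s → Φ z e = 0) {F : L2Field N} (hF : F ∈ sobolev C)
    (hF0 : ∀ᵐ x, x ∉ Metric.closedBall x₀ s' → F x = 0) :
    ∃ G ∈ sobolev (∅ : Set (Rn N)), ∃ H ∈ sobolev (∅ : Set (Rn N)),
      (∀ᵐ x, x ∈ Metric.ball x₀ s → 0 < Φ x e → G x = F x) ∧
      (∀ᵐ x, x ∉ Metric.closedBall x₀ (L ^ 2 * s') → G x = 0) ∧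
      (∀ᵐ x, x ∈ Metric.ball x₀ s → Φ x e < 0 → H x = F x) ∧
      ∀ᵐ x, x ∉ Metric.closedBall x₀ (L ^ 2 * s') → H x = 0 := by
  obtain ⟨G, hG, hG1, hG2⟩ := exists_reflection e hL hC hs' hss hΦ hΦ0 hΦC hF hF0
  -- Changing the sign of the e-coordinate of the chart exchanges the two sides.
  set Φ' : Rn N → Rn N := fun z => Φ z - (2 * Φ z e) • EuclideanSpace.single e 1 with hΦ'
  have he : ∀ z, Φ' z e = -Φ z e := fun z => by simp [hΦ']; ring
  have hne : ∀ z, ∀ i, i ≠ e → Φ' z i = Φ z i := fun z i hi => by simp [hΦ', hi]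
  have hnorm : ∀ z z', ‖Φ' z - Φ' z'‖ = ‖Φ z - Φ z'‖ := fun z z' => by
    refine norm_eq_norm_of_abs_eq fun i => ?_
    rcases eq_or_ne i e with rfl | hi
    · simp only [PiLp.sub_apply, he]
      rw [← abs_neg]; congr 1; ring
    · simp only [PiLp.sub_apply, hne _ _ hi]
  obtain ⟨H, hH, hH1, hH2⟩ := exists_reflection e hL hC hs' hss (Φ := Φ')
    (fun z hz z' hz' => by rw [hnorm]; exact hΦ z hz z' hz') (by simp [hΦ', hΦ0])
    (fun z hz hzs => by rw [he, hΦC z hz hzs, neg_zero]) hF hF0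
  refine ⟨G, hG, H, hH, hG1, hG2, ?_, hH2⟩
  filter_upwards [hH1] with x hx hxs hxe
  exact hx hxs (by rw [he]; linarith)

end Reflection

/-! ### Interior and boundary of Lipschitz hypersurfaces -/

section Hypersurface

open scoped NNReal ENNReal

variable {N : ℕ}

theorem mem_flatHyperplane_iff {e : Fin N} (he : (e : ℕ) + 1 = N) {y : Rn N} :
    y ∈ flatHyperplane N ↔ y e = 0 := by
  refine ⟨fun h => h e he, fun h i hi => ?_⟩
  have : i = e := Fin.ext (by omega)
  rwa [this]

theorem mem_flatHalfHyperplane_iff {e d : Fin N} (he : (e : ℕ) + 1 = N) (hd : (d : ℕ) + 2 = N)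
    {y : Rn N} : y ∈ flatHalfHyperplane N ↔ y e = 0 ∧ 0 ≤ y d := by
  refine and_congr (mem_flatHyperplane_iff he) ⟨fun h => h d hd, fun h i hi => ?_⟩
  have : i = d := Fin.ext (by omega)
  rwa [this]

theorem exists_last_two (hN : 2 ≤ N) :
    ∃ e d : Fin N, (e : ℕ) + 1 = N ∧ (d : ℕ) + 2 = N ∧ d ≠ e :=
  ⟨⟨N - 1, by omega⟩, ⟨N - 2, by omega⟩, by simp; omega, by simp; omega, by simp; omega⟩

/-- If a set looks flat in two charts and covers a disc of the hyperplane in the first one, it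
also covers a disc in the second one. -/
theorem exists_disc_of_disc {e d : Fin N} (hde : d ≠ e) {A : Set (Rn N)} {Φ Φ' : Rn N → Rn N}
    {x x' z : Rn N} {r r' L : ℝ} (hL : 0 < L) (hΦ : BiLipOn L Φ (Metric.ball x r))
    (hΦ' : BiLipOn L Φ' (Metric.ball x' r')) (hz : z ∈ Metric.ball x r)
    (hz' : z ∈ Metric.ball x' r') (hz0 : Φ z e = 0)
    (hA' : ∀ w ∈ A, w ∈ Metric.ball x' r' → Φ' w e = 0) {δ : ℝ} (hδ : 0 < δ)
    (hdisc : ∀ y : Rn N, y e = 0 → ‖y - Φ z‖ < δ → ∃ w ∈ A, w ∈ Metric.ball x r ∧ Φ w = y) :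
    ∃ δ' > 0, ∀ y : Rn N, y e = 0 → ‖y - Φ' z‖ < δ' →
      ∃ w ∈ A, w ∈ Metric.ball x' r' ∧ Φ' w = y := by
  -- The transition between the two charts is bi-Lipschitz from a disc of the hyperplane E into E,
  -- so invariance of domain is applied inside E. The coordinate d ≠ e makes the dimension of E
  -- positive.
  set E : Submodule ℝ (Rn N) :=
    LinearMap.ker (EuclideanSpace.proj e : Rn N →L[ℝ] ℝ).toLinearMap with hE
  have hmem : ∀ y : Rn N, y ∈ E ↔ y e = 0 := fun y => by simp [hE]
  have hnt : Nontrivial E := by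
    refine ⟨⟨⟨EuclideanSpace.single d 1, (hmem _).2 (by simp [hde.symm])⟩, 0, fun h => ?_⟩⟩
    have := congrArg (fun v : E => (v : Rn N) d) h
    simp at this
  have hfin : Module.finrank ℝ E ≠ 0 := Module.finrank_pos.ne'
  set y₀ : E := ⟨Φ z, (hmem _).2 hz0⟩ with hy₀
  have hgap : 0 < r' - dist z x' := sub_pos.2 hz'
  set δ₁ := min δ ((r' - dist z x') / L) with hδ₁
  have hδ₁0 : 0 < δ₁ := lt_min hδ (by positivity)
  have hex : ∀ y : E, ∃ v : E, y ∈ Metric.ball y₀ δ₁ →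
      ∃ w ∈ A, w ∈ Metric.ball x r ∧ w ∈ Metric.ball x' r' ∧ Φ w = y ∧ Φ' w = v := by
    intro y
    by_cases hy : y ∈ Metric.ball y₀ δ₁
    · have hy1 : ‖(y : Rn N) - Φ z‖ < δ₁ := by
        rw [Metric.mem_ball, Subtype.dist_eq, dist_eq_norm] at hy; exact hy
      obtain ⟨w, hwA, hwx, hw⟩ := hdisc y ((hmem _).1 y.2) (hy1.trans_le (min_le_left _ _))
      have h1 := hΦ.norm_le hL hwx hz
      rw [hw] at h1
      have h2 : L * ‖(y : Rn N) - Φ z‖ < r' - dist z x' := by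
        rw [mul_comm, ← lt_div_iff₀ hL]; exact hy1.trans_le (min_le_right _ _)
      have hwx' : w ∈ Metric.ball x' r' := by
        rw [Metric.mem_ball]
        have := dist_triangle w z x'
        rw [dist_eq_norm w z] at this
        linarith
      exact ⟨⟨Φ' w, (hmem _).2 (hA' w hwA hwx')⟩, fun _ => ⟨w, hwA, hwx, hwx', hw, rfl⟩⟩
    · exact ⟨0, fun h => absurd h hy⟩
  choose f hf using hex
  have hball := (ball_subset_image_of_biLipschitz hfin (L := L * L) (by positivity) (f := f)
    (x₀ := y₀) (ρ := δ₁) (fun y₁ h₁ y₂ h₂ => by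
      obtain ⟨w₁, -, a1, b1, c1, d1⟩ := hf y₁ h₁
      obtain ⟨w₂, -, a2, b2, c2, d2⟩ := hf y₂ h₂
      have e1 : ‖y₁ - y₂‖ = ‖Φ w₁ - Φ w₂‖ := by rw [c1, c2]; rfl
      have e2 : ‖f y₁ - f y₂‖ = ‖Φ' w₁ - Φ' w₂‖ := by rw [d1, d2]; rfl
      rw [e1, e2]
      have g1 := hΦ w₁ a1 w₂ a2
      have g2 := hΦ' w₁ b1 w₂ b2
      have g3 := hΦ.norm_le hL a1 a2
      have g4 := hΦ'.norm_le hL b1 b2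
      constructor
      · rw [inv_mul_le_iff₀ (by positivity), mul_assoc]
        exact g1.2.trans (mul_le_mul_of_nonneg_left g4 hL.le)
      · rw [mul_assoc]
        exact g2.2.trans (mul_le_mul_of_nonneg_left g3 hL.le))).2
  have hfy₀ : (f y₀ : Rn N) = Φ' z := by
    obtain ⟨w, -, a, -, c, dd⟩ := hf y₀ (Metric.mem_ball_self hδ₁0)
    rw [← dd, hΦ.injOn hL a hz c]
  refine ⟨δ₁ / (L * L), by positivity, fun y hye hy => ?_⟩
  have hyb : (⟨y, (hmem _).2 hye⟩ : E) ∈ Metric.ball (f y₀) (δ₁ / (L * L)) := by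
    rw [Metric.mem_ball, Subtype.dist_eq, dist_eq_norm, hfy₀]; exact hy
  obtain ⟨v, hv, hvy⟩ := hball hyb
  obtain ⟨w, hw, -, hwx', -, hwv⟩ := hf v hv
  exact ⟨w, hw, hwx', by rw [hwv, hvy]⟩

namespace LipschitzHypersurface

variable {r L : ℝ} (S : LipschitzHypersurface N r L)

theorem biLipOn {x : Rn N} (hx : x ∈ S.carrier) : BiLipOn L (S.chart x) (Metric.ball x r) :=
  S.biLipschitz x hx

theorem chart_eq_zero {e : Fin N} (he : (e : ℕ) + 1 = N) {x : Rn N} (hx : x ∈ S.carrier)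
    {z : Rn N} (hz : z ∈ S.carrier) (hzx : z ∈ Metric.ball x r) : S.chart x z e = 0 :=
  (mem_flatHyperplane_iff he).1 (S.image_flat x hx ⟨z, ⟨hz, hzx⟩, rfl⟩)

/-- An interior point of a hypersurface is interior with respect to every chart. -/
theorem exists_disc_of_notMem_boundary {e d : Fin N} (he : (e : ℕ) + 1 = N) (hde : d ≠ e)
    (hr : 0 < r) (hL : 0 < L) {x z : Rn N} (hx : x ∈ S.carrier) (hz : z ∈ S.carrier)
    (hzx : z ∈ Metric.ball x r) (hzb : z ∉ S.boundary) :
    ∃ δ > 0, ∀ y : Rn N, y e = 0 → ‖y - S.chart x z‖ < δ →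
      ∃ w ∈ S.carrier, w ∈ Metric.ball x r ∧ S.chart x w = y := by
  have hc : CoversFlatDisc r S.carrier z (S.chart z) := by
    by_contra h; exact hzb ⟨hz, h⟩
  obtain ⟨δ, hδ, -, hsub⟩ := hc
  have hzz := Metric.mem_ball_self (x := z) hr
  refine exists_disc_of_disc hde hL (S.biLipOn hz) (S.biLipOn hx) hzz hzx
    (S.chart_eq_zero he hz hz hzz) (fun w hw hwx => S.chart_eq_zero he hx hw hwx) hδ
    fun y hy hyz => ?_
  rw [S.chart_self z hz, sub_zero] at hyz
  obtain ⟨w, ⟨hw1, hw2⟩, hw3⟩ := hsub ⟨by simpa using hyz, (mem_flatHyperplane_iff he).2 hy⟩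
  exact ⟨w, hw1, hw2, hw3⟩

/-- A point around which a hypersurface covers a disc in some chart is interior. -/
theorem notMem_boundary_of_disc {e d : Fin N} (he : (e : ℕ) + 1 = N) (hde : d ≠ e)
    (hr : 0 < r) (hL : 0 < L) {x z : Rn N} (hx : x ∈ S.carrier) (hz : z ∈ S.carrier)
    (hzx : z ∈ Metric.ball x r) {δ : ℝ} (hδ : 0 < δ)
    (hdisc : ∀ y : Rn N, y e = 0 → ‖y - S.chart x z‖ < δ →
      ∃ w ∈ S.carrier, w ∈ Metric.ball x r ∧ S.chart x w = y) : z ∉ S.boundary := by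
  have hzz := Metric.mem_ball_self (x := z) hr
  obtain ⟨δ', hδ', h⟩ := exists_disc_of_disc hde hL (S.biLipOn hx) (S.biLipOn hz) hzx hzz
    (S.chart_eq_zero he hx hz hzx) (fun w hw hwx => S.chart_eq_zero he hz hw hwx) hδ hdisc
  rintro ⟨-, hn⟩
  refine hn ⟨min δ' r, lt_min hδ' hr, min_le_right _ _, ?_⟩
  rintro y ⟨hy1, hy2⟩
  obtain ⟨w, hw1, hw2, hw3⟩ := h y ((mem_flatHyperplane_iff he).1 hy2) (by
    rw [S.chart_self z hz, sub_zero]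
    exact (mem_ball_zero_iff.1 hy1).trans_le (min_le_left _ _))
  exact ⟨w, ⟨hw1, hw2⟩, hw3⟩

/-- Away from its boundary, a hypersurface covers discs of a definite size in its charts. -/
theorem exists_mem_of_norm_lt {e d : Fin N} (he : (e : ℕ) + 1 = N) (hde : d ≠ e)
    (hr : 0 < r) (hL : 0 < L) {x : Rn N} (hx : x ∈ S.carrier) {ρ : ℝ} (hρ : 0 < ρ) (hρr : ρ ≤ r)
    (hb : ∀ y ∈ S.boundary, ρ ≤ dist x y) {y : Rn N} (hye : y e = 0) (hy : ‖y‖ < ρ / L) :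
    ∃ w ∈ S.carrier, w ∈ Metric.ball x r ∧ S.chart x w = y := by
  have hN : Module.finrank ℝ (Rn N) ≠ 0 := by
    rw [finrank_euclideanSpace_fin]; omega
  have hΦ := (S.biLipOn hx).mono (Metric.ball_subset_ball hρr)
  have hsub := Metric.ball_subset_ball (x := x) hρr
  set Φ := S.chart x with hΦdef
  have hball : Metric.ball 0 (ρ / L) ⊆ Φ '' Metric.ball x ρ := by
    have := (ball_subset_image_of_biLipschitz hN hL hΦ).2
    rwa [show Φ x = 0 from S.chart_self x hx] at this
  set g := Function.invFunOn Φ (Metric.ball x ρ) with hg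
  have hg1 : ∀ y ∈ Metric.ball (0 : Rn N) (ρ / L), g y ∈ Metric.ball x ρ ∧ Φ (g y) = y :=
    fun y hy => ⟨Function.invFunOn_mem (hball hy), Function.invFunOn_eq (hball hy)⟩
  have hgl : ∀ y₁ ∈ Metric.ball (0 : Rn N) (ρ / L), ∀ y₂ ∈ Metric.ball (0 : Rn N) (ρ / L),
      ‖g y₁ - g y₂‖ ≤ L * ‖y₁ - y₂‖ := by
    intro y₁ h₁ y₂ h₂
    have := hΦ.norm_le hL (hg1 y₁ h₁).1 (hg1 y₂ h₂).1
    rwa [(hg1 y₁ h₁).2, (hg1 y₂ h₂).2] at this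
  have hgc : ContinuousOn g (Metric.ball 0 (ρ / L)) :=
    (LipschitzOnWith.of_dist_le_mul (K := L.toNNReal) fun y₁ h₁ y₂ h₂ => by
      rw [Real.coe_toNNReal _ hL.le, dist_eq_norm, dist_eq_norm]
      exact hgl y₁ h₁ y₂ h₂).continuousOn
  -- On the connected disc P, the set of y with g y in the hypersurface is closed by compactness and
  -- contains 0. It is open because g y lies within ρ of x, hence off the boundary, and an interior
  -- point has a whole disc around it. So it is all of P.
  set P : Set (Rn N) := {y | y e = 0} ∩ Metric.ball 0 (ρ / L) with hP
  have hPc : IsPreconnected P := by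
    refine (Convex.inter ?_ (convex_ball _ _)).isPreconnected
    intro a ha b hb s t _ _ _
    simp only [Set.mem_ofPred_eq] at ha hb ⊢
    simp [ha, hb]
  have hclosed : ∃ Z, IsClosed Z ∧ P ∩ g ⁻¹' S.carrier = P ∩ Z := by
    obtain ⟨Z, hZ, hZe⟩ := continuousOn_iff_isClosed.1 (hgc.mono (Set.inter_subset_right :
      P ⊆ _)) S.carrier S.isCompact.isClosed
    exact ⟨Z, hZ, by rw [Set.inter_comm, hZe, Set.inter_comm]⟩
  obtain ⟨Z, hZ, hZe⟩ := hclosed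
  have hopen : ∃ U, IsOpen U ∧ P ∩ U = P ∩ g ⁻¹' S.carrier := by
    refine ⟨⋃ p ∈ P ∩ g ⁻¹' S.carrier, {q | ∃ δ, dist q p < δ ∧
      ∀ q', dist q' p < δ → q' ∈ P → g q' ∈ S.carrier}, ?_, ?_⟩
    · refine isOpen_biUnion fun p _ => ?_
      rw [Metric.isOpen_iff]
      rintro q ⟨δ, hδ, h⟩
      refine ⟨δ - dist q p, sub_pos.2 hδ, fun q' hq' => ⟨δ, ?_, h⟩⟩
      have := dist_triangle q' q p
      rw [Metric.mem_ball] at hq'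
      linarith
    · ext q
      constructor
      · rintro ⟨hqP, hq⟩
        simp only [Set.mem_iUnion] at hq
        obtain ⟨p, _, δ, hδ, h⟩ := hq
        exact ⟨hqP, h q hδ hqP⟩
      · rintro ⟨hqP, hq⟩
        refine ⟨hqP, ?_⟩
        simp only [Set.mem_iUnion]
        have hgq := hg1 q hqP.2
        have hgb : g q ∉ S.boundary := fun h => by
          have h1 := hb _ h
          have h2 := Metric.mem_ball.1 hgq.1
          rw [dist_comm] at h2; linarith
        obtain ⟨δ, hδ, h⟩ := S.exists_disc_of_notMem_boundary he hde hr hL hx hq (hsub hgq.1) hgb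
        refine ⟨q, ⟨hqP, hq⟩, δ, by simpa using hδ, fun q' hq' hq'P => ?_⟩
        obtain ⟨w, hw1, hw2, hw3⟩ := h q' hq'P.1 (by
          rw [← hΦdef, hgq.2, ← dist_eq_norm]; exact hq')
        have hgq' := hg1 q' hq'P.2
        have : g q' = w := (S.biLipOn hx).injOn hL (hsub hgq'.1) hw2 (hgq'.2.trans hw3.symm)
        rw [this]; exact hw1
  obtain ⟨U, hU, hUe⟩ := hopen
  have h0P : (0 : Rn N) ∈ P := ⟨by simp, Metric.mem_ball_self (by positivity)⟩
  have h0 : (0 : Rn N) ∈ P ∩ g ⁻¹' S.carrier := by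
    refine ⟨h0P, ?_⟩
    have h1 := hg1 0 h0P.2
    have : g 0 = x := hΦ.injOn hL h1.1 (Metric.mem_ball_self hρ) (by
      rw [h1.2, hΦdef, S.chart_self x hx])
    rw [Set.mem_preimage, this]; exact hx
  have hall : P ⊆ g ⁻¹' S.carrier := by
    intro q hq
    by_contra hqn
    have hqZ : q ∉ Z := fun h => hqn (hZe.symm ▸ (⟨hq, h⟩ : q ∈ P ∩ Z) : q ∈ P ∩ g ⁻¹' S.carrier).2
    obtain ⟨p, hpP, hpU, hpZ⟩ := hPc U Zᶜ hU hZ.isOpen_compl (fun p hp => by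
      by_cases hpZ : p ∈ Z
      · have : p ∈ P ∩ g ⁻¹' S.carrier := hZe.symm ▸ (⟨hp, hpZ⟩ : p ∈ P ∩ Z)
        exact Or.inl (hUe.symm ▸ this : p ∈ P ∩ U).2
      · exact Or.inr hpZ) ⟨0, h0P, (hUe.symm ▸ h0 : (0 : Rn N) ∈ P ∩ U).2⟩ ⟨q, hq, hqZ⟩
    have : p ∈ P ∩ g ⁻¹' S.carrier := hUe ▸ (⟨hpP, hpU⟩ : p ∈ P ∩ U)
    rw [hZe] at this
    exact hpZ this.2
  have hyP : y ∈ P := ⟨hye, by simpa using hy⟩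
  exact ⟨g y, hall hyP, hsub (hg1 y hyP.2).1, (hg1 y hyP.2).2⟩

/-- Two distinct points of the ball of a chart already force L⁻¹ ≤ L. -/
theorem one_le (hr : 0 < r) (hL : 0 < L) (hN : 2 ≤ N) {x : Rn N} (hx : x ∈ S.carrier) :
    1 ≤ L := by
  set z : Rn N := x + EuclideanSpace.single (⟨0, by omega⟩ : Fin N) (r / 2) with hz
  have hzx : ‖z - x‖ = r / 2 := by
    rw [hz, add_sub_cancel_left]; simp [abs_of_pos hr]
  have h := S.biLipschitz x hx z (by rw [Metric.mem_ball, dist_eq_norm, hzx]; linarith) x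
    (Metric.mem_ball_self hr)
  rw [hzx] at h
  have h1 : L⁻¹ * (r / 2) ≤ L * (r / 2) := h.1.trans h.2
  have h2 : L⁻¹ ≤ L := le_of_mul_le_mul_right h1 (by positivity)
  by_contra hlt
  push Not at hlt
  have := (one_lt_inv₀ hL).2 hlt
  linarith

/-- In the chart of a boundary point, the boundary is contained in a subspace of
codimension two. -/
theorem chart_boundary_eq_zero {e d : Fin N} (he : (e : ℕ) + 1 = N) (hd : (d : ℕ) + 2 = N)
    (hde : d ≠ e) (hr : 0 < r) (hL : 0 < L) {x z : Rn N} (hx : x ∈ S.boundary)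
    (hz : z ∈ S.boundary) (hzx : z ∈ Metric.ball x r) : S.chart x z d = 0 := by
  have hN : Module.finrank ℝ (Rn N) ≠ 0 := by
    rw [finrank_euclideanSpace_fin]; omega
  have himg := S.image_of_boundary x hx.1 hx.2
  have hmem : S.chart x z ∈ S.chart x '' Metric.ball x r ∩ flatHalfHyperplane N :=
    himg ▸ ⟨z, ⟨hz.1, hzx⟩, rfl⟩
  have hopen := (ball_subset_image_of_biLipschitz hN hL (S.biLipOn hx.1)).1
  -- With positive d-coordinate, a small disc of the hyperplane lies in the half-hyperplane and in
  -- the open image of the chart. The point would be interior in this chart, hence in its own.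
  by_contra hne
  have hpos : 0 < S.chart x z d :=
    lt_of_le_of_ne ((mem_flatHalfHyperplane_iff he hd).1 hmem.2).2 (Ne.symm hne)
  obtain ⟨δ, hδ, hδs⟩ := Metric.isOpen_iff.1 hopen _ hmem.1
  refine S.notMem_boundary_of_disc he hde hr hL hx.1 hz.1 hzx (lt_min hδ hpos)
    (fun y hye hy => ?_) hz
  have h1 : y ∈ S.chart x '' (S.carrier ∩ Metric.ball x r) := by
    rw [himg]
    refine ⟨hδs ?_, (mem_flatHalfHyperplane_iff he hd).2 ⟨hye, ?_⟩⟩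
    · rw [Metric.mem_ball, dist_eq_norm]; exact hy.trans_le (min_le_left _ _)
    · have h2 := (PiLp.norm_apply_le (y - S.chart x z) d).trans (hy.le.trans (min_le_right _ _))
      rw [PiLp.sub_apply, Real.norm_eq_abs] at h2
      linarith [(abs_le.1 h2).1]
  obtain ⟨w, ⟨hw1, hw2⟩, hw3⟩ := h1
  exact ⟨w, hw1, hw2, hw3⟩

/-- A hypersurface with nonempty boundary has points far from its boundary. -/
theorem exists_far_from_boundary (hN : 2 ≤ N) (hr : 0 < r) (hL : 0 < L)
    (hne : S.boundary.Nonempty) :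
    ∃ y ∈ S.carrier, ∀ w ∈ S.boundary, r / (2 * L ^ 2) ≤ dist y w := by
  obtain ⟨e, d, he, hd, hde⟩ := exists_last_two hN
  obtain ⟨x, hx⟩ := hne
  have hL1 := S.one_le hr hL hN hx.1
  have hfin : Module.finrank ℝ (Rn N) ≠ 0 := by
    rw [finrank_euclideanSpace_fin]; omega
  have himg := S.image_of_boundary x hx.1 hx.2
  have hball := (ball_subset_image_of_biLipschitz hfin hL (S.biLipOn hx.1)).2
  rw [S.chart_self x hx.1] at hball
  -- The point at depth r/(2L) in the half-hyperplane. Boundary points in the ball have d-coordinate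
  -- 0 in the chart, so they are at distance at least r/(2L²) from its preimage; those outside the
  -- ball are at distance at least r/2.
  set p : Rn N := EuclideanSpace.single d (r / (2 * L)) with hp
  have hpn : ‖p‖ = r / (2 * L) := by
    simp [hp, abs_of_pos hr, abs_of_pos hL]
  have hlt : r / (2 * L) < r / L := by
    apply div_lt_div_of_pos_left hr hL; linarith
  have hp1 : p ∈ S.chart x '' (S.carrier ∩ Metric.ball x r) := by
    rw [himg]
    refine ⟨hball (by rw [mem_ball_zero_iff, hpn]; exact hlt),
      (mem_flatHalfHyperplane_iff he hd).2 ⟨by simp [hp, hde.symm], ?_⟩⟩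
    simp [hp]; positivity
  obtain ⟨y, ⟨hy1, hy2⟩, hyp⟩ := hp1
  refine ⟨y, hy1, fun w hw => ?_⟩
  by_cases hwx : w ∈ Metric.ball x r
  · have h1 := S.chart_boundary_eq_zero he hd hde hr hL hx hw hwx
    have h2 := PiLp.norm_apply_le (S.chart x y - S.chart x w) d
    rw [PiLp.sub_apply, h1, hyp, sub_zero, ← hyp] at h2
    have h3 := (S.biLipschitz x hx.1 y hy2 w hwx).2
    have h4 : ‖S.chart x y d‖ = r / (2 * L) := by
      rw [hyp]; simp [hp, abs_of_pos hr, abs_of_pos hL]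
    rw [h4] at h2
    rw [dist_eq_norm, div_le_iff₀ (by positivity)]
    have h5 := h2.trans h3
    rw [div_le_iff₀ (by positivity)] at h5
    linarith [show L * ‖y - w‖ * (2 * L) = ‖y - w‖ * (2 * L ^ 2) by ring]
  · have h1 := (S.biLipOn hx.1).norm_le hL hy2 (Metric.mem_ball_self hr)
    rw [S.chart_self x hx.1, hyp, sub_zero, hpn, ← dist_eq_norm] at h1
    have h2 : L * (r / (2 * L)) = r / 2 := by field_simp
    have h3 : r ≤ dist w x := by simpa using hwx
    have h4 := dist_triangle w y x
    rw [dist_comm w y] at h4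
    have h5 : r / (2 * L ^ 2) ≤ r / 2 := by
      apply div_le_div_of_nonneg_left hr.le (by norm_num)
      linarith [one_le_pow₀ hL1 (n := 2)]
    linarith

/-- Finitely many charts suffice, and in each the hypersurface lies in the bi-Lipschitz preimage of
a hyperplane. -/
theorem volume_carrier (hN : 2 ≤ N) (hr : 0 < r) (hL : 0 < L) : volume S.carrier = 0 := by
  obtain ⟨e, d, he, hd, hde⟩ := exists_last_two hN
  obtain ⟨t, ht, htS⟩ := S.isCompact.elim_nhds_subcover (fun x => Metric.ball x r)
    fun x _ => Metric.ball_mem_nhds x hr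
  have hflat : volume {y : Rn N | y e = 0} = 0 := by
    have h := Measure.addHaar_submodule (volume : Measure (Rn N))
      (LinearMap.ker (EuclideanSpace.proj e : Rn N →L[ℝ] ℝ).toLinearMap) (fun h => by
        have h1 : (EuclideanSpace.single e (1 : ℝ) : Rn N) ∈
          LinearMap.ker (EuclideanSpace.proj e : Rn N →L[ℝ] ℝ).toLinearMap := by rw [h]; trivial
        simp at h1)
    convert h using 2
    ext y
    simp
  refine measure_mono_null (t := ⋃ x ∈ t, S.carrier ∩ Metric.ball x r) (fun y hy => ?_) ?_
  · obtain ⟨x, hx, hyx⟩ := Set.mem_iUnion₂.1 (htS hy)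
    exact Set.mem_iUnion₂.2 ⟨x, hx, hy, hyx⟩
  · refine (measure_biUnion_null_iff t.countable_toSet).2 fun x hx => ?_
    have h := volume_inter_preimage_le (f := S.chart x) (U := Metric.ball x r) (L := L.toNNReal)
      (s := {y | y e = 0}) fun z hz z' hz' => by
        rw [Real.coe_toNNReal _ hL.le, dist_eq_norm, dist_eq_norm]
        exact (S.biLipOn (ht x hx)).norm_le hL hz hz'
    rw [hflat, mul_zero] at h
    refine measure_mono_null ?_ (le_antisymm h bot_le)
    rintro z ⟨hz, hzx⟩
    exact ⟨hzx, S.chart_eq_zero he (ht x hx) hz hzx⟩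

end LipschitzHypersurface

end Hypersurface

/-! ### Volume of neighbourhoods of the boundaries -/

section Packing

open scoped NNReal ENNReal

variable {N : ℕ}

/-- Subsets of a ball are covered by boundedly many balls centred at their points. -/
theorem exists_card_cover (R : ℝ) {σ : ℝ} (hσ : 0 < σ) :
    ∃ m : ℕ, ∀ B ⊆ Metric.closedBall (0 : Rn N) R, ∃ t : Finset (Rn N), (t : Set (Rn N)) ⊆ B ∧
      t.card ≤ m ∧ ∀ x ∈ B, ∃ c ∈ t, dist x c < σ := by
  classical
  obtain ⟨u, -, huf, hu⟩ := (isCompact_closedBall (0 : Rn N) R).finite_cover_balls (half_pos hσ)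
  refine ⟨huf.toFinset.card, fun B hB => ?_⟩
  have hex : ∀ c : Rn N, ∃ p, (∃ q ∈ B, dist q c < σ / 2) → p ∈ B ∧ dist p c < σ / 2 := by
    intro c
    by_cases h : ∃ q ∈ B, dist q c < σ / 2
    · obtain ⟨q, hq⟩ := h; exact ⟨q, fun _ => hq⟩
    · exact ⟨0, fun h' => absurd h' h⟩
  choose p hp using hex
  refine ⟨(huf.toFinset.filter fun c => ∃ q ∈ B, dist q c < σ / 2).image p, ?_, ?_, ?_⟩
  · intro x hx
    simp only [Finset.coe_image, Finset.coe_filter, Set.mem_image, Set.mem_ofPred_eq] at hx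
    obtain ⟨c, ⟨-, hc⟩, rfl⟩ := hx
    exact (hp c hc).1
  · exact Finset.card_image_le.trans (Finset.card_filter_le _ _)
  · intro x hx
    obtain ⟨c, hc, hxc⟩ := Set.mem_iUnion₂.1 (hu (hB hx))
    have hc' : ∃ q ∈ B, dist q c < σ / 2 := ⟨x, hx, hxc⟩
    refine ⟨p c, Finset.mem_image.2 ⟨c, Finset.mem_filter.2 ⟨huf.mem_toFinset.2 hc, hc'⟩, rfl⟩, ?_⟩
    have := dist_triangle x c (p c)
    rw [dist_comm c] at this
    linarith [(hp c hc').2, Metric.mem_ball.1 hxc]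

/-- Separated families in a ball have bounded cardinality. -/
theorem exists_card_separated_le (R : ℝ) {σ : ℝ} (hσ : 0 < σ) :
    ∃ m : ℕ, ∀ {ι : Type} (t : Finset ι) (f : ι → Rn N),
      (∀ i ∈ t, f i ∈ Metric.closedBall (0 : Rn N) R) →
      (∀ i ∈ t, ∀ j ∈ t, i ≠ j → σ ≤ dist (f i) (f j)) → t.card ≤ m := by
  obtain ⟨m, hm⟩ := exists_card_cover (N := N) R (half_pos hσ)
  refine ⟨m, fun t f hR hsep => ?_⟩
  obtain ⟨s, -, hs, hcov⟩ := hm _ (subset_refl _)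
  choose! c hc hfc using fun i (hi : i ∈ t) => hcov (f i) (hR i hi)
  refine (Finset.card_le_card_of_injOn c (fun i hi => hc i hi) fun i hi j hj hij => ?_).trans hs
  by_contra hne
  have h1 := hsep i hi j hj hne
  have h2 := dist_triangle (f i) (c i) (f j)
  have h3 := hfc i hi
  have h4 := hfc j hj
  rw [← hij, dist_comm] at h4
  linarith

theorem volume_box (b : Fin N → ℝ) :
    volume {y : Rn N | ∀ i, |y i| ≤ b i} = ∏ i, ENNReal.ofReal (2 * b i) := by
  have h := (PiLp.volume_preserving_ofLp (Fin N)).measure_preimage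
    (s := Set.Icc (fun i => -b i) b) measurableSet_Icc.nullMeasurableSet
  rw [Real.volume_Icc_pi] at h
  convert h using 1
  · congr 1
    ext y
    simp only [Set.mem_ofPred_eq, Set.mem_preimage, Set.mem_Icc, Pi.le_def, abs_le]
    exact forall_and
  · refine Finset.prod_congr rfl fun i _ => ?_
    congr 1; ring

/-- The two thin directions produce the factor a ^ 2 on which the capacity argument depends. -/
theorem volume_thin_box {e d : Fin N} (hde : d ≠ e) (a b : ℝ) :
    volume {y : Rn N | |y e| ≤ a ∧ |y d| ≤ a ∧ ∀ i, |y i| ≤ b} ≤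
      ENNReal.ofReal (2 * a) ^ 2 * ENNReal.ofReal (2 * b) ^ (N - 2) := by
  classical
  refine (measure_mono (t := {y : Rn N | ∀ i, |y i| ≤ if i = e ∨ i = d then a else b}) ?_).trans ?_
  · rintro y ⟨h1, h2, h3⟩ i
    split_ifs with h
    · rcases h with rfl | rfl
      · exact h1
      · exact h2
    · exact h3 i
  · rw [volume_box]
    simp only [mul_ite, apply_ite ENNReal.ofReal]
    rw [Finset.prod_ite, Finset.prod_const, Finset.prod_const]
    have h1 : (Finset.univ.filter fun i : Fin N => i = e ∨ i = d) = {e, d} := by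
      ext i; simp
    have h2 : (Finset.univ.filter fun i : Fin N => ¬ (i = e ∨ i = d)) = {e, d}ᶜ := by
      ext i; simp
    rw [h1, h2, Finset.card_compl, Finset.card_pair hde.symm, Fintype.card_fin]

/-- The neighbourhoods of the boundary of a hypersurface have small volume. -/
theorem exists_volume_boundary_le (hN : 2 ≤ N) {r L : ℝ} (hr : 0 < r) (hL : 0 < L) (R : ℝ) :
    ∃ A : ℝ≥0∞, A ≠ ∞ ∧ ∀ S : LipschitzHypersurface N r L, S.carrier ⊆ Metric.closedBall 0 R →
      ∀ ε, 0 < ε → ε ≤ r / 4 →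
        volume {x | ∃ w ∈ S.boundary, dist x w < ε} ≤ A * ENNReal.ofReal ε ^ 2 := by
  obtain ⟨e, d, he, hd, hde⟩ := exists_last_two hN
  obtain ⟨m, hm⟩ := exists_card_cover (N := N) R (σ := r / 4) (by positivity)
  -- In a chart centred at a boundary point, the ε-neighbourhood of the nearby boundary lies in a
  -- box with two half-sides Lε and the others Lr; the first factor is the distortion of volume by
  -- the inverse chart.
  set A₁ : ℝ≥0∞ := (L.toNNReal : ℝ≥0∞) ^ Module.finrank ℝ (Rn N) * (ENNReal.ofReal (2 * L) ^ 2 *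
    ENNReal.ofReal (2 * (L * r)) ^ (N - 2)) with hA₁
  have hA₁t : A₁ ≠ ∞ := ENNReal.mul_ne_top (ENNReal.pow_ne_top ENNReal.coe_ne_top)
    (ENNReal.mul_ne_top (ENNReal.pow_ne_top ENNReal.ofReal_ne_top)
      (ENNReal.pow_ne_top ENNReal.ofReal_ne_top))
  refine ⟨m * A₁, ENNReal.mul_ne_top (ENNReal.natCast_ne_top m) hA₁t, fun S hS ε hε hεr => ?_⟩
  obtain ⟨t, htB, htm, hcov⟩ := hm S.boundary fun x hx => hS hx.1
  have hpiece : ∀ c ∈ t, volume {x | ∃ w ∈ S.boundary, dist w c < r / 4 ∧ dist x w < ε} ≤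
      A₁ * ENNReal.ofReal ε ^ 2 := by
    intro c hc
    have hcb := htB hc
    have hΦ := S.biLipOn hcb.1
    have hsub : {x | ∃ w ∈ S.boundary, dist w c < r / 4 ∧ dist x w < ε} ⊆
        Metric.ball c r ∩ S.chart c ⁻¹' {y : Rn N | |y e| ≤ L * ε ∧ |y d| ≤ L * ε ∧
          ∀ i, |y i| ≤ L * r} := by
      rintro x ⟨w, hw, hwc, hxw⟩
      have hwb : w ∈ Metric.ball c r := Metric.mem_ball.2 (by linarith)
      have hxb : x ∈ Metric.ball c r := Metric.mem_ball.2 (by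
        have := dist_triangle x w c
        linarith)
      have hd0 := S.chart_boundary_eq_zero he hd hde hr hL hcb hw hwb
      have he0 := S.chart_eq_zero he hcb.1 hw.1 hwb
      have h1 := (hΦ x hxb w hwb).2
      rw [← dist_eq_norm x w] at h1
      have h2 : ∀ i, |S.chart c x i - S.chart c w i| ≤ L * ε := fun i =>
        (PiLp.norm_apply_le (S.chart c x - S.chart c w) i).trans
          (h1.trans (mul_le_mul_of_nonneg_left hxw.le hL.le))
      refine ⟨hxb, ?_, ?_, fun i => ?_⟩
      · simpa [he0] using h2 e
      · simpa [hd0] using h2 d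
      · have h3 := (hΦ x hxb c (Metric.mem_ball_self hr)).2
        rw [S.chart_self c hcb.1, sub_zero, ← dist_eq_norm] at h3
        exact (PiLp.norm_apply_le (S.chart c x) i).trans
          (h3.trans (mul_le_mul_of_nonneg_left (Metric.mem_ball.1 hxb).le hL.le))
    refine (measure_mono hsub).trans ((volume_inter_preimage_le (L := L.toNNReal)
      fun z hz z' hz' => ?_).trans ?_)
    · rw [Real.coe_toNNReal _ hL.le, dist_eq_norm, dist_eq_norm]
      exact hΦ.norm_le hL hz hz'
    · rw [hA₁, mul_assoc]
      refine mul_le_mul_right ((volume_thin_box hde (L * ε) (L * r)).trans (le_of_eq ?_)) _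
      rw [show 2 * (L * ε) = (2 * L) * ε by ring, ENNReal.ofReal_mul (by positivity), mul_pow]
      ring
  calc volume {x | ∃ w ∈ S.boundary, dist x w < ε}
      ≤ volume (⋃ c ∈ t, {x | ∃ w ∈ S.boundary, dist w c < r / 4 ∧ dist x w < ε}) := by
        refine measure_mono ?_
        rintro x ⟨w, hw, hxw⟩
        obtain ⟨c, hc, hwc⟩ := hcov w hw
        exact Set.mem_iUnion₂.2 ⟨c, hc, w, hw, hwc, hxw⟩
    _ ≤ ∑ c ∈ t, volume {x | ∃ w ∈ S.boundary, dist w c < r / 4 ∧ dist x w < ε} :=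
        measure_biUnion_finset_le _ _
    _ ≤ ∑ _c ∈ t, A₁ * ENNReal.ofReal ε ^ 2 := Finset.sum_le_sum hpiece
    _ = t.card * (A₁ * ENNReal.ofReal ε ^ 2) := by rw [Finset.sum_const, nsmul_eq_mul]
    _ ≤ m * A₁ * ENNReal.ofReal ε ^ 2 := by
        rw [← mul_assoc]
        exact mul_le_mul_left (mul_le_mul_left (by exact_mod_cast htm) _) _

/-- The separation condition in the definition of `BTilde`. -/
def IsSeparated {r L : ℝ} (ω : ℝ → ℝ) (Ω : Set (Rn N)) {M : ℕ}
    (S : Fin M → LipschitzHypersurface N r L) : Prop :=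
  ∀ i, ∀ x ∈ (S i).carrier, 0 < (S i).distBoundary Ω x →
    ∀ j, j ≠ i → ∀ y ∈ (S j).carrier, ω ((S i).distBoundary Ω x) ≤ dist x y

theorem LipschitzHypersurface.le_distBoundary {r L : ℝ} (S : LipschitzHypersurface N r L)
    {Ω : Set (Rn N)} {x : Rn N} {δ : ℝ} (hδ : δ ≤ Metric.diam Ω)
    (h : ∀ w ∈ S.boundary, δ ≤ dist x w) : δ ≤ S.distBoundary Ω x := by
  unfold LipschitzHypersurface.distBoundary
  split_ifs with hne
  · exact (Metric.le_infDist hne).2 fun {y} hy => h y hy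
  · exact hδ

/-- The neighbourhoods of the singular set of a separated family of hypersurfaces have small
volume, uniformly with respect to the family. -/
theorem exists_volume_singular_le (hN : 2 ≤ N) {r L : ℝ} (hr : 0 < r) (hL : 0 < L)
    {Ω : Set (Rn N)} (hΩb : Bornology.IsBounded Ω) {ω : ℝ → ℝ} (hω_pos : ∀ t, 0 < t → 0 < ω t)
    (hω_mono : MonotoneOn ω (Set.Ioi 0)) :
    ∃ A : ℝ≥0∞, A ≠ ∞ ∧ ∀ (M : ℕ) (S : Fin M → LipschitzHypersurface N r L),
      (∀ i, (S i).carrier ⊆ closure Ω) → IsSeparated ω Ω S → ∀ ε, 0 < ε → ε ≤ r / 4 →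
        volume {x | ∃ i, ∃ w ∈ (S i).boundary, dist x w < ε} ≤ A * ENNReal.ofReal ε ^ 2 := by
  classical
  obtain ⟨R, hR⟩ := hΩb.closure.subset_closedBall (0 : Rn N)
  obtain ⟨A, hA, hvol⟩ := exists_volume_boundary_le hN hr hL R
  set δ := r / (2 * L ^ 2) with hδ
  have hδ0 : 0 < δ := by positivity
  obtain ⟨m, hm⟩ := exists_card_separated_le (N := N) R (hω_pos δ hδ0)
  refine ⟨m * A, ENNReal.mul_ne_top (ENNReal.natCast_ne_top m) hA, fun M S hS hsep ε hε hεr => ?_⟩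
  -- Only members with nonempty boundary count. Each has a point at distance at least δ from its own
  -- boundary, so these points are ω(δ) apart, and their number is bounded independently of M.
  set t : Finset (Fin M) := Finset.univ.filter fun i => (S i).boundary.Nonempty with ht
  have hfar : ∀ i ∈ t, ∃ y ∈ (S i).carrier, ∀ w ∈ (S i).boundary, δ ≤ dist y w := fun i hi =>
    (S i).exists_far_from_boundary hN hr hL (Finset.mem_filter.1 hi).2
  choose! y hy hyw using hfar
  have hcard : t.card ≤ m := by
    refine hm t y (fun i hi => hR (hS i (hy i hi))) fun i hi j hj hij => ?_
    have h1 : δ ≤ (S i).distBoundary Ω (y i) := by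
      rw [LipschitzHypersurface.distBoundary, if_pos (Finset.mem_filter.1 hi).2]
      exact (Metric.le_infDist (Finset.mem_filter.1 hi).2).2 fun {w} hw => hyw i hi w hw
    exact (hω_mono hδ0 (hδ0.trans_le h1) h1).trans
      (hsep i (y i) (hy i hi) (hδ0.trans_le h1) j hij.symm (y j) (hy j hj))
  calc volume {x | ∃ i, ∃ w ∈ (S i).boundary, dist x w < ε}
      ≤ volume (⋃ i ∈ t, {x | ∃ w ∈ (S i).boundary, dist x w < ε}) := by
        refine measure_mono ?_
        rintro x ⟨i, w, hw, hxw⟩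
        exact Set.mem_iUnion₂.2 ⟨i, Finset.mem_filter.2 ⟨Finset.mem_univ _, w, hw⟩, w, hw, hxw⟩
    _ ≤ ∑ i ∈ t, volume {x | ∃ w ∈ (S i).boundary, dist x w < ε} :=
        measure_biUnion_finset_le _ _
    _ ≤ ∑ _i ∈ t, A * ENNReal.ofReal ε ^ 2 :=
        Finset.sum_le_sum fun i _ => hvol (S i) ((hS i).trans hR) ε hε hεr
    _ = t.card * (A * ENNReal.ofReal ε ^ 2) := by rw [Finset.sum_const, nsmul_eq_mul]
    _ ≤ m * A * ENNReal.ofReal ε ^ 2 := by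
        rw [mul_assoc]
        gcongr

end Packing

/-! ### Local approximation near a point away from the boundaries -/

section Local

open scoped NNReal ENNReal

/-- The vectors approximated by the subspaces `W n` along the filter `l`. -/
def approximable {H : Type*} [NormedAddCommGroup H] [NormedSpace ℝ H] (l : Filter ℕ)
    (W : ℕ → Submodule ℝ H) : Submodule ℝ H where
  carrier := {x | ∀ ε > 0, ∀ᶠ n in l, ∃ y ∈ W n, ‖x - y‖ < ε}
  zero_mem' := fun ε hε => Eventually.of_forall fun n => ⟨0, (W n).zero_mem, by simpa using hε⟩
  add_mem' := by
    intro x x' hx hx' ε hε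
    filter_upwards [hx (ε / 2) (half_pos hε), hx' (ε / 2) (half_pos hε)] with n h h'
    obtain ⟨y, hy, hxy⟩ := h
    obtain ⟨y', hy', hxy'⟩ := h'
    refine ⟨y + y', (W n).add_mem hy hy', ?_⟩
    rw [add_sub_add_comm]
    exact (norm_add_le _ _).trans_lt (by linarith)
  smul_mem' := by
    intro c x hx ε hε
    filter_upwards [hx (ε / (|c| + 1)) (by positivity)] with n h
    obtain ⟨y, hy, hxy⟩ := h
    refine ⟨c • y, (W n).smul_mem c hy, ?_⟩
    rw [← smul_sub, norm_smul, Real.norm_eq_abs]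
    rw [lt_div_iff₀ (by positivity)] at hxy
    nlinarith [norm_nonneg (x - y)]

theorem mem_approximable {H : Type*} [NormedAddCommGroup H] [NormedSpace ℝ H] {l : Filter ℕ}
    {W : ℕ → Submodule ℝ H} {x : H} :
    x ∈ approximable l W ↔ ∀ ε > 0, ∀ᶠ n in l, ∃ y ∈ W n, ‖x - y‖ < ε := Iff.rfl

/-- A closed subspace is weakly closed; for this reason bounded sequences of approximable fields
with the right weak limit will be enough. -/
theorem isClosed_approximable {H : Type*} [NormedAddCommGroup H] [NormedSpace ℝ H] (l : Filter ℕ)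
    (W : ℕ → Submodule ℝ H) : IsClosed (approximable l W : Set H) := by
  refine isClosed_of_closure_subset fun x hx ε hε => ?_
  obtain ⟨x', hx', hd⟩ := Metric.mem_closure_iff.1 hx (ε / 2) (half_pos hε)
  rw [dist_eq_norm] at hd
  filter_upwards [hx' (ε / 2) (half_pos hε)] with n h
  obtain ⟨y, hy, hxy⟩ := h
  refine ⟨y, hy, ?_⟩
  have := norm_add_le (x - x') (x' - y)
  rw [sub_add_sub_cancel] at this
  linarith

variable {N : ℕ}

/-- A Sobolev field supported away from the singular set has no singular set. -/
theorem mem_sobolev_empty_of_support {C : Set (Rn N)} {F : L2Field N} (hF : F ∈ sobolev C)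
    {U Q : Set (Rn N)} (hU : IsOpen U) (hQ : IsCompact Q) (hQU : Q ⊆ U) (hUC : Disjoint U C)
    (hF0 : ∀ᵐ x, x ∉ Q → F x = 0) : F ∈ sobolev (∅ : Set (Rn N)) := by
  obtain ⟨χ, hχ, hχc, hχs, hχ01, hχ1⟩ := exists_smooth_cutoff hQ hU hQU
  obtain ⟨M, hM⟩ : ∃ M, ∀ x, ‖fderiv ℝ χ x‖ ≤ M :=
    (hχ.continuous_fderiv (by simp)).bounded_above_of_compact_support (hχc.fderiv (𝕜 := ℝ))
  have hMi : ∀ x i, |partialDeriv i χ x| ≤ M := fun x i => by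
    refine ((fderiv ℝ χ x).le_opNorm _).trans ?_
    simpa using hM x
  obtain ⟨G, hG, hG0, hGs⟩ := exists_mul_mem_sobolev (C := C) (C' := ∅) (ζ := χ)
    hχ.continuous.measurable (fun x _ => hχ.contDiffAt)
    (by rw [(hUC.mono_left hχs).inter_eq]) (M := max 1 M)
    (ae_of_all _ fun x => ⟨le_max_of_le_left (by
      rw [abs_of_nonneg (hχ01 x).1]; exact (hχ01 x).2), fun i => le_max_of_le_right (hMi x i)⟩) hF
  have hd : ∀ x ∈ Q, ∀ i, partialDeriv i χ x = 0 := fun x hx i => by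
    rw [partialDeriv, (show χ =ᶠ[𝓝 x] fun _ => 1 from hχ1 x hx).fderiv_eq]; simp
  have : G = F := by
    refine field_ext ?_ fun i => ?_
    · filter_upwards [hG0, hF0] with x h0 hx
      by_cases hQx : x ∈ Q
      · rw [h0, (hχ1 x hQx).self_of_nhds, one_mul]
      · rw [h0, hx hQx]; simp
    · filter_upwards [hGs i, hF0] with x hs hx
      by_cases hQx : x ∈ Q
      · rw [hs, (hχ1 x hQx).self_of_nhds, hd x hQx]; simp
      · rw [hs, hx hQx]; simp
  rwa [← this]

/-- Small neighbourhoods of a bi-Lipschitz hypersurface have small volume. -/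
theorem tendsto_volume_near_flat {e : Fin N} {L : ℝ} (hL : 0 < L) {Φ : Rn N → Rn N}
    {Q : Set (Rn N)} (hQ : IsCompact Q) (hΦ : BiLipOn L Φ Q) :
    Tendsto (fun j : ℕ => volume {x | x ∈ Q ∧ |Φ x e| ≤ 1 / ((j : ℝ) + 1)}) atTop (𝓝 0) := by
  have hclosed : ∀ j : ℕ, IsClosed {x | x ∈ Q ∧ |Φ x e| ≤ 1 / ((j : ℝ) + 1)} := fun j =>
    (hΦ.continuousOn hL).preimage_isClosed_of_isClosed hQ.isClosed
      (t := {y : Rn N | |y e| ≤ 1 / ((j : ℝ) + 1)})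
      (isClosed_le (by fun_prop) continuous_const)
  have h := tendsto_measure_iInter_atTop (μ := volume)
    (s := fun j : ℕ => {x | x ∈ Q ∧ |Φ x e| ≤ 1 / ((j : ℝ) + 1)})
    (fun j => (hclosed j).measurableSet.nullMeasurableSet)
    (fun i j hij x hx => ⟨hx.1, hx.2.trans (one_div_le_one_div_of_le (by positivity)
      (by gcongr))⟩)
    ⟨0, ((measure_mono fun x hx => hx.1).trans_lt hQ.measure_lt_top).ne⟩
  have hflat : volume {y : Rn N | y e = 0} = 0 := by
    have h := Measure.addHaar_submodule (volume : Measure (Rn N))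
      (LinearMap.ker (EuclideanSpace.proj e : Rn N →L[ℝ] ℝ).toLinearMap) (fun h => by
        have h1 : (EuclideanSpace.single e (1 : ℝ) : Rn N) ∈
          LinearMap.ker (EuclideanSpace.proj e : Rn N →L[ℝ] ℝ).toLinearMap := by rw [h]; trivial
        simp at h1)
    convert h using 2
    ext y
    simp
  have hzero : volume (⋂ j : ℕ, {x | x ∈ Q ∧ |Φ x e| ≤ 1 / ((j : ℝ) + 1)}) = 0 := by
    have h1 := volume_inter_preimage_le (f := Φ) (U := Q) (L := L.toNNReal)
      (s := {y | y e = 0}) fun z hz z' hz' => by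
        rw [Real.coe_toNNReal _ hL.le, dist_eq_norm, dist_eq_norm]
        exact hΦ.norm_le hL hz hz'
    rw [hflat, mul_zero] at h1
    refine measure_mono_null (fun x hx => ?_) (le_antisymm h1 bot_le)
    rw [Set.mem_iInter] at hx
    refine ⟨(hx 0).1, ?_⟩
    have := ge_of_tendsto' (tendsto_one_div_add_atTop_nhds_zero_nat (𝕜 := ℝ)) fun j => (hx j).2
    exact abs_nonpos_iff.1 this
  rwa [hzero] at h

/-- Approximation of a Sobolev field supported near a point where the singular sets `Cn n` are
hypersurfaces which converge in the bi-Lipschitz sense. -/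
theorem mem_approximable_of_charts (e : Fin N) {l : Filter ℕ} {L : ℝ} (hL : 1 ≤ L)
    {C : Set (Rn N)} (hC : IsClosed C) {Cn : ℕ → Set (Rn N)} (hCn : ∀ n, volume (Cn n) = 0)
    {x₀ : Rn N} {s s' : ℝ} (hs' : 0 < s') (hss : L ^ 4 * s' < s)
    {Φ : Rn N → Rn N} {Φn : ℕ → Rn N → Rn N}
    (hΦ : BiLipOn L Φ (Metric.ball x₀ s)) (hΦ0 : Φ x₀ = 0)
    (hΦC : ∀ z ∈ C, z ∈ Metric.ball x₀ s → Φ z e = 0)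
    (hΦn : ∀ᶠ n in l, ContinuousOn (Φn n) (Metric.ball x₀ s) ∧
      ∀ z ∈ Metric.ball x₀ s, Φn n z e = 0 → z ∈ Cn n)
    (hunif : TendstoUniformlyOn Φn Φ l (Metric.closedBall x₀ (L ^ 2 * s')))
    {F : L2Field N} (hF : F ∈ sobolev C) (hF0 : ∀ᵐ x, x ∉ Metric.closedBall x₀ s' → F x = 0) :
    F ∈ approximable l fun n => sobolev (Cn n) := by
  have hL0 : 0 < L := zero_lt_one.trans_le hL
  obtain ⟨G, hG, H, hH, hG1, hG2, hH1, hH2⟩ :=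
    exists_two_reflections e hL hC hs' hss hΦ hΦ0 hΦC hF hF0
  set Q := Metric.closedBall x₀ (L ^ 2 * s') with hQ
  have hQs : Q ⊆ Metric.ball x₀ s := by
    refine Metric.closedBall_subset_ball (lt_of_le_of_lt ?_ hss)
    exact mul_le_mul_of_nonneg_right (pow_le_pow_right₀ hL (by norm_num)) hs'.le
  have hsQ : Metric.closedBall x₀ s' ⊆ Q := Metric.closedBall_subset_closedBall
    (le_mul_of_one_le_left hs'.le (one_le_pow₀ hL))
  have hQc : IsCompact Q := isCompact_closedBall _ _
  -- Dominates the error of the glued field. As k is in L², its norm is small on a sufficiently thin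
  -- layer T, fixed before n.
  set k : Rn N → ℝ := fun x => ‖F x‖ + ‖G x‖ + ‖H x‖ with hk
  have hkm : MemLp k 2 volume :=
    ((Lp.memLp F).norm.add (Lp.memLp G).norm).add (Lp.memLp H).norm
  rw [mem_approximable]
  intro ε hε
  obtain ⟨δ, hδ, hδk⟩ := hkm.eLpNorm_indicator_le (by norm_num) (by norm_num) (half_pos hε)
  obtain ⟨j, hj⟩ := ((ENNReal.tendsto_nhds_zero.1
    (tendsto_volume_near_flat (e := e) hL0 hQc (hΦ.mono hQs))) _
      (ENNReal.ofReal_pos.2 hδ)).exists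
  set η : ℝ := 1 / ((j : ℝ) + 1) with hη
  have hη0 : 0 < η := by positivity
  set T : Set (Rn N) := {x | x ∈ Q ∧ |Φ x e| ≤ η} with hT
  have hTm : MeasurableSet T := ((hΦ.mono hQs).continuousOn hL0).preimage_isClosed_of_isClosed
    hQc.isClosed (t := {y : Rn N | |y e| ≤ η}) (isClosed_le (by fun_prop) continuous_const)
    |>.measurableSet
  have hTk := hδk T hTm hj
  filter_upwards [hΦn, Metric.tendstoUniformlyOn_iff.1 hunif η hη0] with n hn hun
  obtain ⟨hcn, hCn'⟩ := hn
  have hopen : ∀ O : Set (Rn N), IsOpen O → IsOpen (Metric.ball x₀ s ∩ Φn n ⁻¹' O) := fun O hO =>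
    hcn.isOpen_inter_preimage Metric.isOpen_ball hO
  have hpos : IsOpen {y : Rn N | 0 < y e} := isOpen_lt continuous_const (by fun_prop)
  have hneg : IsOpen {y : Rn N | y e < 0} := isOpen_lt (by fun_prop) continuous_const
  have hside : ∀ x ∈ Metric.ball x₀ s, x ∉ Cn n → 0 < Φn n x e ∨ Φn n x e < 0 := fun x hx hxC =>
    (lt_or_gt_of_ne fun h => hxC (hCn' x hx h)).symm
  -- The upper extension is kept where the e-coordinate of Φn is positive, the lower one where it is
  -- negative. The interface is the zero set of that coordinate, contained in Cn.
  obtain ⟨G', hG', hGe⟩ := exists_indicator_mem_sobolev (hCn n) hG Metric.isOpen_ball hQc hQs hG2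
    (A := Metric.ball x₀ s ∩ Φn n ⁻¹' {y | 0 < y e}) (hopen _ hpos).measurableSet
    (fun x hx hxC => (hside x hx hxC).imp
      (fun h => (hopen _ hpos).mem_nhds ⟨hx, h⟩)
      (fun h => by
        filter_upwards [(hopen _ hneg).mem_nhds ⟨hx, h⟩] with y hy hy'
        exact lt_asymm (show Φn n y e < 0 from hy.2) hy'.2))
  obtain ⟨H', hH', hHe⟩ := exists_indicator_mem_sobolev (hCn n) hH Metric.isOpen_ball hQc hQs hH2
    (A := Metric.ball x₀ s ∩ Φn n ⁻¹' {y | y e < 0}) (hopen _ hneg).measurableSet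
    (fun x hx hxC => (hside x hx hxC).symm.imp
      (fun h => (hopen _ hneg).mem_nhds ⟨hx, h⟩)
      (fun h => by
        filter_upwards [(hopen _ hpos).mem_nhds ⟨hx, h⟩] with y hy hy'
        exact lt_asymm (show 0 < Φn n y e from hy.2) hy'.2))
  refine ⟨G' + H', Submodule.add_mem _ hG' hH', ?_⟩
  -- Off the layer, |Φ_e| exceeds η while Φn is within η of Φ: the signs agree, and the glued field
  -- is F.
  have hbound : ∀ᵐ x, ‖(F - (G' + H')) x‖ ≤ ‖T.indicator k x‖ := by
    filter_upwards [Lp.coeFn_sub F (G' + H'), Lp.coeFn_add G' H', hGe, hHe, hG1, hG2, hH1, hH2, hF0]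
      with x a1 a2 a3 a4 a5 a6 a7 a8 a9
    rw [a1, Pi.sub_apply, a2, Pi.add_apply, a3, a4]
    by_cases hxQ : x ∈ Q
    · have hxs := hQs hxQ
      by_cases hxT : x ∈ T
      · rw [Set.indicator_of_mem hxT]
        have hi : ∀ (A : Set (Rn N)) (f : L2Field N), ‖A.indicator f x‖ ≤ ‖f x‖ := fun A f =>
          norm_indicator_le_norm_self _ _
        refine (norm_sub_le _ _).trans ?_
        refine (add_le_add le_rfl (norm_add_le _ _)).trans ?_
        rw [Real.norm_of_nonneg (by positivity), hk]
        have := hi (Metric.ball x₀ s ∩ Φn n ⁻¹' {y | 0 < y e}) G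
        have := hi (Metric.ball x₀ s ∩ Φn n ⁻¹' {y | y e < 0}) H
        simp only
        linarith
      · have hbig : η < |Φ x e| := by
          by_contra h; exact hxT ⟨hxQ, not_lt.1 h⟩
        have hclose : |Φ x e - Φn n x e| < η := by
          refine lt_of_le_of_lt ?_ (hun x hxQ)
          rw [dist_eq_norm]
          exact PiLp.norm_apply_le (Φ x - Φn n x) e
        have hc := abs_lt.1 hclose
        rcases lt_abs.1 hbig with h | h
        · have h1 : 0 < Φn n x e := by linarith
          rw [Set.indicator_of_mem (show x ∈ Metric.ball x₀ s ∩ Φn n ⁻¹' {y | 0 < y e} from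
              ⟨hxs, h1⟩), Set.indicator_of_notMem fun h' => lt_asymm h1 h'.2,
            a5 hxs (hη0.trans h)]
          simp
        · have h1 : Φn n x e < 0 := by linarith
          rw [Set.indicator_of_notMem fun h' => lt_asymm h1 h'.2,
            Set.indicator_of_mem (show x ∈ Metric.ball x₀ s ∩ Φn n ⁻¹' {y | y e < 0} from
              ⟨hxs, h1⟩), a7 hxs (by linarith)]
          simp
    · have e1 := a9 fun h => hxQ (hsQ h)
      have e2 : ∀ A : Set (Rn N), A.indicator G x = 0 := fun A => by
        by_cases hA : x ∈ A <;> simp [hA, a6 hxQ]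
      have e3 : ∀ A : Set (Rn N), A.indicator H x = 0 := fun A => by
        by_cases hA : x ∈ A <;> simp [hA, a8 hxQ]
      rw [e1, e2, e3]
      simp
  have h1 := (eLpNorm_mono_ae hbound).trans hTk
  rw [Lp.norm_def]
  have h2 := ENNReal.toReal_mono ENNReal.ofReal_ne_top h1
  rw [ENNReal.toReal_ofReal (half_pos hε).le] at h2
  linarith

/-- Uniformly bi-Lipschitz charts have a limit along an ultrafilter. -/
theorem exists_limit_chart (l : Ultrafilter ℕ) {L : ℝ} (hL : 0 < L) {x₀ : Rn N} {s : ℝ}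
    (hs : 0 < s) {Φn : ℕ → Rn N → Rn N}
    (hΦn : ∀ᶠ n in (l : Filter ℕ), BiLipOn L (Φn n) (Metric.ball x₀ s))
    (h0 : Tendsto (fun n => Φn n x₀) l (𝓝 0)) :
    ∃ Φ : Rn N → Rn N, BiLipOn L Φ (Metric.ball x₀ s) ∧ Φ x₀ = 0 ∧
      (∀ z ∈ Metric.ball x₀ s, Tendsto (fun n => Φn n z) l (𝓝 (Φ z))) ∧
      ∀ Q, IsCompact Q → Q ⊆ Metric.ball x₀ s → TendstoUniformlyOn Φn Φ l Q := by
  have hx₀ := Metric.mem_ball_self (x := x₀) hs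
  have hex : ∀ z, ∃ y, z ∈ Metric.ball x₀ s → Tendsto (fun n => Φn n z) l (𝓝 y) := by
    intro z
    by_cases hz : z ∈ Metric.ball x₀ s
    · have hb : ∀ᶠ n in (l : Filter ℕ), Φn n z ∈ Metric.closedBall (0 : Rn N) (L * s + 1) := by
        filter_upwards [hΦn, h0.eventually (Metric.ball_mem_nhds 0 one_pos)] with n hn hn0
        have h1 := (hn z hz x₀ hx₀).2
        have h2 : ‖z - x₀‖ ≤ s := by rw [← dist_eq_norm]; exact (Metric.mem_ball.1 hz).le
        have h3 := norm_add_le (Φn n z - Φn n x₀) (Φn n x₀)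
        rw [sub_add_cancel] at h3
        rw [dist_zero_right] at hn0
        rw [mem_closedBall_zero_iff]
        have := mul_le_mul_of_nonneg_left h2 hL.le
        linarith
      -- Bounded values converge along an ultrafilter by compactness; equi-Lipschitz bounds and a
      -- finite net later turn this into uniform convergence.
      obtain ⟨y, -, hy⟩ := (isCompact_closedBall (0 : Rn N) (L * s + 1)).ultrafilter_le_nhds
        (l.map fun n => Φn n z) (by
          rw [le_principal_iff]
          exact hb)
      exact ⟨y, fun _ => hy⟩
    · exact ⟨0, fun h => absurd h hz⟩
  choose Φ hΦ using hex
  have hbil : BiLipOn L Φ (Metric.ball x₀ s) := by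
    intro z hz z' hz'
    have hlim := ((hΦ z hz).sub (hΦ z' hz')).norm
    exact ⟨ge_of_tendsto hlim (hΦn.mono fun n hn => (hn z hz z' hz').1),
      le_of_tendsto hlim (hΦn.mono fun n hn => (hn z hz z' hz').2)⟩
  refine ⟨Φ, hbil, tendsto_nhds_unique (hΦ x₀ hx₀) h0, hΦ, fun Q hQ hQs => ?_⟩
  rw [Metric.tendstoUniformlyOn_iff]
  intro ε hε
  obtain ⟨t, htQ, htf, ht⟩ := hQ.finite_cover_balls (e := ε / (3 * L)) (by positivity)
  have hev : ∀ᶠ n in (l : Filter ℕ), ∀ c ∈ t, dist (Φn n c) (Φ c) < ε / 3 :=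
    (eventually_all_finite htf).2 fun c hc =>
      (hΦ c (hQs (htQ hc))).eventually (Metric.ball_mem_nhds _ (by positivity))
  filter_upwards [hev, hΦn] with n hn hbn z hz
  obtain ⟨c, hc, hzc⟩ := Set.mem_iUnion₂.1 (ht hz)
  have hcs := hQs (htQ hc)
  have hzs := hQs hz
  rw [Metric.mem_ball, dist_eq_norm, lt_div_iff₀ (by positivity)] at hzc
  have h1 := (hbil z hzs c hcs).2
  have h2 := (hbn z hzs c hcs).2
  have h3 := hn c hc
  have h4 := dist_triangle4 (Φ z) (Φ c) (Φn n c) (Φn n z)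
  rw [dist_comm (Φ c), dist_comm (Φn n c) (Φn n z)] at h4
  rw [← dist_eq_norm (Φ z)] at h1
  rw [← dist_eq_norm (Φn n z)] at h2
  linarith [show ‖z - c‖ * (3 * L) = 3 * (L * ‖z - c‖) by ring]

variable {r L : ℝ}

/-- Near a point which stays away from the boundaries, a separated family of hypersurfaces is a
single hypersurface, which is flat in a chart of a definite size. -/
theorem exists_flattening_chart {e d : Fin N} (he : (e : ℕ) + 1 = N) (hde : d ≠ e) (hN : 2 ≤ N)
    (hr : 0 < r) (hL : 0 < L) {Ω : Set (Rn N)} (hdiam : 0 < Metric.diam Ω) {ω : ℝ → ℝ}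
    (hω_pos : ∀ t, 0 < t → 0 < ω t) (hω_mono : MonotoneOn ω (Set.Ioi 0)) (x₀ : Rn N) {ε : ℝ}
    (hε : 0 < ε) :
    ∃ s > 0, ∀ {M : ℕ} (S : Fin M → LipschitzHypersurface N r L), IsSeparated ω Ω S →
      (∀ i, ∀ w ∈ (S i).boundary, ε ≤ dist x₀ w) →
      (∃ y ∈ ⋃ i, (S i).carrier, dist x₀ y < s) →
      1 ≤ L ∧ ∃ Φ : Rn N → Rn N, BiLipOn L Φ (Metric.ball x₀ s) ∧
        (∀ y ∈ ⋃ i, (S i).carrier, ‖Φ x₀‖ ≤ L * dist x₀ y) ∧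
        ∀ z ∈ Metric.ball x₀ s, z ∈ ⋃ i, (S i).carrier ↔ Φ z e = 0 := by
  -- Let x be the point of the union nearest to x₀; the ball of radius s lies within 2s of x. The
  -- bound ρ/2 on s keeps it in the chart at x, ρ/(2L²) keeps chart values in the covered disc of
  -- radius ρ/L, and ω(δ)/2 excludes the other members. The diameter enters δ for members without
  -- boundary.
  set δ := min (ε / 2) (Metric.diam Ω) with hδ
  have hδ0 : 0 < δ := lt_min (half_pos hε) hdiam
  set ρ := min r (ε / 2) with hρ
  have hρ0 : 0 < ρ := lt_min hr (half_pos hε)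
  set s := min (min (ρ / 2) (ρ / (2 * L ^ 2))) (ω δ / 2) with hs
  have hs0 : 0 < s := lt_min (lt_min (by positivity) (by positivity)) (half_pos (hω_pos δ hδ0))
  have hs1 : s ≤ ρ / 2 := (min_le_left _ _).trans (min_le_left _ _)
  have hs2 : s ≤ ρ / (2 * L ^ 2) := (min_le_left _ _).trans (min_le_right _ _)
  have hs3 : s ≤ ω δ / 2 := min_le_right _ _
  have hρr : ρ ≤ r := min_le_left _ _
  have hρε : ρ ≤ ε / 2 := min_le_right _ _
  refine ⟨s, hs0, fun {M} S hsep hb hne => ?_⟩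
  have hcomp : IsCompact (⋃ i, (S i).carrier) := isCompact_iUnion fun i => (S i).isCompact
  obtain ⟨y, hy, hys⟩ := hne
  obtain ⟨x, hx, hxmin⟩ := hcomp.exists_isMinOn ⟨y, hy⟩
    (f := fun z => dist x₀ z) (by fun_prop)
  have hxs : dist x₀ x < s := (hxmin hy).trans_lt hys
  obtain ⟨i, hxi⟩ := Set.mem_iUnion.1 hx
  have hdb : ∀ w ∈ (S i).boundary, ε / 2 ≤ dist x w := fun w hw => by
    have h1 := hb i w hw
    have h2 := dist_triangle x₀ x w
    linarith
  have hdist : δ ≤ (S i).distBoundary Ω x := (S i).le_distBoundary (min_le_right _ _)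
    fun w hw => (min_le_left _ _).trans (hdb w hw)
  have hsepx : ∀ j, j ≠ i → ∀ z ∈ (S j).carrier, ω δ ≤ dist x z := fun j hj z hz =>
    (hω_mono hδ0 (hδ0.trans_le hdist) hdist).trans (hsep i x hxi (hδ0.trans_le hdist) j hj z hz)
  have hL1 := (S i).one_le hr hL hN hxi
  have hzx : ∀ z ∈ Metric.ball x₀ s, dist z x < 2 * s := fun z hz => by
    have := dist_triangle z x₀ x
    linarith [Metric.mem_ball.1 hz]
  have hsub : Metric.ball x₀ s ⊆ Metric.ball x r := fun z hz => by
    rw [Metric.mem_ball]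
    linarith [hzx z hz]
  have hxr := Metric.mem_ball_self (x := x) hr
  have hΦ := (S i).biLipOn hxi
  refine ⟨hL1, (S i).chart x, hΦ.mono hsub, fun z hz => ?_, fun z hz => ?_⟩
  · have h1 := (hΦ x₀ (hsub (Metric.mem_ball_self hs0)) x hxr).2
    rw [(S i).chart_self x hxi, sub_zero, ← dist_eq_norm] at h1
    exact h1.trans (mul_le_mul_of_nonneg_left (hxmin hz) hL.le)
  · constructor
    · intro hzC
      obtain ⟨j, hzj⟩ := Set.mem_iUnion.1 hzC
      have hji : j = i := by
        by_contra hne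
        have h1 := hsepx j hne z hzj
        have h2 := hzx z hz
        rw [dist_comm] at h2
        linarith
      subst hji
      exact (S j).chart_eq_zero he hxi hzj (hsub hz)
    · intro hz0
      have h1 := (hΦ z (hsub hz) x hxr).2
      rw [(S i).chart_self x hxi, sub_zero, ← dist_eq_norm] at h1
      have h2 : L * dist z x < ρ / L := by
        have h3 : L * dist z x < L * (2 * s) := mul_lt_mul_of_pos_left (hzx z hz) hL
        refine h3.trans_le ?_
        rw [le_div_iff₀ hL]
        rw [le_div_iff₀ (by positivity)] at hs2
        linarith [show L * (2 * s) * L = s * (2 * L ^ 2) by ring]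
      obtain ⟨w, hw, hwx, hwz⟩ := (S i).exists_mem_of_norm_lt he hde hr hL hxi hρ0 hρr
        (fun w hw => hρε.trans (hdb w hw)) hz0 (h1.trans_lt h2)
      rw [← hΦ.injOn hL hwx (hsub hz) hwz]
      exact Set.mem_iUnion.2 ⟨i, hw⟩

end Local

/-! ### Localization, and removal of sets of codimension two -/

section Localization

open scoped NNReal ENNReal

variable {N : ℕ}

theorem partialDeriv_eq_zero_of_eventuallyEq {χ : Rn N → ℝ} {x : Rn N} {c : ℝ}
    (h : ∀ᶠ y in 𝓝 x, χ y = c) (i : Fin N) : partialDeriv i χ x = 0 := by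
  rw [partialDeriv, (show χ =ᶠ[𝓝 x] fun _ => c from h).fderiv_eq]; simp

/-- Decomposition of a Sobolev field according to an open covering of its support. -/
theorem exists_split {C : Set (Rn N)} {F : L2Field N} (hF : F ∈ sobolev C)
    {Q U V : Set (Rn N)} (hQ : IsCompact Q) (hU : IsOpen U) (hV : IsOpen V) (hQUV : Q ⊆ U ∪ V)
    (hF0 : ∀ᵐ x, x ∉ Q → F x = 0) :
    ∃ G ∈ sobolev C, ∃ H ∈ sobolev C, F = G + H ∧ (∀ᵐ x, x ∉ U → G x = 0) ∧
      ∃ Q', IsCompact Q' ∧ Q' ⊆ V ∧ ∀ᵐ x, x ∉ Q' → H x = 0 := by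
  have hQV : Q \ V ⊆ U := fun x hx => (hQUV hx.1).resolve_right hx.2
  -- χ = 1 near Q ∖ V, so χF is supported in U and the remainder lives on Q minus the interior of {χ
  -- = 1}, a compact subset of V.
  obtain ⟨χ, hχ, hχc, hχs, hχ01, hχ1⟩ := exists_smooth_cutoff (hQ.diff hV) hU hQV
  obtain ⟨M, hM⟩ : ∃ M, ∀ x, ‖fderiv ℝ χ x‖ ≤ M :=
    (hχ.continuous_fderiv (by simp)).bounded_above_of_compact_support (hχc.fderiv (𝕜 := ℝ))
  have hMi : ∀ x i, |partialDeriv i χ x| ≤ M := fun x i => by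
    refine ((fderiv ℝ χ x).le_opNorm _).trans ?_
    simpa using hM x
  obtain ⟨G, hG, hG0, hGs⟩ := exists_mul_mem_sobolev (C := C) (C' := C) (ζ := χ)
    hχ.continuous.measurable (fun x _ => hχ.contDiffAt) Set.inter_subset_right (M := max 1 M)
    (ae_of_all _ fun x => ⟨le_max_of_le_left (by
      rw [abs_of_nonneg (hχ01 x).1]; exact (hχ01 x).2), fun i => le_max_of_le_right (hMi x i)⟩) hF
  refine ⟨G, hG, F - G, Submodule.sub_mem _ hF hG, by abel, ?_,
    Q \ interior {y | χ y = 1}, hQ.diff isOpen_interior, ?_, ?_⟩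
  · filter_upwards [hG0, ae_all_iff.2 hGs] with x h0 hs hxU
    have hxt : x ∉ tsupport χ := fun h => hxU (hχs h)
    have hz := image_eq_zero_of_notMem_tsupport hxt
    ext j
    refine Fin.cases ?_ (fun i => ?_) j
    · rw [h0, hz]; simp
    · rw [hs, hz, partialDeriv_eq_zero_of_notMem_tsupport i hxt]; simp
  · rintro x ⟨hx, hxi⟩
    by_contra hxV
    exact hxi (mem_interior_iff_mem_nhds.2 (hχ1 x ⟨hx, hxV⟩))
  · filter_upwards [hG0, ae_all_iff.2 hGs, hF0, Lp.coeFn_sub F G] with x h0 hs hx hsub hxQ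
    rw [hsub, Pi.sub_apply]
    by_cases hQx : x ∈ Q
    · have hxi : x ∈ interior {y | χ y = 1} := by
        by_contra h; exact hxQ ⟨hQx, h⟩
      have hev : ∀ᶠ y in 𝓝 x, χ y = 1 := mem_interior_iff_mem_nhds.1 hxi
      have h1 := hev.self_of_nhds
      rw [sub_eq_zero]
      ext j
      refine Fin.cases ?_ (fun i => ?_) j
      · rw [h0, h1, one_mul]
      · rw [hs, h1, partialDeriv_eq_zero_of_eventuallyEq hev]; simp
    · have hFx := hx hQx
      rw [hFx]
      ext j
      refine Fin.cases ?_ (fun i => ?_) j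
      · simp [h0, hFx]
      · simp [hs, hFx]

/-- A Sobolev field belongs to a subspace as soon as its localizations do. -/
theorem mem_of_locally_mem {C : Set (Rn N)} {T : Submodule ℝ (L2Field N)} {Q : Set (Rn N)}
    (hQ : IsCompact Q)
    (hloc : ∀ x ∈ Q, ∃ s > 0, ∀ F ∈ sobolev C, (∀ᵐ y, y ∉ Metric.closedBall x s → F y = 0) → F ∈ T)
    {F : L2Field N} (hF : F ∈ sobolev C) (hF0 : ∀ᵐ x, x ∉ Q → F x = 0) : F ∈ T := by
  classical
  choose! s hs hsT using hloc
  obtain ⟨t, ht, htQ⟩ := hQ.elim_nhds_subcover (fun x => Metric.ball x (s x))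
    fun x hx => Metric.ball_mem_nhds x (hs x hx)
  have hT : ∀ x ∈ t, ∀ F ∈ sobolev C,
      (∀ᵐ y, y ∉ Metric.closedBall x (s x) → F y = 0) → F ∈ T := fun x hx => hsT x (ht x hx)
  clear hs hsT ht
  induction t using Finset.induction_on generalizing Q F with
  | empty =>
    have hQe : Q = ∅ := by simpa using htQ
    have : F = 0 := by
      refine Lp.ext ?_
      filter_upwards [hF0, Lp.coeFn_zero (EuclideanSpace ℝ (Fin (N + 1))) 2 volume] with x hx h0
      rw [hx (by rw [hQe]; exact Set.notMem_empty x), h0]; rfl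
    rw [this]; exact T.zero_mem
  | insert a t hat ih =>
    obtain ⟨G, hG, H, hH, hFGH, hG0, Q', hQ', hQ'V, hH0⟩ := exists_split hF hQ
      (U := Metric.ball a (s a)) (V := ⋃ x ∈ t, Metric.ball x (s x)) Metric.isOpen_ball
      (isOpen_biUnion fun _ _ => Metric.isOpen_ball) (by
        rw [Finset.set_biUnion_insert] at htQ; exact htQ) hF0
    rw [hFGH]
    refine T.add_mem (hT a (Finset.mem_insert_self a t) G hG ?_)
      (ih hQ' hH hH0 hQ'V fun x hx => hT x (Finset.mem_insert_of_mem hx))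
    filter_upwards [hG0] with x hx hxb
    exact hx fun h => hxb (Metric.ball_subset_closedBall h)

/-- A smooth cutoff vanishing near a closed set, with a gradient bounded by the inverse of the
size of the transition layer. -/
theorem exists_cutoff_near (Z : Set (Rn N)) {ε : ℝ} (hε : 0 < ε) :
    ∃ η : Rn N → ℝ, ContDiff ℝ (⊤ : ℕ∞) η ∧ (∀ x, 0 ≤ η x ∧ η x ≤ 1) ∧
      (∀ x i, |partialDeriv i η x| ≤ 1 / ε) ∧
      (∀ x, Metric.infDist x Z < ε / 2 → η x = 0) ∧
      ∀ x, 3 * ε < Metric.infDist x Z → η x = 1 := by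
  -- A ramp from 0 at distance ε to 1 at distance 2ε. Mollification at scale ε/2 keeps the slope 1/ε
  -- and displaces the thresholds by at most ε/2.
  set u : Rn N → ℝ := fun x => max 0 (min 1 (Metric.infDist x Z / ε - 1)) with hu
  have hε' : 0 ≤ 1 / ε := by positivity
  have hdist : ∀ x y : Rn N, |Metric.infDist x Z - Metric.infDist y Z| ≤ dist x y := fun x y => by
    simpa [Real.dist_eq] using (Metric.lipschitz_infDist_pt Z).dist_le_mul x y
  have hlip : ∀ x y, |u x - u y| ≤ 1 / ε * dist x y := by
    intro x y
    refine (abs_max_sub_max_le_max _ _ _ _).trans ?_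
    rw [sub_self, abs_zero]
    refine max_le (by positivity) ((abs_min_sub_min_le_max _ _ _ _).trans ?_)
    rw [sub_self, abs_zero]
    refine max_le (by positivity) ?_
    rw [sub_sub_sub_cancel_right, ← sub_div, abs_div, abs_of_pos hε, div_eq_inv_mul, one_div]
    exact mul_le_mul_of_nonneg_left (hdist x y) (by positivity)
  have hu01 : ∀ x, 0 ≤ u x ∧ u x ≤ 1 := fun x =>
    ⟨le_max_left _ _, max_le zero_le_one (min_le_left _ _)⟩
  have hu0 : ∀ x, Metric.infDist x Z ≤ ε → u x = 0 := fun x hx => by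
    refine max_eq_left ((min_le_right _ _).trans ?_)
    rw [sub_nonpos, div_le_one hε]; exact hx
  have hu1 : ∀ x, 2 * ε ≤ Metric.infDist x Z → u x = 1 := fun x hx => by
    have h1 : 1 ≤ Metric.infDist x Z / ε - 1 := by
      rw [le_sub_iff_add_le, le_div_iff₀ hε]; linarith
    simp only [hu, min_eq_left h1]; norm_num
  have huc : Continuous u := by
    have := Metric.continuous_infDist_pt Z
    fun_prop
  let φ : ContDiffBump (0 : Rn N) := ⟨ε / 4, ε / 2, by positivity, by linarith⟩
  have hφs : ∀ t, φ.normed volume t ≠ 0 → ‖t‖ < ε / 2 := fun t ht => by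
    have : t ∈ Function.support (φ.normed volume) := ht
    rw [φ.support_normed_eq] at this
    simpa [φ] using this
  have hli := huc.locallyIntegrable (μ := (volume : Measure (Rn N)))
  have hint := mollify_integrable φ hli
  have hφ0 : ∀ t, 0 ≤ φ.normed volume t := φ.nonneg_normed
  have hφ1 : ∫ t, φ.normed volume t = 1 := φ.integral_normed
  have hconst : ∀ x c, (∀ t, ‖t‖ < ε / 2 → u (x - t) = c) → mollify φ u x = c := by
    intro x c h
    rw [mollify_apply]
    have : ∀ t, φ.normed volume t * u (x - t) = φ.normed volume t * c := fun t => by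
      by_cases ht : φ.normed volume t = 0
      · simp [ht]
      · rw [h t (hφs t ht)]
    simp_rw [this]
    rw [integral_mul_const, hφ1, one_mul]
  have hshift : ∀ x t : Rn N, ‖t‖ < ε / 2 →
      |Metric.infDist (x - t) Z - Metric.infDist x Z| < ε / 2 := fun x t ht => by
    refine (hdist _ _).trans_lt ?_
    rwa [dist_eq_norm, sub_sub_cancel_left, norm_neg]
  refine ⟨mollify φ u, mollify_contDiff φ hli, fun x => ⟨?_, ?_⟩, fun x i => ?_, fun x hx => ?_,
    fun x hx => ?_⟩
  · rw [mollify_apply]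
    exact integral_nonneg fun t => mul_nonneg (hφ0 t) (hu01 _).1
  · rw [mollify_apply, ← hφ1]
    exact integral_mono (hint x) φ.integrable_normed fun t =>
      mul_le_of_le_one_right (hφ0 t) (hu01 _).2
  · have hml : LipschitzWith (Real.toNNReal (1 / ε)) (mollify φ u) := by
      refine LipschitzWith.of_dist_le_mul fun x y => ?_
      rw [Real.coe_toNNReal _ hε', Real.dist_eq, mollify_apply, mollify_apply,
        ← integral_sub (hint x) (hint y)]
      have hI : Integrable (fun t => φ.normed volume t * (1 / ε * dist x y)) volume :=
        φ.integrable_normed.mul_const _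
      have := norm_integral_le_of_norm_le (f := fun t => φ.normed volume t * u (x - t) -
        φ.normed volume t * u (y - t)) hI (ae_of_all _ fun t => by
          rw [← mul_sub, norm_mul, Real.norm_of_nonneg (hφ0 t)]
          refine mul_le_mul_of_nonneg_left ((hlip _ _).trans ?_) (hφ0 t)
          rw [dist_sub_right])
      rwa [integral_mul_const, hφ1, one_mul] at this
    refine ((fderiv ℝ (mollify φ u) x).le_opNorm _).trans ?_
    have := norm_fderiv_le_of_lipschitz ℝ (x₀ := x) hml
    rw [Real.coe_toNNReal _ hε'] at this
    simpa using this
  · exact hconst x 0 fun t ht => hu0 _ (by linarith [(abs_lt.1 (hshift x t ht)).2])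
  · exact hconst x 1 fun t ht => hu1 _ (by linarith [(abs_lt.1 (hshift x t ht)).1])

theorem tendsto_integral_mul_of_dominated {u : ℕ → Rn N → ℝ} {u₀ g : Rn N → ℝ}
    (hu : ∀ k, AEStronglyMeasurable (u k) volume) (hu₀ : MemLp u₀ 2 volume) (hg : MemLp g 2 volume)
    (hb : ∀ k, ∀ᵐ x, |u k x| ≤ |u₀ x|)
    (hlim : ∀ᵐ x, Tendsto (fun k => u k x) atTop (𝓝 (u₀ x))) :
    Tendsto (fun k => ∫ x, u k x * g x) atTop (𝓝 (∫ x, u₀ x * g x)) := by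
  refine tendsto_integral_of_dominated_convergence (fun x => |u₀ x| * |g x|)
    (fun k => (hu k).mul hg.1) (hu₀.norm.integrable_mul hg.norm) (fun k => ?_) ?_
  · filter_upwards [hb k] with x hx
    rw [norm_mul]
    exact mul_le_mul_of_nonneg_right hx (norm_nonneg _)
  · filter_upwards [hlim] with x hx using hx.mul_const _

/-- Sets of vanishing capacity do not matter: it suffices to deal with the fields which are
supported away from a compact set of Minkowski codimension two. -/
theorem mem_of_mem_of_support_disjoint {C : Set (Rn N)} (hC : IsClosed C) (hC0 : volume C = 0)
    {T : Submodule ℝ (L2Field N)} (hT : IsClosed (T : Set (L2Field N))) {Z : Set (Rn N)}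
    (hZ : IsClosed Z) {A : ℝ≥0∞} (hA : A ≠ ∞) {ρ : ℝ} (hρ : 0 < ρ)
    (hvol : ∀ ε, 0 < ε → ε ≤ ρ →
      volume {x | ∃ w ∈ Z, dist x w < ε} ≤ A * ENNReal.ofReal ε ^ 2)
    (hTZ : ∀ Q, IsCompact Q → Disjoint Q Z → ∀ F ∈ sobolev C, (∀ᵐ x, x ∉ Q → F x = 0) → F ∈ T)
    {Q : Set (Rn N)} (hQ : IsCompact Q) {F : L2Field N} (hF : F ∈ sobolev C)
    (hF0 : ∀ᵐ x, x ∉ Q → F x = 0) {M : ℝ} (hM : ∀ᵐ x, |F x 0| ≤ M) : F ∈ T := by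
  -- `Metric.infDist` to the empty set is 0, so the cutoffs would vanish identically in that case.
  rcases Z.eq_empty_or_nonempty with rfl | hZne
  · exact hTZ Q hQ (Set.disjoint_empty Q) F hF hF0
  have hM0 : 0 ≤ M := by
    obtain ⟨x, hx⟩ := hM.exists
    exact (abs_nonneg _).trans hx
  set ε : ℕ → ℝ := fun k => ρ / 4 / ((k : ℝ) + 1) with hεdef
  have hε : ∀ k, 0 < ε k := fun k => by positivity
  have hερ : ∀ k, 4 * ε k ≤ ρ := fun k => by
    have : ε k ≤ ρ / 4 := div_le_self (by positivity) (by simp)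
    linarith
  have hεlim : Tendsto ε atTop (𝓝 0) :=
    (tendsto_const_div_atTop_nhds_zero_nat (ρ / 4)).comp (tendsto_add_atTop_nat 1) |>.congr
      fun k => by simp [hεdef]
  choose η hη hη01 hηd hη0 hη1 using fun k => exists_cutoff_near Z (hε k)
  have hmem : ∀ k, ∃ G ∈ sobolev C, (∀ᵐ x, G x 0 = η k x * F x 0) ∧
      ∀ i : Fin N, ∀ᵐ x, G x i.succ = η k x * F x i.succ + partialDeriv i (η k) x * F x 0 :=
    fun k => exists_mul_mem_sobolev (hη k).continuous.measurable (fun x _ => (hη k).contDiffAt)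
      Set.inter_subset_right (M := max 1 (1 / ε k)) (ae_of_all _ fun x => ⟨le_max_of_le_left (by
        rw [abs_of_nonneg (hη01 k x).1]; exact (hη01 k x).2),
        fun i => le_max_of_le_right (hηd k x i)⟩) hF
  choose G hG hG0 hGs using hmem
  have hGT : ∀ k, G k ∈ T := by
    intro k
    have hop : IsOpen {x : Rn N | Metric.infDist x Z < ε k / 2} :=
      isOpen_lt (Metric.continuous_infDist_pt Z) continuous_const
    refine hTZ (Q \ {x | Metric.infDist x Z < ε k / 2}) (hQ.diff hop) ?_ (G k) (hG k) ?_
    · rw [Set.disjoint_left]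
      rintro x ⟨-, hx⟩ hxZ
      exact hx (by
        rw [Set.mem_ofPred_eq, Metric.infDist_zero_of_mem hxZ]
        exact half_pos (hε k))
    · filter_upwards [hG0 k, ae_all_iff.2 (hGs k), hF0] with x h0 hs hx hxQ
      by_cases hQx : x ∈ Q
      · have hxi : x ∈ {x : Rn N | Metric.infDist x Z < ε k / 2} := by
          by_contra h; exact hxQ ⟨hQx, h⟩
        have hd := partialDeriv_eq_zero_of_eventuallyEq (χ := η k) (x := x) (c := 0) (by
          filter_upwards [hop.mem_nhds hxi] with y hy using hη0 k y hy)
        ext j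
        refine Fin.cases ?_ (fun i => ?_) j
        · rw [h0, hη0 k x hxi]; simp
        · rw [hs, hη0 k x hxi, hd]; simp
      · have hFx := hx hQx
        ext j
        refine Fin.cases ?_ (fun i => ?_) j
        · rw [h0, hFx]; simp
        · rw [hs, hFx]; simp
  have hmul : ∀ k j, MemLp (fun x => η k x * F x j) 2 volume ∧
      eLpNorm (fun x => η k x * F x j) 2 volume ≤ eLpNorm (fun x => F x j) 2 volume := by
    intro k j
    have hle : ∀ x, ‖η k x * F x j‖ ≤ ‖F x j‖ := fun x => by
      rw [norm_mul, Real.norm_of_nonneg (hη01 k x).1]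
      exact mul_le_of_le_one_left (norm_nonneg _) (hη01 k x).2
    have hm := memLp_coord F j
    exact ⟨hm.mono ((hη k).continuous.aestronglyMeasurable.mul hm.1) (ae_of_all _ hle),
      eLpNorm_mono hle⟩
  -- The term F ∂η is at most M/ε_k on the 4ε_k-neighbourhood of Z, of volume at most 16 A ε_k². Its
  -- L² norm need not tend to 0, but stays below B for all k, which suffices for weak convergence.
  set B : ℝ≥0∞ := ENNReal.ofReal M * (16 * A) ^ (1 / (2 : ℝ)) with hB
  have hBt : B ≠ ∞ := ENNReal.mul_ne_top ENNReal.ofReal_ne_top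
    (ENNReal.rpow_ne_top_of_nonneg (by norm_num) (ENNReal.mul_ne_top (by norm_num) hA))
  have hgrad : ∀ k i, eLpNorm (fun x => partialDeriv i (η k) x * F x 0) 2 volume ≤ B := by
    intro k i
    set P : Set (Rn N) := {x | ∃ w ∈ Z, dist x w < 4 * ε k} with hP
    have hPo : IsOpen P := by
      have : P = ⋃ w ∈ Z, Metric.ball w (4 * ε k) := by ext x; simp [hP]
      rw [this]
      exact isOpen_biUnion fun _ _ => Metric.isOpen_ball
    have hle : ∀ᵐ x, ‖partialDeriv i (η k) x * F x 0‖ ≤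
        ‖P.indicator (fun _ => 1 / ε k * M) x‖ := by
      filter_upwards [hM] with x hx
      by_cases hxP : x ∈ P
      · rw [Set.indicator_of_mem hxP, norm_mul, Real.norm_of_nonneg (mul_nonneg
          (one_div_nonneg.2 (hε k).le) hM0)]
        exact mul_le_mul (hηd k x i) hx (norm_nonneg _) (one_div_nonneg.2 (hε k).le)
      · have hfar : 3 * ε k < Metric.infDist x Z := by
          refine lt_of_lt_of_le (by linarith [hε k] : 3 * ε k < 4 * ε k)
            ((Metric.le_infDist hZne).2 fun {w} hw => ?_)
          by_contra h
          exact hxP ⟨w, hw, not_le.1 h⟩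
        have hop : IsOpen {x : Rn N | 3 * ε k < Metric.infDist x Z} :=
          isOpen_lt continuous_const (Metric.continuous_infDist_pt Z)
        rw [partialDeriv_eq_zero_of_eventuallyEq (χ := η k) (c := 1) (by
          filter_upwards [hop.mem_nhds hfar] with y hy using hη1 k y hy)]
        simp
    refine (eLpNorm_mono_ae hle).trans ?_
    rw [eLpNorm_indicator_const hPo.measurableSet (by norm_num) (by norm_num)]
    have hv := hvol (4 * ε k) (by linarith [hε k]) (hερ k)
    have hofr : ENNReal.ofReal (4 * ε k) ^ 2 = 16 * ENNReal.ofReal (ε k) ^ 2 := by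
      rw [ENNReal.ofReal_mul (by norm_num), mul_pow]
      norm_num
    rw [Real.enorm_eq_ofReal (mul_nonneg (one_div_nonneg.2 (hε k).le) hM0),
      ENNReal.ofReal_mul (one_div_nonneg.2 (hε k).le)]
    calc ENNReal.ofReal (1 / ε k) * ENNReal.ofReal M * volume P ^ (1 / (2 : ℝ≥0∞).toReal)
        ≤ ENNReal.ofReal (1 / ε k) * ENNReal.ofReal M *
          (16 * A * ENNReal.ofReal (ε k) ^ 2) ^ (1 / (2 : ℝ)) := by
          rw [ENNReal.toReal_ofNat]
          gcongr
          refine hv.trans (le_of_eq ?_)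
          rw [hofr]; ring
      _ = (ENNReal.ofReal (1 / ε k) * ENNReal.ofReal (ε k)) * B := by
          rw [ENNReal.mul_rpow_of_nonneg _ _ (by norm_num), ← ENNReal.rpow_natCast,
            ← ENNReal.rpow_mul]
          norm_num [hB]
          ring
      _ = B := by
          rw [← ENNReal.ofReal_mul (one_div_nonneg.2 (hε k).le), one_div_mul_cancel (hε k).ne',
            ENNReal.ofReal_one, one_mul]
  have hbound : ∀ k, ‖G k‖ ≤ ∑ j, ((eLpNorm (fun x => F x j) 2 volume).toReal + B.toReal) := by
    intro k
    refine (norm_field_le (G k)).trans (Finset.sum_le_sum fun j _ => ?_)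
    rw [← ENNReal.toReal_add (memLp_coord F j).eLpNorm_ne_top hBt]
    refine ENNReal.toReal_mono (ENNReal.add_ne_top.2 ⟨(memLp_coord F j).eLpNorm_ne_top, hBt⟩) ?_
    refine Fin.cases ?_ (fun i => ?_) j
    · rw [eLpNorm_congr_ae (hG0 k)]
      exact (hmul k 0).2.trans le_self_add
    · rw [eLpNorm_congr_ae (hGs k i)]
      refine (eLpNorm_add_le (hmul k i.succ).1.1
        ((measurable_partialDeriv i (η k)).aestronglyMeasurable.mul (memLp_coord F 0).1)
        (by norm_num)).trans (add_le_add (hmul k i.succ).2 (hgrad k i))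
  have hZnull : volume Z = 0 := by
    have hlim : Tendsto (fun k => A * ENNReal.ofReal (ε k) ^ 2) atTop (𝓝 0) := by
      have h1 := (ENNReal.continuous_ofReal.tendsto 0).comp hεlim
      rw [ENNReal.ofReal_zero] at h1
      have h2 := ENNReal.Tendsto.const_mul (a := A) (ENNReal.Tendsto.pow (n := 2) h1) (Or.inr hA)
      simpa using h2
    refine le_antisymm (ge_of_tendsto' hlim fun k => ?_) bot_le
    refine (measure_mono fun x hx => ?_).trans (hvol (ε k) (hε k) (by linarith [hερ k, hε k]))
    exact ⟨x, hx, by simpa using hε k⟩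
  refine mem_of_bounded_of_tendsto_coord hC hC0 hT hF hG hGT hbound fun φ hφ => ?_
  have hlim := tendsto_integral_mul_of_dominated (u := fun k x => η k x * F x 0)
    (fun k => (hmul k 0).1.1) (memLp_coord F 0) (hφ.memLp volume)
    (fun k => ae_of_all _ fun x => by
      rw [abs_mul, abs_of_nonneg (hη01 k x).1]
      exact mul_le_of_le_one_left (abs_nonneg _) (hη01 k x).2) (by
      filter_upwards [measure_eq_zero_iff_ae_notMem.1 hZnull] with x hx
      have hpos : 0 < Metric.infDist x Z := (hZ.notMem_iff_infDist_pos hZne).1 hx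
      refine tendsto_const_nhds.congr' ?_
      filter_upwards [hεlim.eventually (gt_mem_nhds (show 0 < Metric.infDist x Z / 3 by positivity))]
        with k hk
      rw [hη1 k x (by linarith), one_mul])
  refine hlim.congr fun k => integral_congr_ae ?_
  filter_upwards [hG0 k] with x hx
  rw [hx]

/-- It suffices to deal with bounded fields. -/
theorem mem_of_truncations_mem {C : Set (Rn N)} (hC : IsClosed C) (hC0 : volume C = 0)
    {T : Submodule ℝ (L2Field N)} (hT : IsClosed (T : Set (L2Field N))) {Q : Set (Rn N)}
    (hQ : IsCompact Q)
    (hTb : ∀ M : ℝ, ∀ F ∈ sobolev C, (∀ᵐ x, x ∉ Q → F x = 0) → (∀ᵐ x, |F x 0| ≤ M) → F ∈ T)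
    {F : L2Field N} (hF : F ∈ sobolev C) (hF0 : ∀ᵐ x, x ∉ Q → F x = 0) : F ∈ T := by
  obtain ⟨A, hA⟩ := exists_truncation hC hF
  choose G hG hG0 hGA using fun k : ℕ => hA k (Nat.cast_nonneg k)
  -- The truncations are bounded in norm uniformly in the level and converge weakly, and T is weakly
  -- closed.
  refine mem_of_bounded_of_tendsto_coord hC hC0 hT hF hG (fun k => ?_) hGA fun φ hφ => ?_
  · refine hTb k (G k) (hG k) ?_ ?_
    · have := sobolev_ae_eq_zero hC (hG k) hQ.isClosed.isOpen_compl (by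
        filter_upwards [hG0 k, hF0] with x h0 hx hxQ
        rw [h0, hx hxQ]
        simp)
      filter_upwards [this, measure_eq_zero_iff_ae_notMem.1 hC0] with x hx hxC hxQ using hx hxQ hxC
    · filter_upwards [hG0 k] with x hx
      rw [hx, abs_le]
      exact ⟨le_max_left _ _, max_le (by linarith [Nat.cast_nonneg (α := ℝ) k]) (min_le_left _ _)⟩
  · have hm := memLp_coord F 0
    have hlim := tendsto_integral_mul_of_dominated
      (u := fun (k : ℕ) x => max (-(k : ℝ)) (min (k : ℝ) (F x 0)))
      (fun k => ((continuous_const.max (continuous_const.min continuous_id)).comp_aestronglyMeasurable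
        hm.1)) hm (hφ.memLp volume)
      (fun k => ae_of_all _ fun x => by
        have hk := Nat.cast_nonneg (α := ℝ) k
        rw [abs_le]
        constructor
        · refine le_max_of_le_right (le_min ?_ (neg_abs_le _))
          linarith [abs_nonneg (F x 0)]
        · exact max_le (by linarith [abs_nonneg (F x 0)]) ((min_le_right _ _).trans (le_abs_self _)))
      (ae_of_all _ fun x => by
        refine tendsto_const_nhds.congr' ?_
        obtain ⟨k₀, hk₀⟩ := exists_nat_ge |F x 0|
        filter_upwards [eventually_ge_atTop k₀] with k hk
        have h1 : |F x 0| ≤ k := hk₀.trans (by exact_mod_cast hk)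
        rw [min_eq_right (abs_le.1 h1).2, max_eq_right (abs_le.1 h1).1])
    refine hlim.congr fun k => integral_congr_ae ?_
    filter_upwards [hG0 k] with x hx
    rw [hx]

end Localization

/-! ### Approximation along an ultrafilter -/

section LowerLimit

open scoped NNReal ENNReal

variable {N : ℕ} {r L : ℝ}

/-- The limit, along a filter, of the boundaries of families of hypersurfaces. -/
def singularLimit (l : Filter ℕ) {M : ℕ → ℕ} (S : ∀ n, Fin (M n) → LipschitzHypersurface N r L) :
    Set (Rn N) :=
  {x | ∀ ε > 0, ∀ᶠ n in l, ∃ i, ∃ w ∈ (S n i).boundary, dist x w < ε}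

variable {l : Filter ℕ} {M : ℕ → ℕ} {S : ∀ n, Fin (M n) → LipschitzHypersurface N r L}

theorem isClosed_singularLimit : IsClosed (singularLimit l S) := by
  refine isClosed_of_closure_subset fun x hx ε hε => ?_
  obtain ⟨y, hy, hxy⟩ := Metric.mem_closure_iff.1 hx (ε / 2) (half_pos hε)
  filter_upwards [hy (ε / 2) (half_pos hε)] with n hn
  obtain ⟨i, w, hw, hyw⟩ := hn
  exact ⟨i, w, hw, by linarith [dist_triangle x y w]⟩

theorem singularLimit_subset [l.NeBot] {Ω : Set (Rn N)} (hS : ∀ n i, (S n i).carrier ⊆ closure Ω) :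
    singularLimit l S ⊆ closure Ω := by
  intro x hx
  rw [← closure_closure, Metric.mem_closure_iff]
  intro ε hε
  obtain ⟨n, i, w, hw, hxw⟩ := (hx ε hε).exists
  exact ⟨w, hS n i hw.1, hxw⟩

/-- By compactness finitely many points are ε-dense in the singular limit, and a single index n has
boundary points within ε of all of them. So the ε-neighbourhood lies in the 3ε-neighbourhood of the
boundaries of that family. -/
theorem exists_volume_singularLimit_le [l.NeBot] (hN : 2 ≤ N) (hr : 0 < r) (hL : 0 < L)
    {Ω : Set (Rn N)} (hΩb : Bornology.IsBounded Ω) {ω : ℝ → ℝ} (hω_pos : ∀ t, 0 < t → 0 < ω t)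
    (hω_mono : MonotoneOn ω (Set.Ioi 0)) (hS : ∀ n i, (S n i).carrier ⊆ closure Ω)
    (hsep : ∀ n, IsSeparated ω Ω (S n)) :
    ∃ A : ℝ≥0∞, A ≠ ∞ ∧ ∀ ε, 0 < ε → ε ≤ r / 12 →
      volume {x | ∃ w ∈ singularLimit l S, dist x w < ε} ≤ A * ENNReal.ofReal ε ^ 2 := by
  obtain ⟨A, hA, hvol⟩ := exists_volume_singular_le hN hr hL hΩb hω_pos hω_mono
  refine ⟨9 * A, ENNReal.mul_ne_top (by norm_num) hA, fun ε hε hεr => ?_⟩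
  have hZc : IsCompact (singularLimit l S) :=
    hΩb.isCompact_closure.of_isClosed_subset isClosed_singularLimit (singularLimit_subset hS)
  obtain ⟨t, htZ, htf, ht⟩ := hZc.finite_cover_balls hε
  obtain ⟨n, hn⟩ := ((eventually_all_finite htf).2 fun c hc => htZ hc ε hε).exists
  have h9 : ENNReal.ofReal (3 * ε) ^ 2 = 9 * ENNReal.ofReal ε ^ 2 := by
    rw [ENNReal.ofReal_mul (by norm_num), mul_pow]
    norm_num
  have h := hvol (M n) (S n) (hS n) (hsep n) (3 * ε) (by positivity) (by linarith)
  rw [h9] at h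
  refine (measure_mono ?_).trans (h.trans (le_of_eq (by ring)))
  rintro x ⟨w, hw, hxw⟩
  obtain ⟨c, hc, hwc⟩ := Set.mem_iUnion₂.1 (ht hw)
  obtain ⟨i, v, hv, hcv⟩ := hn c hc
  refine ⟨i, v, hv, ?_⟩
  have := dist_triangle4 x w c v
  linarith [Metric.mem_ball.1 hwc]

theorem volume_iUnion_carrier (hN : 2 ≤ N) (hr : 0 < r) (hL : 0 < L) {M : ℕ}
    (S : Fin M → LipschitzHypersurface N r L) : volume (⋃ i, (S i).carrier) = 0 :=
  measure_iUnion_null fun i => (S i).volume_carrier hN hr hL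

/-- Local approximation away from the limit of the boundaries. -/
theorem exists_local_approximable (l : Ultrafilter ℕ) (hN : 2 ≤ N) (hr : 0 < r) (hL : 0 < L)
    {Ω : Set (Rn N)} {ω : ℝ → ℝ} (hω_pos : ∀ t, 0 < t → 0 < ω t)
    (hω_mono : MonotoneOn ω (Set.Ioi 0)) (hsep : ∀ n, IsSeparated ω Ω (S n))
    {C : Set (Rn N)} (hC : IsClosed C) (hdiam : C.Nonempty → 0 < Metric.diam Ω)
    (hCn : ∀ z ∈ C, ∀ ε > 0, ∀ᶠ n in (l : Filter ℕ), ∃ y ∈ ⋃ i, (S n i).carrier, dist z y < ε)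
    {x₀ : Rn N} (hx₀ : x₀ ∉ singularLimit l S) :
    ∃ s > 0, ∀ F ∈ sobolev C, (∀ᵐ y, y ∉ Metric.closedBall x₀ s → F y = 0) →
      F ∈ approximable (l : Filter ℕ) fun n => sobolev (⋃ i, (S n i).carrier) := by
  by_cases hxC : x₀ ∈ C
  · obtain ⟨e, d, he, -, hde⟩ := exists_last_two hN
    -- The negation of an eventual statement is again eventual because l is an ultrafilter; a
    -- general filter would only give it frequently.
    have hev : ∃ ε > 0, ∀ᶠ n in (l : Filter ℕ), ∀ i, ∀ w ∈ (S n i).boundary, ε ≤ dist x₀ w := by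
      simp only [singularLimit, Set.mem_ofPred_eq, not_forall] at hx₀
      obtain ⟨ε, hε, h⟩ := hx₀
      refine ⟨ε, hε, ?_⟩
      filter_upwards [Ultrafilter.eventually_not.2 h] with n hn i w hw
      by_contra hlt
      exact hn ⟨i, w, hw, not_le.1 hlt⟩
    obtain ⟨ε, hε, hev⟩ := hev
    obtain ⟨s, hs, hchart⟩ := exists_flattening_chart (r := r) (L := L) he hde hN hr hL
      (hdiam ⟨x₀, hxC⟩) hω_pos hω_mono x₀ hε
    have hex : ∀ n, ∃ Φ : Rn N → Rn N, (∀ i, ∀ w ∈ (S n i).boundary, ε ≤ dist x₀ w) →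
        (∃ y ∈ ⋃ i, (S n i).carrier, dist x₀ y < s) → 1 ≤ L ∧ BiLipOn L Φ (Metric.ball x₀ s) ∧
        (∀ y ∈ ⋃ i, (S n i).carrier, ‖Φ x₀‖ ≤ L * dist x₀ y) ∧
        ∀ z ∈ Metric.ball x₀ s, z ∈ ⋃ i, (S n i).carrier ↔ Φ z e = 0 := by
      intro n
      by_cases h : (∀ i, ∀ w ∈ (S n i).boundary, ε ≤ dist x₀ w) ∧
        ∃ y ∈ ⋃ i, (S n i).carrier, dist x₀ y < s
      · obtain ⟨h1, Φ, h2⟩ := hchart (S n) (hsep n) h.1 h.2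
        exact ⟨Φ, fun _ _ => ⟨h1, h2⟩⟩
      · exact ⟨0, fun h1 h2 => absurd ⟨h1, h2⟩ h⟩
    choose Φn hΦn using hex
    have hgood : ∀ᶠ n in (l : Filter ℕ), 1 ≤ L ∧ BiLipOn L (Φn n) (Metric.ball x₀ s) ∧
        (∀ y ∈ ⋃ i, (S n i).carrier, ‖Φn n x₀‖ ≤ L * dist x₀ y) ∧
        ∀ z ∈ Metric.ball x₀ s, z ∈ ⋃ i, (S n i).carrier ↔ Φn n z e = 0 := by
      filter_upwards [hev, hCn x₀ hxC s hs] with n h1 h2 using hΦn n h1 h2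
    have hL1 : 1 ≤ L := hgood.exists.choose_spec.1
    have h0 : Tendsto (fun n => Φn n x₀) l (𝓝 0) := by
      rw [Metric.tendsto_nhds]
      intro η hη
      filter_upwards [hgood, hCn x₀ hxC (η / L) (by positivity)] with n hn hy
      obtain ⟨y, hy, hyd⟩ := hy
      rw [dist_zero_right]
      refine (hn.2.2.1 y hy).trans_lt ?_
      rwa [mul_comm, ← lt_div_iff₀ hL]
    obtain ⟨Φ, hΦ, hΦ0, hΦlim, hΦu⟩ := exists_limit_chart l hL hs (hgood.mono fun n hn => hn.2.1) h0
    -- Near z there are points of the n-th union, on which the e-coordinate of Φn vanishes; the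
    -- Lipschitz bound carries this to z and then to the limit.
    have hΦC : ∀ z ∈ C, z ∈ Metric.ball x₀ s → Φ z e = 0 := by
      intro z hz hzs
      have hlim : Tendsto (fun n => |Φn n z e|) l (𝓝 |Φ z e|) := by
        have hc : Continuous fun y : Rn N => |y e| := by fun_prop
        exact (hc.tendsto (Φ z)).comp (hΦlim z hzs)
      refine abs_nonpos_iff.1 (le_of_forall_pos_le_add fun η hη => ?_)
      rw [zero_add]
      have hgap : 0 < s - dist z x₀ := sub_pos.2 hzs
      refine le_of_tendsto hlim ?_
      filter_upwards [hgood, hCn z hz (min (η / L) (s - dist z x₀)) (lt_min (by positivity) hgap)]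
        with n hn hy
      obtain ⟨y, hy, hyd⟩ := hy
      have hys : y ∈ Metric.ball x₀ s := by
        rw [Metric.mem_ball]
        have := dist_triangle y z x₀
        rw [dist_comm y z] at this
        linarith [hyd.trans_le (min_le_right _ _)]
      have hy0 := (hn.2.2.2 y hys).1 hy
      have h1 := (PiLp.norm_apply_le (Φn n z - Φn n y) e).trans (hn.2.1 z hzs y hys).2
      rw [PiLp.sub_apply, hy0, sub_zero, ← dist_eq_norm] at h1
      refine h1.trans ?_
      have h2 := hyd.le.trans (min_le_left _ _)
      rwa [mul_comm, ← le_div_iff₀ hL]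
    have hL4 : 1 ≤ L ^ 4 := one_le_pow₀ hL1
    have hL40 : 0 < L ^ 4 := zero_lt_one.trans_le hL4
    have hs4 : L ^ 4 * (s / (2 * L ^ 4)) = s / 2 := by field_simp
    -- Reflection needs L ^ 4 times the radius of the support to be less than s.
    refine ⟨s / (2 * L ^ 4), by positivity, fun F hF hF0 => ?_⟩
    refine mem_approximable_of_charts e hL1 hC (fun n => volume_iUnion_carrier hN hr hL (S n))
      (s := s) (by positivity) (by rw [hs4]; linarith) hΦ hΦ0 hΦC (Φn := Φn) ?_ ?_ hF hF0
    · filter_upwards [hgood] with n hn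
      exact ⟨hn.2.1.continuousOn hL, fun z hz h => (hn.2.2.2 z hz).2 h⟩
    · refine hΦu _ (isCompact_closedBall _ _) (Metric.closedBall_subset_ball ?_)
      have : L ^ 2 * (s / (2 * L ^ 4)) ≤ L ^ 4 * (s / (2 * L ^ 4)) :=
        mul_le_mul_of_nonneg_right (pow_le_pow_right₀ hL1 (by norm_num)) (by positivity)
      linarith
  · obtain ⟨s, hs, hsC⟩ := Metric.isOpen_iff.1 hC.isOpen_compl x₀ hxC
    -- Off C the localized field has no singular set at all, so it serves as its own approximation
    -- for every n.
    refine ⟨s / 2, half_pos hs, fun F hF hF0 ε hε => Eventually.of_forall fun n => ⟨F, ?_, ?_⟩⟩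
    · exact sobolev_mono (Set.empty_subset _) (mem_sobolev_empty_of_support hF Metric.isOpen_ball
        (isCompact_closedBall x₀ (s / 2)) (Metric.closedBall_subset_ball (half_lt_self hs))
        (Set.disjoint_left.2 fun x hx hxC' => hsC hx hxC') hF0)
    · simpa using hε

/-- The Sobolev fields with singular set `C` are approximated by Sobolev fields whose singular
sets are the given hypersurfaces. -/
theorem mem_approximable_of_mem_sobolev (l : Ultrafilter ℕ) (hN : 2 ≤ N) (hr : 0 < r) (hL : 0 < L)
    {Ω : Set (Rn N)} (hΩb : Bornology.IsBounded Ω) {ω : ℝ → ℝ} (hω_pos : ∀ t, 0 < t → 0 < ω t)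
    (hω_mono : MonotoneOn ω (Set.Ioi 0)) (hS : ∀ n i, (S n i).carrier ⊆ closure Ω)
    (hsep : ∀ n, IsSeparated ω Ω (S n)) {C : Set (Rn N)} (hC : IsClosed C) (hC0 : volume C = 0)
    (hdiam : C.Nonempty → 0 < Metric.diam Ω)
    (hCn : ∀ z ∈ C, ∀ ε > 0, ∀ᶠ n in (l : Filter ℕ), ∃ y ∈ ⋃ i, (S n i).carrier, dist z y < ε)
    {Q : Set (Rn N)} (hQ : IsCompact Q) {F : L2Field N} (hF : F ∈ sobolev C)
    (hF0 : ∀ᵐ x, x ∉ Q → F x = 0) :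
    F ∈ approximable (l : Filter ℕ) fun n => sobolev (⋃ i, (S n i).carrier) := by
  obtain ⟨A, hA, hvol⟩ := exists_volume_singularLimit_le (l := (l : Filter ℕ)) hN hr hL hΩb hω_pos
    hω_mono hS hsep
  have hT := isClosed_approximable (l : Filter ℕ) fun n => sobolev (⋃ i, (S n i).carrier)
  refine mem_of_truncations_mem hC hC0 hT hQ (fun m G hG hG0 hGm => ?_) hF hF0
  refine mem_of_mem_of_support_disjoint hC hC0 hT isClosed_singularLimit hA
    (show 0 < r / 12 by positivity) hvol (fun Q' hQ' hdisj H hH hH0 => ?_) hQ hG hG0 hGm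
  exact mem_of_locally_mem hQ' (fun x hx => exists_local_approximable l hN hr hL hω_pos hω_mono hsep
    hC hdiam hCn (Set.disjoint_left.1 hdisj hx)) hH hH0

/-- Elements of `approximable atTop W` are limits of sequences. -/
theorem exists_tendsto_of_mem_approximable {H : Type*} [NormedAddCommGroup H] [NormedSpace ℝ H]
    {W : ℕ → Submodule ℝ H} {x : H} (hx : x ∈ approximable atTop W) :
    ∃ u : ℕ → H, (∀ n, u n ∈ W n) ∧ Tendsto u atTop (𝓝 x) := by
  have hex : ∀ n, ∃ u ∈ W n, dist x u < Metric.infDist x (W n) + 1 / ((n : ℝ) + 1) := fun n =>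
    (Metric.infDist_lt_iff ⟨0, (W n).zero_mem⟩).1 (lt_add_of_pos_right _ (by positivity))
  choose u hu hxu using hex
  refine ⟨u, hu, Metric.tendsto_nhds.2 fun ε hε => ?_⟩
  filter_upwards [hx (ε / 2) (half_pos hε), (tendsto_one_div_add_atTop_nhds_zero_nat
    (𝕜 := ℝ)).eventually (gt_mem_nhds (half_pos hε))] with n hn hn'
  obtain ⟨y, hy, hxy⟩ := hn
  rw [← dist_eq_norm] at hxy
  have := Metric.infDist_le_dist_of_mem (x := x) (s := (W n : Set H)) hy
  rw [dist_comm]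
  linarith [hxu n]

end LowerLimit

/-! ### Passage between Ω and the whole space, and Mosco convergence -/

section Mosco

open scoped NNReal ENNReal

variable {N : ℕ}

theorem WeaklyConverges.of_tendsto {X : Type*} [NormedAddCommGroup X] [NormedSpace ℝ X]
    {u : ℕ → X} {x : X} (h : Tendsto u atTop (𝓝 x)) : WeaklyConverges u x := fun f =>
  (f.continuous.tendsto x).comp h

theorem strongLowerLimit_subset_weakUpperLimit {X : Type*} [NormedAddCommGroup X]
    [NormedSpace ℝ X] (A : ℕ → Submodule ℝ X) : strongLowerLimit A ⊆ weakUpperLimit A := by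
  rintro x ⟨u, hu, hux⟩
  exact ⟨id, strictMono_id, u, hu, WeaklyConverges.of_tendsto hux⟩

theorem setIntegral_mul_eq_of_tsupport_subset {A : Set (Rn N)} {f φ : Rn N → ℝ}
    (h : tsupport φ ⊆ A) : ∫ x in A, f x * φ x = ∫ x, f x * φ x :=
  setIntegral_eq_integral_of_forall_compl_eq_zero fun x hx => by
    rw [image_eq_zero_of_notMem_tsupport fun h' => hx (h h'), mul_zero]

theorem setIntegral_mul_partialDeriv_eq_of_tsupport_subset {A : Set (Rn N)} {f φ : Rn N → ℝ}
    (h : tsupport φ ⊆ A) (i : Fin N) :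
    ∫ x in A, f x * partialDeriv i φ x = ∫ x, f x * partialDeriv i φ x :=
  setIntegral_eq_integral_of_forall_compl_eq_zero fun x hx => by
    rw [partialDeriv_eq_zero_of_notMem_tsupport i fun h' => hx (h h'), mul_zero]

/-- Restriction to `Ω` of the fields on the whole space. -/
noncomputable def restrictField (Ω : Set (Rn N)) : L2Field N →L[ℝ] L2Vec Ω :=
  LpToLpRestrictCLM (Rn N) (EuclideanSpace ℝ (Fin (N + 1))) ℝ volume 2 Ω

theorem restrictField_ae (Ω : Set (Rn N)) (F : L2Field N) :
    ∀ᵐ x ∂(volume.restrict Ω), restrictField Ω F x = F x :=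
  LpToLpRestrictCLM_coeFn ℝ Ω F

/-- A test function supported in Ω ∖ K avoids both K and ∂Ω. The vanishing on K is void because K is
null. -/
theorem restrictField_mem_H1 {Ω K : Set (Rn N)} (hΩ : IsOpen Ω) (hK : volume K = 0)
    {F : L2Field N} (hF : F ∈ sobolev (K ∪ frontier Ω)) : restrictField Ω F ∈ H1 Ω K := by
  have hae := restrictField_ae Ω F
  have hae' := ae_restrict_of_ae_restrict_of_subset (Set.sdiff_subset (s := Ω) (t := K)) hae
  refine ⟨?_, fun φ h1 h2 h3 i => ?_⟩
  · filter_upwards [ae_restrict_of_ae (measure_eq_zero_iff_ae_notMem.1 hK)] with x hx hxK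
    exact absurd hxK hx
  · have ht : IsTest (K ∪ frontier Ω) φ := by
      refine ⟨h1, h2, Set.disjoint_left.2 fun x hx hxK => ?_⟩
      rcases hxK with hxK | hxf
      · exact (h3 hx).2 hxK
      · rw [hΩ.frontier_eq] at hxf
        exact hxf.2 (h3 hx).1
    have h := mem_sobolev.1 hF φ ht i
    rw [integral_congr_ae (g := fun x => F x 0 * partialDeriv i φ x)
        (hae'.mono fun x hx => by simp only [hx]),
      integral_congr_ae (f := fun x => restrictField Ω F x i.succ * φ x)
        (g := fun x => F x i.succ * φ x) (hae'.mono fun x hx => by simp only [hx]),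
      setIntegral_mul_partialDeriv_eq_of_tsupport_subset h3,
      setIntegral_mul_eq_of_tsupport_subset h3]
    exact h

/-- Extension by zero of the elements of `H¹(Ω ∖ K)`. -/
theorem exists_extension_of_mem_H1 {Ω K : Set (Rn N)} (hΩ : IsOpen Ω) {F : L2Vec Ω}
    (hF : F ∈ H1 Ω K) : ∃ G ∈ sobolev (K ∪ frontier Ω), restrictField Ω G = F ∧
      ∀ᵐ x, x ∉ Ω → G x = 0 := by
  have hm : MemLp (Ω.indicator F) 2 volume :=
    (memLp_indicator_iff_restrict hΩ.measurableSet).2 (Lp.memLp F)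
  obtain ⟨G, hG⟩ : ∃ G : L2Field N, ∀ᵐ x, G x = Ω.indicator F x := ⟨hm.toLp, hm.coeFn_toLp⟩
  refine ⟨G, ?_, ?_, ?_⟩
  · rw [mem_sobolev]
    intro φ hφ i
    -- φ vanishes near ∂Ω, so cutting it off at Ω keeps it smooth and gives a test function
    -- supported in Ω ∖ K.
    set ψ : Rn N → ℝ := Ω.indicator φ with hψ
    have hfr : ∀ x ∈ frontier Ω, ∀ᶠ y in 𝓝 x, φ y = 0 := fun x hx =>
      notMem_tsupport_iff_eventuallyEq.1 fun h => Set.disjoint_left.1 hφ.2.2 h (Or.inr hx)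
    have hloc : ∀ x, (x ∈ Ω ∧ ψ =ᶠ[𝓝 x] φ) ∨ (x ∉ Ω ∧ ψ =ᶠ[𝓝 x] 0) := by
      intro x
      by_cases hx : x ∈ Ω
      · refine Or.inl ⟨hx, ?_⟩
        filter_upwards [hΩ.mem_nhds hx] with y hy
        exact Set.indicator_of_mem hy _
      · refine Or.inr ⟨hx, ?_⟩
        by_cases hxc : x ∈ closure Ω
        · have hxf : x ∈ frontier Ω := by rw [hΩ.frontier_eq]; exact ⟨hxc, hx⟩
          filter_upwards [hfr x hxf] with y hy
          by_cases hyΩ : y ∈ Ω <;> simp [hψ, hyΩ, hy]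
        · filter_upwards [isClosed_closure.isOpen_compl.mem_nhds hxc] with y hy
          exact Set.indicator_of_notMem (fun h => hy (subset_closure h)) _
    have hψΩ : tsupport ψ ⊆ Ω := by
      intro x hx
      rcases hloc x with ⟨h, -⟩ | ⟨-, h⟩
      · exact h
      · exact absurd hx (notMem_tsupport_iff_eventuallyEq.2 h)
    have hψφ : tsupport ψ ⊆ tsupport φ := by
      refine closure_mono fun x hx => ?_
      rw [Function.mem_support] at hx ⊢
      intro h0
      apply hx
      by_cases hxΩ : x ∈ Ω <;> simp [hψ, hxΩ, h0]
    have hψK : tsupport ψ ⊆ Ω \ K := fun x hx =>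
      ⟨hψΩ hx, fun h => Set.disjoint_left.1 hφ.2.2 (hψφ hx) (Or.inl h)⟩
    have hψs : ContDiff ℝ (⊤ : ℕ∞) ψ := contDiff_iff_contDiffAt.2 fun x => by
      rcases hloc x with ⟨-, h⟩ | ⟨-, h⟩
      · exact hφ.1.contDiffAt.congr_of_eventuallyEq h
      · exact contDiffAt_const.congr_of_eventuallyEq h
    have hψc : HasCompactSupport ψ := hφ.2.1.of_isClosed_subset (isClosed_tsupport ψ) hψφ
    have h := hF.2 ψ hψs hψc hψK i
    rw [setIntegral_mul_partialDeriv_eq_of_tsupport_subset hψK,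
      setIntegral_mul_eq_of_tsupport_subset hψK] at h
    have e1 : ∫ x, G x 0 * partialDeriv i φ x = ∫ x, F x 0 * partialDeriv i ψ x := by
      refine integral_congr_ae ?_
      filter_upwards [hG] with x hx
      rw [hx]
      rcases hloc x with ⟨h, h'⟩ | ⟨h, h'⟩
      · rw [Set.indicator_of_mem h, partialDeriv, partialDeriv, h'.fderiv_eq]
      · rw [Set.indicator_of_notMem h, partialDeriv_eq_zero_of_eventuallyEq h']
        simp
    have e2 : ∫ x, G x i.succ * φ x = ∫ x, F x i.succ * ψ x := by
      refine integral_congr_ae ?_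
      filter_upwards [hG] with x hx
      rw [hx]
      by_cases hxΩ : x ∈ Ω <;> simp [hψ, hxΩ]
    rw [e1, e2, h]
  · refine Lp.ext ?_
    filter_upwards [restrictField_ae Ω G, ae_restrict_of_ae hG,
      ae_restrict_mem hΩ.measurableSet] with x h1 h2 h3
    rw [h1, h2, Set.indicator_of_mem h3]
  · filter_upwards [hG] with x hx hxΩ
    rw [hx, Set.indicator_of_notMem hxΩ]

/-- Weak limits of elements of `H¹(Ω ∖ K n)` belong to `H¹(Ω ∖ K)`. -/
theorem weakUpperLimit_subset_H1 {Ω : Set (Rn N)} {K : ℕ → Set (Rn N)} {Kinf : Set (Rn N)}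
    (hKc : IsCompact Kinf) (hK0 : volume Kinf = 0)
    (hconv : Tendsto (fun n => Metric.hausdorffEDist (K n) Kinf) atTop (𝓝 0)) :
    weakUpperLimit (fun n => H1 Ω (K n)) ⊆ H1 Ω Kinf := by
  rintro F ⟨n, hn, u, hu, hlim⟩
  refine ⟨?_, fun φ h1 h2 h3 i => ?_⟩
  · filter_upwards [ae_restrict_of_ae (measure_eq_zero_iff_ae_notMem.1 hK0)] with x hx hxK
    exact absurd hxK hx
  have hd1 : MemLp (partialDeriv i φ) 2 (volume.restrict Ω) :=
    (partialDeriv_continuous i h1).memLp_of_hasCompactSupport (partialDeriv_hasCompactSupport i h2)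
  have hd2 : MemLp φ 2 (volume.restrict Ω) := h1.continuous.memLp_of_hasCompactSupport h2
  obtain ⟨ρ, hρ, hρd⟩ := Metric.exists_pos_forall_lt_edist (s := tsupport φ) h2 hKc.isClosed
    (Set.disjoint_left.2 fun x hx => (h3 hx).2)
  have hev : ∀ᶠ k in atTop, tsupport φ ⊆ Ω \ K (n k) := by
    filter_upwards [hn.tendsto_atTop.eventually
      (hconv.eventually (gt_mem_nhds (ENNReal.coe_pos.2 hρ)))] with k hk x hx
    refine ⟨(h3 hx).1, fun hxK => ?_⟩
    obtain ⟨y, hy, hxy⟩ := Metric.exists_edist_lt_of_hausdorffEDist_lt hxK hk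
    exact lt_asymm hxy (hρd x hx y hy)
  -- Once the support of φ avoids K', both integrals are continuous functionals of the field which
  -- no longer depend on K', so weak limits apply.
  have hconvert : ∀ (G : L2Vec Ω) (K' : Set (Rn N)), tsupport φ ⊆ Ω \ K' →
      ∫ x in Ω \ K', G x 0 * partialDeriv i φ x = coordCLM hd1 0 G ∧
      ∫ x in Ω \ K', G x i.succ * φ x = coordCLM hd2 i.succ G := by
    intro G K' h
    have h' : tsupport φ ⊆ Ω := h.trans Set.sdiff_subset
    rw [coordCLM_apply, coordCLM_apply, setIntegral_mul_partialDeriv_eq_of_tsupport_subset h,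
      setIntegral_mul_partialDeriv_eq_of_tsupport_subset h',
      setIntegral_mul_eq_of_tsupport_subset h, setIntegral_mul_eq_of_tsupport_subset h']
    exact ⟨rfl, rfl⟩
  rw [(hconvert F Kinf h3).1, (hconvert F Kinf h3).2]
  refine tendsto_nhds_unique (hlim (coordCLM hd1 0)) ?_
  refine (hlim (coordCLM hd2 i.succ)).neg.congr' ?_
  filter_upwards [hev] with k hk
  rw [← (hconvert (u k) _ hk).1, ← (hconvert (u k) _ hk).2]
  exact ((hu k).2 φ h1 h2 hk i).symm

theorem diam_pos_of_isOpen (hN : 2 ≤ N) {Ω : Set (Rn N)} (hΩ : IsOpen Ω)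
    (hΩb : Bornology.IsBounded Ω) (hne : Ω.Nonempty) : 0 < Metric.diam Ω := by
  obtain ⟨x, hx⟩ := hne
  obtain ⟨ε, hε, hb⟩ := Metric.isOpen_iff.1 hΩ x hx
  set z : Rn N := x + EuclideanSpace.single (⟨0, by omega⟩ : Fin N) (ε / 2) with hz
  have hzx : dist z x = ε / 2 := by
    rw [dist_eq_norm, hz, add_sub_cancel_left]; simp [abs_of_pos hε]
  have := Metric.dist_le_diam_of_mem hΩb (hb (show z ∈ Metric.ball x ε by
    rw [Metric.mem_ball, hzx]; linarith)) hx
  linarith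

end Mosco

theorem mainTheorem1 (N : ℕ) (hN : 2 ≤ N) (Ω : Set (Rn N)) (hΩo : IsOpen Ω)
    (hΩb : Bornology.IsBounded Ω) (r L : ℝ) (hr : 0 < r) (hL : 0 < L)
    (hΩ : HasLipschitzHypersurfaceBoundary r L Ω)
    (ω : ℝ → ℝ) (hω_pos : ∀ t, 0 < t → 0 < ω t) (hω_mono : MonotoneOn ω (Set.Ioi 0))
    (hω_left : ∀ t, 0 < t → ContinuousWithinAt ω (Set.Iic t) t)
    (K : ℕ → Set (Rn N)) (hK : ∀ n, K n ∈ BTilde r L ω Ω)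
    (Kinf : Set (Rn N)) (hKinf : Kinf ∈ BTilde r L ω Ω)
    (hconv : Tendsto (fun n => Metric.hausdorffEDist (K n) Kinf) atTop (𝓝 0)) :
    MoscoConverges (fun n => H1 Ω (K n)) (H1 Ω Kinf) := by
  choose hKc hKΩ M S hS hKS hsep using hK
  obtain ⟨hKic, hKiΩ, M', S', hS', hKS', -⟩ := hKinf
  have hnull : ∀ n, volume (K n) = 0 := fun n =>
    measure_mono_null (Set.subset_union_left.trans (hKS n).subset)
      (volume_iUnion_carrier hN hr hL (S n))
  have hC0 : volume (Kinf ∪ frontier Ω) = 0 := by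
    rw [hKS']; exact volume_iUnion_carrier hN hr hL S'
  have hC : IsClosed (Kinf ∪ frontier Ω) := hKic.isClosed.union isClosed_frontier
  -- Ω may be empty; then so is the singular set, and no lower bound on the diameter is required.
  have hdiam : (Kinf ∪ frontier Ω).Nonempty → 0 < Metric.diam Ω := by
    rintro ⟨x, hx⟩
    have hx' : x ∈ closure Ω := hx.elim (fun h => hKiΩ h) fun h => frontier_subset_closure h
    exact diam_pos_of_isOpen hN hΩo hΩb (closure_nonempty_iff.1 ⟨x, hx'⟩)
  have hupper := weakUpperLimit_subset_H1 (Ω := Ω) hKic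
    (measure_mono_null Set.subset_union_left hC0) hconv
  have hlower : (H1 Ω Kinf : Set (L2Vec Ω)) ⊆ strongLowerLimit fun n => H1 Ω (K n) := by
    intro F hF
    obtain ⟨G, hG, hGF, hG0⟩ := exists_extension_of_mem_H1 hΩo hF
    have happ : G ∈ approximable atTop fun n => sobolev (⋃ i, (S n i).carrier) := by
      intro ε hε
      -- A set belongs to `atTop` as soon as it belongs to every ultrafilter l ≤ `atTop`.
      refine mem_iff_ultrafilter.2 fun l hl => ?_
      refine mem_approximable_of_mem_sobolev l hN hr hL hΩb hω_pos hω_mono hS hsep hC hC0 hdiam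
        (fun z hz η hη => ?_) hΩb.isCompact_closure hG ?_ ε hε
      -- Points of `Kinf` are approached by the K n through Hausdorff convergence; points of ∂Ω
      -- belong to every union of hypersurfaces.
      · rcases hz with hz | hz
        · have hη' : (0 : ENNReal) < ENNReal.ofReal η := ENNReal.ofReal_pos.2 hη
          filter_upwards [hl (hconv.eventually (gt_mem_nhds hη'))] with n hn
          rw [Metric.hausdorffEDist_comm] at hn
          obtain ⟨y, hy, hzy⟩ := Metric.exists_edist_lt_of_hausdorffEDist_lt hz hn
          refine ⟨y, hKS n ▸ Or.inl hy, ?_⟩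
          rw [edist_dist] at hzy
          exact (ENNReal.ofReal_lt_ofReal_iff hη).1 hzy
        · exact Eventually.of_forall fun n => ⟨z, hKS n ▸ Or.inr hz, by simpa using hη⟩
      · filter_upwards [hG0] with x hx hxΩ
        exact hx fun h => hxΩ (subset_closure h)
    obtain ⟨u, hu, hlim⟩ := exists_tendsto_of_mem_approximable happ
    refine ⟨fun n => restrictField Ω (u n), fun n => ?_, ?_⟩
    · have := hu n
      rw [← hKS n] at this
      exact restrictField_mem_H1 hΩo (hnull n) this
    · rw [← hGF]
      exact ((restrictField Ω).continuous.tendsto G).comp hlim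
  -- The inclusions H¹ ⊆ strong lower limit ⊆ weak upper limit ⊆ H¹ close a cycle.
  exact ⟨hupper.antisymm (hlower.trans (strongLowerLimit_subset_weakUpperLimit _)),
    ((strongLowerLimit_subset_weakUpperLimit _).trans hupper).antisymm hlower⟩
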